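/- Let $\mathbb F$ be a field of prime characteristic $p>3$, let $m,n\ge 3$ be integers and let $\underline t=(t_1,\dots,t_m)$ be a tuple of positive integers. Let $\mathfrak A(m)$ be the divided power algebra over $\mathbb F$ with basis $\{x^{(\alpha)}\mid\alpha\in\mathbb N_0^m\}$ and multiplication $x^{(\alpha)}x^{(\beta)}=\binom{\alpha+\beta}{\alpha}x^{(\alpha+\beta)}$, let $\Lambda(n)$ be the exterior superalgebra over $\mathbb F$ in $n$ variables $x_{m+1},\dots,x_{m+n}$, and let $\mathfrak A(m,n)=\mathfrak A(m)\otimes_{\mathbb F}\Lambda(n)$, with the $\mathbb Z/2$-grading induced by that of $\Lambda(n)$. Let $D_1,\dots,D_{m+n}$ be the superderivations of $\mathfrak A(m,n)$ given, for $f\in\mathfrak A(m)$ and $\omega\in\Lambda(n)$, by $D_i(x^{(\alpha)}\omega)=x^{(\alpha-\varepsilon_i)}\omega$ for $1\le i\le m$ (read as $0$ if $\alpha_i=0$) and $D_k(f\omega)=f\cdot\partial\omega/\partial x_k$ for $m<k\le m+n$. Put $\mathfrak A(m,n;\underline t)=\mathrm{span}_{\mathbb F}\{x^{(\alpha)}\omega\mid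 0\le\alpha_i\le p^{t_i}-1\ (1\le i\le m),\ \omega\in\Lambda(n)\}$, let $W=W(m,n;\underline t)=\{\sum_{r=1}^{m+n}f_rD_r\mid f_r\in\mathfrak A(m,n;\underline t)\}$ be the generalized Witt Lie superalgebra (with the supercommutator as bracket), and let $\mathcal W=W_{\bar 0}$ be its even part, a Lie algebra over $\mathbb F$. Then the derivation algebra $\mathrm{Der}(\mathcal W)$ of the Lie algebra $\mathcal W$ is finite-dimensional, and $$\dim_{\mathbb F}\mathrm{Der}(\mathcal W)=(m+n)\,2^{n-1}\,p^{\sum_{i=1}^m t_i}+\sum_{i=1}^m t_i-m.$$ -/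

import Mathlib

open scoped TensorProduct

attribute [local instance 100] LieRing.ofAssociativeRing

noncomputable section

namespace WittSuper

/-! ### The divided power algebra `𝔄(m)` -/

/-- The divided power algebra in `m` variables over `F`: the free `F`-module with basis
`x^(α)`, `α ∈ ℕ^m` (multiplication: `mulMap`). -/
def DividedPow (F : Type*) [CommRing F] (m : ℕ) : Type _ := (Fin m → ℕ) →₀ F

namespace DividedPow

variable {F : Type*} [CommRing F] {m : ℕ}

instance : AddCommGroup (DividedPow F m) := inferInstanceAs (AddCommGroup ((Fin m → ℕ) →₀ F))

instance : Module F (DividedPow F m) := inferInstanceAs (Module F ((Fin m → ℕ) →₀ F))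

/-- The standard basis `x^(α)` of the divided power algebra. -/
def basis (F : Type*) [CommRing F] (m : ℕ) : Module.Basis (Fin m → ℕ) F (DividedPow F m) :=
  Module.Basis.ofRepr (LinearEquiv.refl F ((Fin m → ℕ) →₀ F))

/-- The divided power monomial `x^(α)`. -/
def x (F : Type*) [CommRing F] {m : ℕ} (α : Fin m → ℕ) : DividedPow F m := basis F m α

/-- `binom (α + β) α = ∏ i, binom (α i + β i) (α i)`. -/
def binom {m : ℕ} (α β : Fin m → ℕ) : ℕ := ∏ i, (α i + β i).choose (α i)

/-- The multiplication `x^(α) x^(β) = binom (α + β) α • x^(α + β)`, extended bilinearly. -/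
def mulMap (F : Type*) [CommRing F] (m : ℕ) :
    DividedPow F m →ₗ[F] DividedPow F m →ₗ[F] DividedPow F m :=
  (basis F m).constr F fun α => (basis F m).constr F fun β => (binom α β : F) • x F (α + β)

instance : Mul (DividedPow F m) := ⟨fun f g => mulMap F m f g⟩

instance : One (DividedPow F m) := ⟨x F 0⟩

theorem mul_def (f g : DividedPow F m) : f * g = mulMap F m f g := rfl

theorem one_def : (1 : DividedPow F m) = x F 0 := rfl

theorem mulMap_x (α β : Fin m → ℕ) :
    mulMap F m (x F α) (x F β) = (binom α β : F) • x F (α + β) := by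
  unfold mulMap x
  rw [Module.Basis.constr_basis, Module.Basis.constr_basis]

theorem x_mul_x (α β : Fin m → ℕ) : x F α * x F β = (binom α β : F) • x F (α + β) :=
  mulMap_x α β

theorem binom_comm (α β : Fin m → ℕ) : binom α β = binom β α := by
  unfold binom
  refine Finset.prod_congr rfl fun i _ => ?_
  rw [Nat.choose_symm_add, add_comm]

theorem binom_assoc (α β γ : Fin m → ℕ) :
    binom α β * binom (α + β) γ = binom β γ * binom α (β + γ) := by
  unfold binom
  rw [← Finset.prod_mul_distrib, ← Finset.prod_mul_distrib]
  refine Finset.prod_congr rfl fun i _ => ?_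
  simp only [Pi.add_apply]
  have h := Nat.choose_mul (n := α i + β i + γ i) (k := α i + β i) (s := α i)
    (Nat.le_add_right _ _)
  rw [mul_comm, h, mul_comm]
  congr 2 <;> omega

theorem mulMap_comm (f g : DividedPow F m) : mulMap F m f g = mulMap F m g f := by
  have h : mulMap F m = (mulMap F m).flip := by
    refine (basis F m).ext fun α => (basis F m).ext fun β => ?_
    change mulMap F m (x F α) (x F β) = mulMap F m (x F β) (x F α)
    rw [mulMap_x, mulMap_x, binom_comm, add_comm]
  exact congrArg (fun L => L f g) h

theorem mulMap_one (g : DividedPow F m) : mulMap F m (x F 0) g = g := by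
  have h : mulMap F m (x F 0) = LinearMap.id := by
    refine (basis F m).ext fun β => ?_
    change mulMap F m (x F 0) (x F β) = x F β
    rw [mulMap_x]
    simp [binom]
  exact congrArg (fun L => L g) h

theorem mulMap_assoc (f g h : DividedPow F m) :
    mulMap F m (mulMap F m f g) h = mulMap F m f (mulMap F m g h) := by
  have key : (mulMap F m).compr₂ (mulMap F m) =
      (LinearMap.llcomp F (DividedPow F m) (DividedPow F m) (DividedPow F m)).compl₁₂
        (mulMap F m) (mulMap F m) := by
    refine (basis F m).ext fun α => (basis F m).ext fun β => (basis F m).ext fun γ => ?_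
    change mulMap F m (mulMap F m (x F α) (x F β)) (x F γ) =
      mulMap F m (x F α) (mulMap F m (x F β) (x F γ))
    simp only [mulMap_x, map_smul, LinearMap.smul_apply, smul_smul, ← Nat.cast_mul]
    rw [binom_assoc, add_assoc]
  exact congrArg (fun L => L f g h) key

instance : CommRing (DividedPow F m) :=
  { (inferInstance : AddCommGroup (DividedPow F m)) with
    mul := (· * ·)
    one := 1
    mul_assoc := mulMap_assoc
    mul_comm := mulMap_comm
    one_mul := mulMap_one
    mul_one := fun f => (mulMap_comm f _).trans (mulMap_one f)
    left_distrib := fun f g h => map_add (mulMap F m f) g h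
    right_distrib := fun f g h => LinearMap.map_add₂ (mulMap F m) f g h
    zero_mul := fun f => LinearMap.map_zero₂ (mulMap F m) f
    mul_zero := fun f => map_zero (mulMap F m f) }

instance : Algebra F (DividedPow F m) :=
  Algebra.ofModule (fun r f g => LinearMap.map_smul₂ (mulMap F m) r f g)
    (fun r f g => map_smul (mulMap F m f) r g)

/-- The special derivation `x^(α) ↦ x^(α - ε_i)` (`0` if `α i = 0`). -/
def partialD (F : Type*) [CommRing F] {m : ℕ} (i : Fin m) : DividedPow F m →ₗ[F] DividedPow F m :=
  (basis F m).constr F fun α => if α i = 0 then 0 else x F (α - Pi.single i 1)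

theorem partialD_x (i : Fin m) (α : Fin m → ℕ) :
    partialD F i (x F α) = if α i = 0 then 0 else x F (α - Pi.single i 1) := by
  unfold partialD x
  rw [Module.Basis.constr_basis]

theorem partialD_x_add (i : Fin m) (α : Fin m → ℕ) :
    partialD F i (x F (α + Pi.single i 1)) = x F α := by
  rw [partialD_x, if_neg (by simp)]
  simp

theorem partialD_x_zero (i : Fin m) (α : Fin m → ℕ) (h : α i = 0) :
    partialD F i (x F α) = 0 := by
  rw [partialD_x, if_pos h]

theorem exists_add (i : Fin m) (α : Fin m → ℕ) (h : α i ≠ 0) :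
    ∃ α' : Fin m → ℕ, α = α' + Pi.single i 1 := by
  refine ⟨α - Pi.single i 1, funext fun j => ?_⟩
  by_cases hj : j = i
  · subst hj; simp; omega
  · simp [Pi.single_eq_of_ne hj]

theorem binom_split (i : Fin m) (α β : Fin m → ℕ) :
    binom α β = (α i + β i).choose (α i) *
      ∏ j ∈ Finset.univ.erase i, (α j + β j).choose (α j) :=
  (Finset.mul_prod_erase _ _ (Finset.mem_univ i)).symm

theorem binom_pascal (i : Fin m) (α β : Fin m → ℕ) :
    binom (α + Pi.single i 1) (β + Pi.single i 1) =
      binom α (β + Pi.single i 1) + binom (α + Pi.single i 1) β := by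
  have h : ∀ j ∈ Finset.univ.erase i, (Pi.single i 1 : Fin m → ℕ) j = 0 := fun j hj =>
    Pi.single_eq_of_ne (Finset.ne_of_mem_erase hj) _
  have h1 : ∀ a b : Fin m → ℕ, (∀ j ∈ Finset.univ.erase i, a j = α j) →
      (∀ j ∈ Finset.univ.erase i, b j = β j) →
      ∏ j ∈ Finset.univ.erase i, (a j + b j).choose (a j) =
        ∏ j ∈ Finset.univ.erase i, (α j + β j).choose (α j) := fun a b ha hb =>
    Finset.prod_congr rfl fun j hj => by rw [ha j hj, hb j hj]
  have hα : ∀ j ∈ Finset.univ.erase i, (α + Pi.single i 1 : Fin m → ℕ) j = α j :=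
    fun j hj => by simp [h j hj]
  have hβ : ∀ j ∈ Finset.univ.erase i, (β + Pi.single i 1 : Fin m → ℕ) j = β j :=
    fun j hj => by simp [h j hj]
  rw [binom_split i, binom_split i α, binom_split i _ β, h1 _ _ hα hβ,
    h1 _ _ (fun _ _ => rfl) hβ, h1 _ _ hα (fun _ _ => rfl), ← add_mul]
  congr 1
  simp only [Pi.add_apply, Pi.single_eq_same]
  rw [show α i + 1 + (β i + 1) = (α i + β i + 1) + 1 by ring, Nat.choose_succ_succ]
  congr 2; ring

theorem binom_zero (i : Fin m) (α β : Fin m → ℕ) (h : α i = 0) :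
    binom α (β + Pi.single i 1) = binom α β := by
  unfold binom
  refine Finset.prod_congr rfl fun j _ => ?_
  by_cases hj : j = i
  · subst hj; simp [h]
  · simp [Pi.single_eq_of_ne hj]

theorem partialD_mul (i : Fin m) (f g : DividedPow F m) :
    partialD F i (f * g) = partialD F i f * g + f * partialD F i g := by
  have key : (mulMap F m).compr₂ (partialD F i) =
      (mulMap F m).comp (partialD F i) + (mulMap F m).compl₂ (partialD F i) := by
    refine (basis F m).ext fun α => (basis F m).ext fun β => ?_
    change partialD F i (mulMap F m (x F α) (x F β)) =
      mulMap F m (partialD F i (x F α)) (x F β) + mulMap F m (x F α) (partialD F i (x F β))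
    rw [mulMap_x, map_smul]
    by_cases hα : α i = 0
    · rw [partialD_x_zero i α hα, LinearMap.map_zero₂, zero_add]
      by_cases hβ : β i = 0
      · rw [partialD_x_zero i β hβ, partialD_x_zero i _ (by simp [hα, hβ])]
        simp
      · obtain ⟨β, rfl⟩ := exists_add i β hβ
        rw [← add_assoc, partialD_x_add, partialD_x_add, mulMap_x, binom_zero i _ _ hα]
    · obtain ⟨α, rfl⟩ := exists_add i α hα
      rw [partialD_x_add]
      by_cases hβ : β i = 0
      · rw [partialD_x_zero i β hβ, map_zero, add_zero, add_right_comm, partialD_x_add, mulMap_x,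
          binom_comm, binom_zero i _ _ hβ, binom_comm]
      · obtain ⟨β, rfl⟩ := exists_add i β hβ
        rw [← add_assoc, partialD_x_add, partialD_x_add, mulMap_x, mulMap_x, binom_pascal,
          Nat.cast_add, add_smul, add_right_comm α, add_assoc α]
  exact congrArg (fun L => L f g) key

theorem partialD_comm (i j : Fin m) (f : DividedPow F m) :
    partialD F i (partialD F j f) = partialD F j (partialD F i f) := by
  have key : partialD F i ∘ₗ partialD F j = partialD F j ∘ₗ partialD F i := by
    rcases eq_or_ne i j with rfl | hij
    · rfl
    refine (basis F m).ext fun α => ?_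
    change partialD F i (partialD F j (x F α)) = partialD F j (partialD F i (x F α))
    rw [partialD_x, partialD_x]
    split_ifs with h1 h2 h2
    · simp
    · rw [map_zero, partialD_x, if_pos]
      simp [h1]
    · rw [map_zero, partialD_x, if_pos]
      simp [h2]
    · rw [partialD_x, partialD_x, if_neg, if_neg, tsub_right_comm]
      · simpa [Pi.single_eq_of_ne hij.symm] using h1
      · simpa [Pi.single_eq_of_ne hij] using h2
  exact congrArg (fun L => L f) key

theorem binom_eq_zero (p : ℕ) [Fact p.Prime] [CharP F p] (t α β : Fin m → ℕ)
    (hα : ∀ i, α i < p ^ t i) (hβ : ∀ i, β i < p ^ t i) (i : Fin m)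
    (h : p ^ t i ≤ α i + β i) : (binom α β : F) = 0 := by
  have hp : p.Prime := Fact.out
  rw [CharP.cast_eq_zero_iff F p]
  refine Dvd.dvd.trans ?_ (Finset.dvd_prod_of_mem _ (Finset.mem_univ i))
  have ht : 1 ≤ t i := by
    by_contra h0
    have h0 : t i = 0 := by omega
    have h1 := hα i
    have h2 := hβ i
    rw [h0, pow_zero] at h1 h2 h
    omega
  have hpos : 0 < ((α i + β i).choose (α i)).factorization p := by
    rw [add_comm (α i),
      Nat.factorization_choose' hp (Nat.lt_add_one (Nat.log p (β i + α i))), Finset.card_pos]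
    refine ⟨t i, ?_⟩
    rw [Finset.mem_filter, Finset.mem_Ico, Nat.mod_eq_of_lt (hα i), Nat.mod_eq_of_lt (hβ i)]
    refine ⟨⟨ht, Nat.lt_succ_of_le (Nat.le_log_of_pow_le hp.one_lt (by omega))⟩, by omega⟩
  exact Nat.dvd_of_factorization_pos hpos.ne'

end DividedPow

/-! ### The superalgebra `𝔄(m,n)` and its special superderivations -/

/-- The exterior algebra `Λ(n)` on `n` generators. -/
abbrev Ext (F : Type*) [CommRing F] (n : ℕ) : Type _ := ExteriorAlgebra F (Fin n → F)

/-- `𝔄(m,n) = 𝔄(m) ⊗ Λ(n)`. Since `𝔄(m)` is purely even, the product is the ordinary one of a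
tensor product of algebras. -/
def Alg (F : Type*) [CommRing F] (m n : ℕ) : Type _ := DividedPow F m ⊗[F] Ext F n

instance (F : Type*) [CommRing F] (m n : ℕ) : Ring (Alg F m n) :=
  inferInstanceAs (Ring (DividedPow F m ⊗[F] Ext F n))

instance (F : Type*) [CommRing F] (m n : ℕ) : Algebra F (Alg F m n) :=
  inferInstanceAs (Algebra F (DividedPow F m ⊗[F] Ext F n))

/-- The pure tensor `f ⊗ ω ∈ 𝔄(m,n)`, as a bilinear map. -/
def tmul {F : Type*} [CommRing F] {m n : ℕ} :
    DividedPow F m →ₗ[F] Ext F n →ₗ[F] Alg F m n :=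
  TensorProduct.mk F (DividedPow F m) (Ext F n)

theorem tmul_mul_tmul {F : Type*} [CommRing F] {m n : ℕ} (f g : DividedPow F m)
    (ω η : Ext F n) : tmul f ω * tmul g η = tmul (f * g) (ω * η) :=
  Algebra.TensorProduct.tmul_mul_tmul f g ω η

theorem tmul_one_one {F : Type*} [CommRing F] {m n : ℕ} :
    tmul (1 : DividedPow F m) (1 : Ext F n) = 1 := rfl

theorem Alg.induction {F : Type*} [CommRing F] {m n : ℕ} {P : Alg F m n → Prop}
    (a : Alg F m n) (zero : P 0) (tmul : ∀ f ω, P (tmul f ω))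
    (add : ∀ a b, P a → P b → P (a + b)) : P a :=
  TensorProduct.induction_on a zero tmul add

/-- The homogeneous component `𝔄(m,n)_θ`, `θ ∈ ℤ/2`. -/
def parityPart (F : Type*) [CommRing F] (m n : ℕ) (θ : ZMod 2) : Submodule F (Alg F m n) :=
  Submodule.span F
    {a | ∃ (f : DividedPow F m) (ω : Ext F n),
      ω ∈ CliffordAlgebra.evenOdd (0 : QuadraticForm F (Fin n → F)) θ ∧ a = tmul f ω}

/-- `∂/∂x_k` on `Λ(n)`: the left odd superderivation with `x_l ↦ δ_{kl}`. -/
def extD (F : Type*) [CommRing F] {n : ℕ} (k : Fin n) : Ext F n →ₗ[F] Ext F n :=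
  CliffordAlgebra.contractLeft (Q := (0 : QuadraticForm F (Fin n → F))) (LinearMap.proj k)

/-- The superderivations `D_r` of `𝔄(m,n)`; the index set `Y` is `Fin m ⊕ Fin n`, the left summand
giving the even and the right summand the odd indices. -/
def D (F : Type*) [CommRing F] {m n : ℕ} : Fin m ⊕ Fin n → Module.End F (Alg F m n)
  | Sum.inl i => (DividedPow.partialD F i).rTensor (Ext F n)
  | Sum.inr k => (extD F k).lTensor (DividedPow F m)

/-- The operator `∑ r, f_r D_r` on `𝔄(m,n)`. -/
def vectorField {F : Type*} [CommRing F] {m n : ℕ} (f : Fin m ⊕ Fin n → Alg F m n) :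
    Module.End F (Alg F m n) :=
  ∑ r, LinearMap.mulLeft F (f r) * D F r

theorem vectorField_apply {F : Type*} [CommRing F] {m n : ℕ} (f : Fin m ⊕ Fin n → Alg F m n)
    (a : Alg F m n) : vectorField f a = ∑ r, f r * D F r a := by
  simp [vectorField]

/-- The truncation `𝔄(m,n;t)`: the span of all `x^(α) ω` with `α i ≤ p ^ t i - 1` and
`ω ∈ Λ(n)`. -/
def truncAlg (F : Type*) [CommRing F] {m : ℕ} (n p : ℕ) (t : Fin m → ℕ) :
    Submodule F (Alg F m n) :=
  Submodule.span F
    {a | ∃ (α : Fin m → ℕ) (ω : Ext F n),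
      (∀ i, α i < p ^ t i) ∧ a = tmul (DividedPow.x F α) ω}

/-- The generalized Witt superalgebra `W(m,n;t) = {∑ r, f_r D_r | f_r ∈ 𝔄(m,n;t)}`, as a space of
operators on `𝔄(m,n)`. -/
def W (F : Type*) [CommRing F] {m : ℕ} (n p : ℕ) (t : Fin m → ℕ) :
    Submodule F (Module.End F (Alg F m n)) where
  carrier := {E | ∃ f : Fin m ⊕ Fin n → Alg F m n,
    (∀ r, f r ∈ truncAlg F n p t) ∧ E = vectorField f}
  zero_mem' := ⟨0, fun _ => zero_mem _, by simp [vectorField]⟩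
  add_mem' := by
    rintro _ _ ⟨f, hf, rfl⟩ ⟨g, hg, rfl⟩
    refine ⟨f + g, fun r => add_mem (hf r) (hg r), LinearMap.ext fun a => ?_⟩
    simp only [vectorField_apply, LinearMap.add_apply, Pi.add_apply, add_mul,
      Finset.sum_add_distrib]
  smul_mem' := by
    rintro c _ ⟨f, hf, rfl⟩
    refine ⟨c • f, fun r => Submodule.smul_mem _ c (hf r), LinearMap.ext fun a => ?_⟩
    simp only [vectorField_apply, LinearMap.smul_apply, Pi.smul_apply, Finset.smul_sum,
      smul_mul_assoc]

/-- The even operators `End(𝔄(m,n))_0`: those that preserve both homogeneous components. -/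
def evenEnd (F : Type*) [CommRing F] (m n : ℕ) : Submodule F (Module.End F (Alg F m n)) where
  carrier := {E | ∀ θ : ZMod 2, ∀ a ∈ parityPart F m n θ, E a ∈ parityPart F m n θ}
  zero_mem' := fun _ _ _ => zero_mem _
  add_mem' := fun hE hE' θ a ha => add_mem (hE θ a ha) (hE' θ a ha)
  smul_mem' := fun c _ hE θ a ha => Submodule.smul_mem _ c (hE θ a ha)

/-! ### The even part is closed under the commutator -/

section exterior
variable {F : Type*} [CommRing F] {n : ℕ}

/-- The homogeneous component `Λ(n)_θ`. -/
abbrev extPart (F : Type*) [CommRing F] (n : ℕ) (θ : ZMod 2) : Submodule F (Ext F n) :=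
  CliffordAlgebra.evenOdd (0 : QuadraticForm F (Fin n → F)) θ

theorem extD_ι (k : Fin n) (v : Fin n → F) :
    extD F k (ExteriorAlgebra.ι F v) = algebraMap F _ (v k) :=
  CliffordAlgebra.contractLeft_ι (Q := (0 : QuadraticForm F (Fin n → F))) (LinearMap.proj k) v

theorem extD_ι_mul (k : Fin n) (v : Fin n → F) (b : Ext F n) :
    extD F k (ExteriorAlgebra.ι F v * b) = v k • b - ExteriorAlgebra.ι F v * extD F k b :=
  CliffordAlgebra.contractLeft_ι_mul (Q := (0 : QuadraticForm F (Fin n → F)))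
    (LinearMap.proj k) v b

theorem extD_comm (k l : Fin n) (b : Ext F n) :
    extD F k (extD F l b) = -extD F l (extD F k b) :=
  CliffordAlgebra.contractLeft_comm (Q := (0 : QuadraticForm F (Fin n → F)))
    (LinearMap.proj k) (LinearMap.proj l) b

theorem ι_mul_anticomm (v w : Fin n → F) :
    ExteriorAlgebra.ι F v * ExteriorAlgebra.ι F w =
      -(ExteriorAlgebra.ι F w * ExteriorAlgebra.ι F v) :=
  eq_neg_of_add_eq_zero_left (ExteriorAlgebra.ι_add_mul_swap v w)

theorem extD_even_mul (k : Fin n) {a : Ext F n} (ha : a ∈ extPart F n 0) (b : Ext F n) :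
    extD F k (a * b) = extD F k a * b + a * extD F k b := by
  induction a, ha using CliffordAlgebra.even_induction generalizing b with
  | algebraMap r =>
    rw [Algebra.algebraMap_eq_smul_one]
    have : extD F k (1 : Ext F n) = 0 := CliffordAlgebra.contractLeft_one
      (Q := (0 : QuadraticForm F (Fin n → F))) (LinearMap.proj k)
    simp [this]
  | add x y hx hy ihx ihy => rw [add_mul, map_add, ihx, ihy, map_add]; noncomm_ring
  | ι_mul_ι_mul m₁ m₂ x hx ih =>
    change extD F k (ExteriorAlgebra.ι F m₁ * ExteriorAlgebra.ι F m₂ * x * b) =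
      extD F k (ExteriorAlgebra.ι F m₁ * ExteriorAlgebra.ι F m₂ * x) * b +
      ExteriorAlgebra.ι F m₁ * ExteriorAlgebra.ι F m₂ * x * extD F k b
    simp only [mul_assoc, extD_ι_mul, ih]
    simp only [mul_sub, sub_mul, mul_add, mul_smul_comm, smul_mul_assoc, mul_assoc]
    abel

theorem extD_odd_mul (k : Fin n) {a : Ext F n} (ha : a ∈ extPart F n 1) (b : Ext F n) :
    extD F k (a * b) = extD F k a * b - a * extD F k b := by
  induction a, ha using CliffordAlgebra.odd_induction generalizing b with
  | ι v =>
    change extD F k (ExteriorAlgebra.ι F v * b) = extD F k (ExteriorAlgebra.ι F v) * b -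
      ExteriorAlgebra.ι F v * extD F k b
    rw [extD_ι_mul, extD_ι, Algebra.smul_def]
  | add x y hx hy ihx ihy => rw [add_mul, map_add, ihx, ihy, map_add]; noncomm_ring
  | ι_mul_ι_mul m₁ m₂ x hx ih =>
    change extD F k (ExteriorAlgebra.ι F m₁ * ExteriorAlgebra.ι F m₂ * x * b) =
      extD F k (ExteriorAlgebra.ι F m₁ * ExteriorAlgebra.ι F m₂ * x) * b -
      ExteriorAlgebra.ι F m₁ * ExteriorAlgebra.ι F m₂ * x * extD F k b
    simp only [mul_assoc, extD_ι_mul, ih]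
    simp only [mul_sub, sub_mul, mul_smul_comm, smul_mul_assoc, mul_assoc]
    abel

theorem even_comm_ι {a : Ext F n} (ha : a ∈ extPart F n 0) (v : Fin n → F) :
    a * ExteriorAlgebra.ι F v = ExteriorAlgebra.ι F v * a := by
  induction a, ha using CliffordAlgebra.even_induction with
  | algebraMap r => exact Algebra.commutes _ _
  | add x y hx hy ihx ihy => rw [add_mul, mul_add, ihx, ihy]
  | ι_mul_ι_mul m₁ m₂ x hx ih =>
    change ExteriorAlgebra.ι F m₁ * ExteriorAlgebra.ι F m₂ * x * ExteriorAlgebra.ι F v =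
      ExteriorAlgebra.ι F v * (ExteriorAlgebra.ι F m₁ * ExteriorAlgebra.ι F m₂ * x)
    rw [mul_assoc _ x, ih, ← mul_assoc, mul_assoc (ExteriorAlgebra.ι F m₁), ι_mul_anticomm m₂,
      mul_neg, ← mul_assoc, ι_mul_anticomm m₁ v]
    simp only [neg_mul, neg_neg, mul_assoc]

theorem even_comm {a : Ext F n} (ha : a ∈ extPart F n 0) (b : Ext F n) : a * b = b * a := by
  induction b using ExteriorAlgebra.induction with
  | algebraMap r => exact (Algebra.commutes _ _).symm
  | ι v => exact even_comm_ι ha v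
  | mul x y hx hy => rw [← mul_assoc, hx, mul_assoc, hy, mul_assoc]
  | add x y hx hy => rw [mul_add, add_mul, hx, hy]

theorem odd_anticomm {a b : Ext F n} (ha : a ∈ extPart F n 1) (hb : b ∈ extPart F n 1) :
    a * b = -(b * a) := by
  induction a, ha using CliffordAlgebra.odd_induction with
  | ι v =>
    change ExteriorAlgebra.ι F v * b = -(b * ExteriorAlgebra.ι F v)
    induction b, hb using CliffordAlgebra.odd_induction with
    | ι w => exact ι_mul_anticomm v w
    | add x y hx hy ihx ihy => rw [add_mul, mul_add, ihx, ihy, neg_add]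
    | ι_mul_ι_mul m₁ m₂ x hx ih =>
      have h := even_comm (CliffordAlgebra.ι_mul_ι_mem_evenOdd_zero
        (0 : QuadraticForm F (Fin n → F)) m₁ m₂) (ExteriorAlgebra.ι F v)
      rw [← mul_assoc, ← h, mul_assoc, ih, mul_neg, ← mul_assoc]
  | add x y hx hy ihx ihy => rw [add_mul, mul_add, ihx, ihy, neg_add]
  | ι_mul_ι_mul m₁ m₂ x hx ih =>
    have h := even_comm (CliffordAlgebra.ι_mul_ι_mem_evenOdd_zero
      (0 : QuadraticForm F (Fin n → F)) m₁ m₂) b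
    rw [mul_assoc, ih, mul_neg, ← mul_assoc, h, mul_assoc]

end exterior

section superalgebra
variable {F : Type*} [CommRing F] {m n : ℕ}

theorem D_inl_tmul (i : Fin m) (f : DividedPow F m) (ω : Ext F n) :
    D F (Sum.inl i) (tmul f ω) = tmul (DividedPow.partialD F i f) ω :=
  LinearMap.rTensor_tmul _ _ _ _

theorem D_inr_tmul (k : Fin n) (f : DividedPow F m) (ω : Ext F n) :
    D F (Sum.inr k) (tmul f ω) = tmul f (extD F k ω) :=
  LinearMap.lTensor_tmul _ _ _ _

theorem D_inl_mul (i : Fin m) (a b : Alg F m n) :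
    D F (Sum.inl i) (a * b) = D F (Sum.inl i) a * b + a * D F (Sum.inl i) b := by
  induction a using Alg.induction with
  | zero => simp
  | add a a' h h' => rw [add_mul, map_add, h, h', map_add]; noncomm_ring
  | tmul f ω =>
    induction b using Alg.induction with
    | zero => simp
    | add b b' h h' => rw [mul_add, map_add, h, h', map_add]; noncomm_ring
    | tmul g η =>
      simp only [tmul_mul_tmul, D_inl_tmul, DividedPow.partialD_mul,
        map_add, LinearMap.add_apply]

theorem D_inr_even_mul (k : Fin n) {a : Alg F m n} (ha : a ∈ parityPart F m n 0)
    (b : Alg F m n) :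
    D F (Sum.inr k) (a * b) = D F (Sum.inr k) a * b + a * D F (Sum.inr k) b := by
  induction ha using Submodule.span_induction with
  | zero => simp
  | add a a' _ _ h h' => rw [add_mul, map_add, h, h', map_add]; noncomm_ring
  | smul c a _ h => simp only [smul_mul_assoc, map_smul, h, smul_add]
  | mem a h =>
    obtain ⟨f, ω, hω, rfl⟩ := h
    induction b using Alg.induction with
    | zero => simp
    | add b b' h h' => rw [mul_add, map_add, h, h', map_add]; noncomm_ring
    | tmul g η =>
      simp only [tmul_mul_tmul, D_inr_tmul, extD_even_mul k hω,
        map_add]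

theorem D_inr_odd_mul (k : Fin n) {a : Alg F m n} (ha : a ∈ parityPart F m n 1)
    (b : Alg F m n) :
    D F (Sum.inr k) (a * b) = D F (Sum.inr k) a * b - a * D F (Sum.inr k) b := by
  induction ha using Submodule.span_induction with
  | zero => simp
  | add a a' _ _ h h' => rw [add_mul, map_add, h, h', map_add]; noncomm_ring
  | smul c a _ h => simp only [smul_mul_assoc, map_smul, h, smul_sub]
  | mem a h =>
    obtain ⟨f, ω, hω, rfl⟩ := h
    induction b using Alg.induction with
    | zero => simp
    | add b b' h h' => rw [mul_add, map_add, h, h', map_add]; noncomm_ring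
    | tmul g η =>
      simp only [tmul_mul_tmul, D_inr_tmul, extD_odd_mul k hω,
        map_sub]

theorem alg_even_comm {a : Alg F m n} (ha : a ∈ parityPart F m n 0) (b : Alg F m n) :
    a * b = b * a := by
  induction ha using Submodule.span_induction with
  | zero => simp
  | add a a' _ _ h h' => rw [add_mul, mul_add, h, h']
  | smul c a _ h => rw [smul_mul_assoc, mul_smul_comm, h]
  | mem a h =>
    obtain ⟨f, ω, hω, rfl⟩ := h
    induction b using Alg.induction with
    | zero => simp
    | add b b' h h' => rw [add_mul, mul_add, h, h']
    | tmul g η =>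
      simp only [tmul_mul_tmul]
      rw [mul_comm f, even_comm hω]

theorem alg_odd_anticomm {a b : Alg F m n} (ha : a ∈ parityPart F m n 1)
    (hb : b ∈ parityPart F m n 1) : a * b = -(b * a) := by
  induction ha using Submodule.span_induction with
  | zero => simp
  | add a a' _ _ h h' => rw [add_mul, mul_add, h, h', neg_add]
  | smul c a _ h => rw [smul_mul_assoc, mul_smul_comm, h, smul_neg]
  | mem a h =>
    obtain ⟨f, ω, hω, rfl⟩ := h
    induction hb using Submodule.span_induction with
    | zero => simp
    | add a a' _ _ h h' => rw [add_mul, mul_add, h, h', neg_add]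
    | smul c a _ h => rw [smul_mul_assoc, mul_smul_comm, h, smul_neg]
    | mem b h =>
      obtain ⟨g, η, hη, rfl⟩ := h
      simp only [tmul_mul_tmul]
      rw [mul_comm f, odd_anticomm hω hη, map_neg]

theorem D_inl_comm (i : Fin m) (s : Fin m ⊕ Fin n) (a : Alg F m n) :
    D F (Sum.inl i) (D F s a) = D F s (D F (Sum.inl i) a) := by
  induction a using Alg.induction with
  | zero => simp
  | add a a' h h' => simp only [map_add, h, h']
  | tmul f ω =>
    cases s with
    | inl j => simp only [D_inl_tmul, DividedPow.partialD_comm i j]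
    | inr k => simp only [D_inl_tmul, D_inr_tmul]

theorem D_inr_anticomm (k l : Fin n) (a : Alg F m n) :
    D F (Sum.inr k) (D F (Sum.inr l) a) = -D F (Sum.inr l) (D F (Sum.inr k) a) := by
  induction a using Alg.induction with
  | zero => simp
  | add a a' h h' => simp only [map_add, h, h', neg_add]
  | tmul f ω => simp only [D_inr_tmul, extD_comm k l, map_neg]

/-- The parity `τ` of the indices: `0` on the left summand, `1` on the right one. -/
def tau {m n : ℕ} : Fin m ⊕ Fin n → ZMod 2
  | Sum.inl _ => 0
  | Sum.inr _ => 1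

/-- The generators `x_r` of `𝔄(m,n)`. -/
def X (F : Type*) [CommRing F] {m n : ℕ} : Fin m ⊕ Fin n → Alg F m n
  | Sum.inl i => tmul (DividedPow.x F (Pi.single i 1)) 1
  | Sum.inr k => tmul 1 (ExteriorAlgebra.ι F (Pi.single k 1))

theorem X_mem (r : Fin m ⊕ Fin n) : X F r ∈ parityPart F m n (tau r) := by
  cases r with
  | inl i =>
    exact Submodule.subset_span ⟨_, _, SetLike.one_mem_graded
      (CliffordAlgebra.evenOdd (0 : QuadraticForm F (Fin n → F))), rfl⟩
  | inr k =>
    exact Submodule.subset_span ⟨_, _, CliffordAlgebra.ι_mem_evenOdd_one _ _, rfl⟩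

theorem D_X (r s : Fin m ⊕ Fin n) : D F r (X F s) = if r = s then 1 else 0 := by
  have h1 : ∀ i, DividedPow.partialD F i (1 : DividedPow F m) = 0 := fun i => by
    rw [DividedPow.one_def, DividedPow.partialD_x_zero i _ rfl]
  have h2 : ∀ k, extD F k (1 : Ext F n) = 0 := fun k => CliffordAlgebra.contractLeft_one
      (Q := (0 : QuadraticForm F (Fin n → F))) (LinearMap.proj k)
  rcases r with i | k <;> rcases s with j | l
  · simp only [X, D_inl_tmul, Sum.inl.injEq]
    split_ifs with h
    · subst h
      rw [DividedPow.partialD_x, if_neg (by simp), tsub_self]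
      rfl
    · rw [DividedPow.partialD_x_zero i _ (Pi.single_eq_of_ne h _), map_zero, LinearMap.zero_apply]
  · simp [X, D_inl_tmul, h1]
  · simp [X, D_inr_tmul, h2]
  · simp only [X, D_inr_tmul, extD_ι, Sum.inr.injEq]
    split_ifs with h
    · subst h
      rw [Pi.single_eq_same, (algebraMap F (Ext F n)).map_one]
      rfl
    · rw [Pi.single_eq_of_ne h, map_zero, map_zero]

theorem vectorField_X (f : Fin m ⊕ Fin n → Alg F m n) (r : Fin m ⊕ Fin n) :
    vectorField f (X F r) = f r := by
  simp [vectorField_apply, D_X]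

theorem coeff_mem {f : Fin m ⊕ Fin n → Alg F m n} (hf : vectorField f ∈ evenEnd F m n)
    (r : Fin m ⊕ Fin n) : f r ∈ parityPart F m n (tau r) := by
  have h := hf (tau r) (X F r) (X_mem r)
  rwa [vectorField_X] at h

theorem smul_D_mul {r s : Fin m ⊕ Fin n} {f g : Alg F m n} (hf : f ∈ parityPart F m n (tau r))
    (hg : g ∈ parityPart F m n (tau s)) (a : Alg F m n) :
    f * D F r (g * a) = f * D F r g * a + g * (f * D F r a) := by
  rcases r with i | k
  · rw [D_inl_mul, mul_add, ← mul_assoc, ← mul_assoc, alg_even_comm hf g, mul_assoc g]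
  · rcases s with j | l
    · rw [D_inr_even_mul k hg, mul_add, ← mul_assoc, ← mul_assoc, ← alg_even_comm hg f,
        mul_assoc g]
    · rw [D_inr_odd_mul k hg, mul_sub, ← mul_assoc, ← mul_assoc, alg_odd_anticomm hf hg,
        neg_mul, sub_neg_eq_add, mul_assoc g]

theorem smul_D_smul_D {r s : Fin m ⊕ Fin n} {f g : Alg F m n}
    (hf : f ∈ parityPart F m n (tau r)) (hg : g ∈ parityPart F m n (tau s)) (a : Alg F m n) :
    f * D F r (g * D F s a) - g * D F s (f * D F r a) =
      f * D F r g * D F s a - g * D F s f * D F r a := by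
  have key : g * (f * D F r (D F s a)) = f * (g * D F s (D F r a)) := by
    rw [← mul_assoc, ← mul_assoc]
    rcases r with i | k
    · rw [alg_even_comm hf g, D_inl_comm]
    · rcases s with j | l
      · rw [alg_even_comm hg f, D_inl_comm]
      · rw [alg_odd_anticomm hg hf, D_inr_anticomm k l, neg_mul, mul_neg, neg_neg]
  rw [smul_D_mul hf hg, smul_D_mul hg hf, key]
  abel

theorem vectorField_lie {f g : Fin m ⊕ Fin n → Alg F m n}
    (hf : ∀ r, f r ∈ parityPart F m n (tau r)) (hg : ∀ r, g r ∈ parityPart F m n (tau r)) :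
    ⁅vectorField f, vectorField g⁆ =
      vectorField (fun s => vectorField f (g s) - vectorField g (f s)) := by
  refine LinearMap.ext fun a => ?_
  have h1 : ∀ f g : Fin m ⊕ Fin n → Alg F m n, vectorField f (vectorField g a) =
      ∑ r, ∑ s, f r * D F r (g s * D F s a) := fun f g => by
    simp only [vectorField_apply, map_sum]
    exact Finset.sum_comm
  have h2 : ∀ f g : Fin m ⊕ Fin n → Alg F m n, vectorField (fun s => vectorField f (g s)) a =
      ∑ r, ∑ s, f r * D F r (g s) * D F s a := fun f g => by
    simp only [vectorField_apply, Finset.sum_mul]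
    exact Finset.sum_comm
  have h3 : vectorField (fun s => vectorField f (g s) - vectorField g (f s)) a =
      vectorField (fun s => vectorField f (g s)) a -
        vectorField (fun s => vectorField g (f s)) a := by
    rw [vectorField_apply, vectorField_apply, vectorField_apply, ← Finset.sum_sub_distrib]
    exact Finset.sum_congr rfl fun s _ => sub_mul _ _ _
  rw [Ring.lie_def, LinearMap.sub_apply, Module.End.mul_apply, Module.End.mul_apply, h3, h2, h2,
    h1, h1, Finset.sum_comm (f := fun r s => g r * D F r (f s * D F s a)),
    Finset.sum_comm (f := fun r s => g r * D F r (f s) * D F s a)]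
  simp only [← Finset.sum_sub_distrib]
  exact Finset.sum_congr rfl fun r _ => Finset.sum_congr rfl fun s _ =>
    smul_D_smul_D (hf r) (hg s) a

variable {p : ℕ} {t : Fin m → ℕ}

theorem D_mem_truncAlg (r : Fin m ⊕ Fin n) {a : Alg F m n} (ha : a ∈ truncAlg F n p t) :
    D F r a ∈ truncAlg F n p t := by
  induction ha using Submodule.span_induction with
  | zero => rw [map_zero]; exact zero_mem _
  | add a b _ _ ha hb => rw [map_add]; exact add_mem ha hb
  | smul c a _ ha => rw [map_smul]; exact Submodule.smul_mem _ c ha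
  | mem a h =>
    obtain ⟨α, ω, hα, rfl⟩ := h
    cases r with
    | inl i =>
      rw [D_inl_tmul, DividedPow.partialD_x]
      split_ifs
      · rw [map_zero, LinearMap.zero_apply]; exact zero_mem _
      · exact Submodule.subset_span ⟨_, _, fun j => (Nat.sub_le _ _).trans_lt (hα j), rfl⟩
    | inr k =>
      rw [D_inr_tmul]
      exact Submodule.subset_span ⟨_, _, hα, rfl⟩

theorem mul_mem_truncAlg [Fact p.Prime] [CharP F p] {a b : Alg F m n}
    (ha : a ∈ truncAlg F n p t) (hb : b ∈ truncAlg F n p t) : a * b ∈ truncAlg F n p t := by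
  induction ha using Submodule.span_induction with
  | zero => rw [zero_mul]; exact zero_mem _
  | add a a' _ _ ha ha' => rw [add_mul]; exact add_mem ha ha'
  | smul c a _ ha => rw [smul_mul_assoc]; exact Submodule.smul_mem _ c ha
  | mem a h =>
    obtain ⟨α, ω, hα, rfl⟩ := h
    induction hb using Submodule.span_induction with
    | zero => rw [mul_zero]; exact zero_mem _
    | add a a' _ _ ha ha' => rw [mul_add]; exact add_mem ha ha'
    | smul c a _ ha => rw [mul_smul_comm]; exact Submodule.smul_mem _ c ha
    | mem b h =>
      obtain ⟨β, η, hβ, rfl⟩ := h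
      rw [tmul_mul_tmul, DividedPow.x_mul_x]
      by_cases h : ∀ i, α i + β i < p ^ t i
      · rw [map_smul, LinearMap.smul_apply]
        exact Submodule.smul_mem _ _ (Submodule.subset_span ⟨_, _, h, rfl⟩)
      · push Not at h
        obtain ⟨i, hi⟩ := h
        rw [DividedPow.binom_eq_zero p t α β hα hβ i hi, zero_smul, map_zero, LinearMap.zero_apply]
        exact zero_mem _

theorem vectorField_mem_truncAlg [Fact p.Prime] [CharP F p] {f : Fin m ⊕ Fin n → Alg F m n}
    (hf : ∀ r, f r ∈ truncAlg F n p t) {a : Alg F m n} (ha : a ∈ truncAlg F n p t) :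
    vectorField f a ∈ truncAlg F n p t := by
  rw [vectorField_apply]
  exact sum_mem fun r _ => mul_mem_truncAlg (hf r) (D_mem_truncAlg r ha)

end superalgebra

/-- The Lie algebra `𝒲 = W(m,n;t)_0`, the even part of the generalized Witt superalgebra. For even
operators the superbracket is the commutator, which is the bracket of `Module.End`. -/
def evenW (F : Type*) [CommRing F] {m : ℕ} (n p : ℕ) [Fact p.Prime] [CharP F p] (t : Fin m → ℕ) :
    LieSubalgebra F (Module.End F (Alg F m n)) :=
  { W F n p t ⊓ evenEnd F m n with
    lie_mem' := by
      rintro E E' ⟨⟨f, hf, rfl⟩, hE⟩ ⟨⟨g, hg, rfl⟩, hE'⟩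
      refine ⟨⟨_, fun s => ?_, vectorField_lie (coeff_mem hE) (coeff_mem hE')⟩, ?_⟩
      · exact sub_mem (vectorField_mem_truncAlg hf (hg s)) (vectorField_mem_truncAlg hg (hf s))
      · intro θ a ha
        rw [Ring.lie_def]
        exact sub_mem (hE θ _ (hE' θ _ ha)) (hE' θ _ (hE θ _ ha)) }

end WittSuper
end

/-! Write L for the even part. An element of L is the same as a family of coefficients f_r, one for
each D_r, with f_r in the truncated superalgebra and of the parity of D_r. Both homogeneous parts of
that superalgebra have dimension 2^(n-1) p^(∑ t_i), so dim L = (m+n) 2^(n-1) p^(∑ t_i). The other ∑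
(t_j - 1) dimensions come from the outer derivations (ad D_j)^(p^r) with 1 ≤ r < t_j; for r = 0 this
map is inner, and for r = t_j it vanishes on L. The theorem follows once L × F^(∑ (t_j - 1)) → Der L
is known to be bijective (`derMap_bijective`).

Surjectivity is a successive normalisation of a derivation d by inner derivations. Since (ad
D_i)^(p^(t_i)) = 0 on L, the Frobenius identity for ad (ad D_i) shows that (ad D_i)^(p^(t_i) - 1)
sends d(D_i) into the center, which is zero. Hence the coefficients of d(D_i) have no top term in
x_i and can be integrated, and a Poincaré lemma makes d kill every D_i (`D_pow_derivation_eq_zero`,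
`IsDer.exists_kill_D`). From then on d commutes with ad D_i, so any field whose derivatives are
killed is sent to a field with coefficients in Λ(n). On such constant fields the torus of all x_r
D_r acts semisimply with weights 0, 1, -1. This makes d kill the torus (`IsDer.exists_kill_tor`).
Then d preserves weights, scales each x_k D_l and x_k x_l D_i, and torus elements correct these
scalars to zero (`IsDer.exists_kill_gl`, `IsDer.exists_isNormal`).

A normal derivation is controlled by weights. If x_i occurs to the first power in x^(α) ω D_s with
D_s ≠ D_i, the field has weight 1 under x_i D_i, while nonzero constant fields have only the weights
0 and -1; so it is killed as soon as its derivatives are (`IsDer.op_mem_ker`). Together with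
brackets of killed fields this reduces everything to the x^(α) D_i (`IsNormal.eq_zero`), and
induction on the degree reduces these to the x_j^(p^r) D_j, which may still be sent to multiples of
D_j (`IsNormal.mon_mem_ker`). Since (ad D_j)^(p^r) sends x_j^(p^r) D_j to D_j, subtracting suitable
multiples of the outer derivations finishes the argument.

For injectivity, the outer derivations kill the D_i, the torus and the x_k x_l D_i, and no nonzero
element of L commutes with all of these (`eq_zero_of_lie_eq_zero`). So the inner part vanishes, and
the outer coefficients are read off on the x_j^(p^r) D_j. -/

noncomputable section

namespace WittSuper

set_option linter.unusedSectionVars false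

/-! ### The exterior algebra: constants, parity, dimension -/

section exteriorAlgebra

variable {F : Type*} [CommRing F] {n : ℕ}

/-- The generator `x_k` of `Λ(n)`. -/
def gen (F : Type*) [CommRing F] {n : ℕ} (k : Fin n) : Ext F n := ExteriorAlgebra.ι F (Pi.single k 1)

theorem extD_one (k : Fin n) : extD F k (1 : Ext F n) = 0 :=
  CliffordAlgebra.contractLeft_one (Q := (0 : QuadraticForm F (Fin n → F))) (LinearMap.proj k)

theorem extD_algebraMap (k : Fin n) (c : F) : extD F k (algebraMap F (Ext F n) c) = 0 := by
  rw [Algebra.algebraMap_eq_smul_one, map_smul, extD_one, smul_zero]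

theorem extD_extD_self (k : Fin n) (b : Ext F n) : extD F k (extD F k b) = 0 :=
  CliffordAlgebra.contractLeft_contractLeft (Q := (0 : QuadraticForm F (Fin n → F)))
    (LinearMap.proj k) b

theorem extD_gen_mul_self (k : Fin n) (b : Ext F n) :
    extD F k (gen F k * b) = b - gen F k * extD F k b := by
  rw [gen, extD_ι_mul, Pi.single_eq_same, one_smul]

theorem extD_gen_mul_of_ne {k l : Fin n} (h : k ≠ l) (b : Ext F n) :
    extD F k (gen F l * b) = -(gen F l * extD F k b) := by
  rw [gen, extD_ι_mul, Pi.single_eq_of_ne h, zero_smul, zero_sub]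

theorem gen_mul_self (k : Fin n) : gen F k * gen F k = 0 := ExteriorAlgebra.ι_sq_zero _

theorem gen_mul_comm (k l : Fin n) : gen F k * gen F l = -(gen F l * gen F k) :=
  ι_mul_anticomm _ _

theorem ι_eq_sum (v : Fin n → F) : ExteriorAlgebra.ι F v = ∑ k, v k • gen F k := by
  conv_lhs => rw [pi_eq_sum_univ' v]
  rw [map_sum]
  refine Finset.sum_congr rfl fun k _ => ?_
  rw [map_smul, gen]

theorem exists_eq_add_sum_gen_mul (ω : Ext F n) :
    ∃ (c : F) (μ : Fin n → Ext F n), ω = algebraMap F _ c + ∑ k, gen F k * μ k := by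
  induction ω using ExteriorAlgebra.induction with
  | algebraMap r => exact ⟨r, 0, by simp⟩
  | ι v => exact ⟨0, fun k => algebraMap F _ (v k), by
      rw [ι_eq_sum, map_zero, zero_add]
      exact Finset.sum_congr rfl fun k _ => by rw [← Algebra.commutes, Algebra.smul_def]⟩
  | mul a b ha hb =>
    obtain ⟨c, μ, rfl⟩ := ha
    obtain ⟨e, ν, rfl⟩ := hb
    refine ⟨c * e, fun k => algebraMap F _ c * ν k + μ k * (algebraMap F _ e + ∑ l, gen F l * ν l), ?_⟩
    simp only [mul_add, Finset.sum_add_distrib, add_mul, Finset.sum_mul, map_mul, Finset.mul_sum,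
      mul_assoc]
    have : ∀ k, algebraMap F (Ext F n) c * (gen F k * ν k) = gen F k * (algebraMap F _ c * ν k) :=
      fun k => by rw [← mul_assoc, Algebra.commutes, mul_assoc]
    simp only [this]
    rw [Finset.sum_comm (f := fun l k => gen F k * (μ k * (gen F l * ν l)))]
    abel
  | add a b ha hb =>
    obtain ⟨c, μ, rfl⟩ := ha
    obtain ⟨e, ν, rfl⟩ := hb
    refine ⟨c + e, μ + ν, ?_⟩
    simp only [map_add, Pi.add_apply, mul_add, Finset.sum_add_distrib]
    abel

/-- The operator ω ↦ ω - x_j ∂_j ω sets x_j to zero: it kills all multiples of x_j and fixes every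
element with ∂_j ω = 0. Applying it for one j after another removes all generators from an expansion
of ω. -/
theorem eq_algebraMap_of_extD_eq_zero {ω : Ext F n} (h : ∀ k, extD F k ω = 0) :
    ∃ c : F, ω = algebraMap F _ c := by
  -- Here s is the set of generators already eliminated.
  suffices H : ∀ s : Finset (Fin n), ∃ (c : F) (μ : Fin n → Ext F n),
      ω = algebraMap F _ c + ∑ k ∈ sᶜ, gen F k * μ k by
    obtain ⟨c, μ, hc⟩ := H Finset.univ
    exact ⟨c, by simpa using hc⟩
  intro s
  induction s using Finset.induction_on with
  | empty => simpa using exists_eq_add_sum_gen_mul ω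
  | insert j s hj ih =>
    obtain ⟨c, μ, hc⟩ := ih
    refine ⟨c, fun k => μ k - gen F j * extD F j (μ k), ?_⟩
    have h1 : ω = ω - gen F j * extD F j ω := by rw [h j, mul_zero, sub_zero]
    have h2 : gen F j * μ j - gen F j * extD F j (gen F j * μ j) = 0 := by
      rw [extD_gen_mul_self, mul_sub, ← mul_assoc, gen_mul_self, zero_mul, sub_zero, sub_self]
    have h3 : ∀ k, k ≠ j → gen F k * μ k - gen F j * extD F j (gen F k * μ k) =
        gen F k * (μ k - gen F j * extD F j (μ k)) := fun k hk => by
      rw [extD_gen_mul_of_ne hk.symm, mul_neg, ← mul_assoc, gen_mul_comm j k, mul_sub, neg_mul,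
        neg_neg, mul_assoc]
    have h4 : sᶜ = insert j (insert j s)ᶜ := by
      ext k
      by_cases hk : k = j <;> simp [hk, hj]
    conv_lhs => rw [h1, hc]
    rw [h4, Finset.sum_insert (by simp), map_add, map_add, extD_algebraMap, zero_add, map_sum,
      mul_add, Finset.mul_sum]
    have h5 : ∑ k ∈ (insert j s)ᶜ, gen F k * μ k -
        ∑ k ∈ (insert j s)ᶜ, gen F j * extD F j (gen F k * μ k) =
        ∑ k ∈ (insert j s)ᶜ, gen F k * (μ k - gen F j * extD F j (μ k)) := by
      rw [← Finset.sum_sub_distrib]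
      refine Finset.sum_congr rfl fun k hk => h3 k ?_
      rintro rfl
      simp at hk
    rw [← h5, ← sub_eq_zero.1 h2]
    abel

theorem extPart_mul_mem {θ η : ZMod 2} {a b : Ext F n} (ha : a ∈ extPart F n θ)
    (hb : b ∈ extPart F n η) : a * b ∈ extPart F n (θ + η) :=
  CliffordAlgebra.evenOdd_mul_le (0 : QuadraticForm F (Fin n → F)) θ η
    (Submodule.mul_mem_mul ha hb)

theorem ι_mem_extPart (v : Fin n → F) : ExteriorAlgebra.ι F v ∈ extPart F n 1 :=
  CliffordAlgebra.ι_mem_evenOdd_one _ v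

theorem gen_mem (k : Fin n) : gen F k ∈ extPart F n 1 := ι_mem_extPart _

theorem one_mem_extPart : (1 : Ext F n) ∈ extPart F n 0 :=
  SetLike.one_mem_graded (CliffordAlgebra.evenOdd (0 : QuadraticForm F (Fin n → F)))

theorem extD_ι_mul_ι_mul_mem (k : Fin n) (v w : Fin n → F) {x : Ext F n} {θ : ZMod 2}
    (hx : x ∈ extPart F n θ) (ih : extD F k x ∈ extPart F n (θ + 1)) :
    extD F k (ExteriorAlgebra.ι F v * ExteriorAlgebra.ι F w * x) ∈ extPart F n (θ + 1) := by
  have h1 : (1 : ZMod 2) + θ = θ + 1 := add_comm _ _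
  have h2 : (1 : ZMod 2) + (1 + (θ + 1)) = θ + 1 := by
    rw [← add_assoc, CharTwo.add_self_eq_zero (1 : ZMod 2), zero_add]
  rw [mul_assoc, extD_ι_mul, extD_ι_mul, mul_sub, mul_smul_comm]
  refine sub_mem (Submodule.smul_mem _ _ ?_) (sub_mem (Submodule.smul_mem _ _ ?_) ?_)
  · exact h1 ▸ extPart_mul_mem (ι_mem_extPart w) hx
  · exact h1 ▸ extPart_mul_mem (ι_mem_extPart v) hx
  · exact h2 ▸ extPart_mul_mem (ι_mem_extPart v) (extPart_mul_mem (ι_mem_extPart w) ih)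

theorem extD_mem (k : Fin n) {θ : ZMod 2} {a : Ext F n} (ha : a ∈ extPart F n θ) :
    extD F k a ∈ extPart F n (θ + 1) := by
  fin_cases θ
  · change a ∈ extPart F n 0 at ha
    change extD F k a ∈ extPart F n (0 + 1)
    induction a, ha using CliffordAlgebra.even_induction with
    | algebraMap r => exact (extD_algebraMap k r).symm ▸ zero_mem _
    | add x y hx hy ihx ihy => rw [map_add]; exact add_mem ihx ihy
    | ι_mul_ι_mul v w x hx ih => exact extD_ι_mul_ι_mul_mem k v w hx ih
  · change a ∈ extPart F n 1 at ha
    change extD F k a ∈ extPart F n (1 + 1)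
    induction a, ha using CliffordAlgebra.odd_induction with
    | ι v =>
      refine (extD_ι k v).symm ▸ ?_
      rw [Algebra.algebraMap_eq_smul_one, CharTwo.add_self_eq_zero]
      exact Submodule.smul_mem _ _ one_mem_extPart
    | add x y hx hy ihx ihy => rw [map_add]; exact add_mem ihx ihy
    | ι_mul_ι_mul v w x hx ih => exact extD_ι_mul_ι_mul_mem k v w hx ih

end exteriorAlgebra

/-! ### Dimension of the exterior algebra and of its even and odd parts -/

section finrank

variable (F : Type*) [Field F] (n : ℕ)

/-- The elements of `Λ(n)` that only involve the generators `x_k`, `k ∈ s`. -/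
def extOn (s : Finset (Fin n)) : Submodule F (Ext F n) :=
  ⨅ k ∈ sᶜ, LinearMap.ker (extD F k)

variable {F n}

theorem mem_extOn {s : Finset (Fin n)} {a : Ext F n} :
    a ∈ extOn F n s ↔ ∀ k, k ∉ s → extD F k a = 0 := by
  simp [extOn, Submodule.mem_iInf]

variable (F) in
/-- Splitting off one generator. -/
def extOnInsert {s : Finset (Fin n)} {j : Fin n} (hj : j ∉ s) :
    (extOn F n s × extOn F n s) ≃ₗ[F] extOn F n (insert j s) where
  toFun u := ⟨u.1 + gen F j * u.2, mem_extOn.2 fun k hk => by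
    simp only [Finset.mem_insert, not_or] at hk
    rw [map_add, mem_extOn.1 u.1.2 k hk.2, extD_gen_mul_of_ne hk.1, mem_extOn.1 u.2.2 k hk.2]
    simp⟩
  map_add' u v := by
    ext
    simp only [Prod.fst_add, Prod.snd_add, Submodule.coe_add, mul_add]
    abel
  map_smul' c u := by
    ext
    simp
  -- The part a - x_j ∂_j a free of x_j is written as ∂_j (x_j a), so that ∂_j visibly kills it.
  invFun a := (⟨extD F j (gen F j * a), mem_extOn.2 fun k hk => by
      by_cases h : k = j
      · rw [h, extD_extD_self]
      · rw [extD_comm, extD_gen_mul_of_ne h, mem_extOn.1 a.2 k (by simp [h, hk])]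
        simp⟩,
    ⟨extD F j a, mem_extOn.2 fun k hk => by
      by_cases h : k = j
      · rw [h, extD_extD_self]
      · rw [extD_comm, mem_extOn.1 a.2 k (by simp [h, hk])]
        simp⟩)
  left_inv u := by
    have h1 := mem_extOn.1 u.1.2 j hj
    have h2 := mem_extOn.1 u.2.2 j hj
    ext
    · simp only [mul_add]
      rw [← mul_assoc, gen_mul_self, zero_mul, add_zero, extD_gen_mul_self, h1, mul_zero, sub_zero]
    · simp only [map_add]
      rw [extD_gen_mul_self, h1, h2, mul_zero, sub_zero, zero_add]
  right_inv a := by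
    ext
    simp only
    rw [extD_gen_mul_self, sub_add_cancel]

theorem finrank_extOn (s : Finset (Fin n)) :
    Module.Finite F (extOn F n s) ∧ Module.finrank F (extOn F n s) = 2 ^ s.card := by
  induction s using Finset.induction_on with
  | empty =>
    have h : extOn F n ∅ = Submodule.span F {1} := by
      ext a
      rw [mem_extOn, Submodule.mem_span_singleton]
      constructor
      · intro h
        obtain ⟨c, rfl⟩ := eq_algebraMap_of_extD_eq_zero fun k => h k (by simp)
        exact ⟨c, (Algebra.algebraMap_eq_smul_one c).symm⟩
      · rintro ⟨c, rfl⟩ k -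
        rw [map_smul, extD_one, smul_zero]
    rw [h]
    exact ⟨inferInstance, by simp [finrank_span_singleton (K := F) (one_ne_zero (α := Ext F n))]⟩
  | insert j s hj ih =>
    obtain ⟨h1, h2⟩ := ih
    refine ⟨Module.Finite.equiv (extOnInsert F hj), ?_⟩
    rw [← (extOnInsert F hj).finrank_eq, Module.finrank_prod, h2, Finset.card_insert_of_notMem hj,
      pow_succ]
    ring

theorem extOn_univ : extOn F n Finset.univ = ⊤ := by
  ext a
  simp [mem_extOn]

instance : Module.Finite F (Ext F n) := by
  have h := (finrank_extOn (F := F) (Finset.univ : Finset (Fin n))).1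
  rw [extOn_univ] at h
  exact Module.Finite.equiv (Submodule.topEquiv (R := F) (M := Ext F n))

theorem finrank_Ext : Module.finrank F (Ext F n) = 2 ^ n := by
  have h := (finrank_extOn (F := F) (Finset.univ : Finset (Fin n))).2
  rwa [extOn_univ, finrank_top, Finset.card_fin] at h

/-- The involution `x_k + ∂/∂x_k` of `Λ(n)`, which swaps the parities. -/
def extSwap (k : Fin n) {θ η : ZMod 2} (h : θ + 1 = η) (h' : η + 1 = θ) :
    extPart F n θ ≃ₗ[F] extPart F n η :=
  have key : ∀ a : Ext F n, gen F k * (gen F k * a + extD F k a) +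
      extD F k (gen F k * a + extD F k a) = a := fun a => by
    rw [mul_add, ← mul_assoc, gen_mul_self, map_add, extD_extD_self, extD_gen_mul_self]
    simp
  { toFun := fun a => ⟨gen F k * a + extD F k a, by
      subst h
      exact add_mem (add_comm (1 : ZMod 2) θ ▸ extPart_mul_mem (gen_mem k) a.2) (extD_mem k a.2)⟩
    invFun := fun a => ⟨gen F k * a + extD F k a, by
      subst h'
      exact add_mem (add_comm (1 : ZMod 2) η ▸ extPart_mul_mem (gen_mem k) a.2) (extD_mem k a.2)⟩
    map_add' := fun a b => by
      ext
      simp only [Submodule.coe_add, mul_add, map_add]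
      abel
    map_smul' := fun c a => by
      ext
      simp
    left_inv := fun a => Subtype.ext (key a)
    right_inv := fun a => Subtype.ext (key a) }

/-- `extSwap` along one generator identifies the two parts, so each has half of the dimension 2^n. A
generator is needed: for n = 0 the odd part is zero. -/
theorem finrank_extPart (hn : 0 < n) (θ : ZMod 2) :
    Module.finrank F (extPart F n θ) = 2 ^ (n - 1) := by
  have h1 : Module.finrank F (extPart F n 0) = Module.finrank F (extPart F n 1) :=
    (extSwap (⟨0, hn⟩ : Fin n) (by decide) (by decide)).finrank_eq
  have h2 := Submodule.finrank_add_eq_of_isCompl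
    (CliffordAlgebra.evenOdd_isCompl (0 : QuadraticForm F (Fin n → F)))
  have h3 : Module.finrank F (CliffordAlgebra (0 : QuadraticForm F (Fin n → F))) = 2 ^ n :=
    finrank_Ext
  have h4 : 2 ^ n = 2 * 2 ^ (n - 1) := by
    rw [← pow_succ', Nat.sub_add_cancel hn]
  rw [h3, h4, h1] at h2
  have h5 : Module.finrank F (extPart F n 1) = 2 ^ (n - 1) := by
    change Module.finrank F (extPart F n 1) + Module.finrank F (extPart F n 1) = _ at h2
    omega
  fin_cases θ
  · exact h1.trans h5
  · exact h5

end finrank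

/-! ### Coefficients in the superalgebra `𝔄(m,n)` -/

section coefficients

variable {F : Type*} [CommRing F] {m n : ℕ}

/-- The monomial `x^(α) ω`. -/
def mon (α : Fin m → ℕ) : Ext F n →ₗ[F] Alg F m n := tmul (DividedPow.x F α)

theorem mon_mul_mon (α β : Fin m → ℕ) (ω η : Ext F n) :
    mon α ω * mon β η = (DividedPow.binom α β : F) • mon (α + β) (ω * η) := by
  rw [mon, mon, tmul_mul_tmul, DividedPow.x_mul_x, map_smul]
  rfl

theorem mon_zero_mul_mon (α : Fin m → ℕ) (ω η : Ext F n) :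
    mon 0 ω * mon α η = mon α (ω * η) := by
  rw [mon_mul_mon, zero_add]
  simp [DividedPow.binom]

theorem mon_mul_mon_zero (α : Fin m → ℕ) (ω η : Ext F n) :
    mon α ω * mon 0 η = mon α (ω * η) := by
  rw [mon_mul_mon, add_zero]
  simp [DividedPow.binom]

theorem one_eq_mon : (1 : Alg F m n) = mon 0 1 := rfl

theorem X_inl (i : Fin m) : X F (Sum.inl i : Fin m ⊕ Fin n) = mon (Pi.single i 1) 1 := rfl

theorem X_inr (k : Fin n) : X F (Sum.inr k : Fin m ⊕ Fin n) = mon 0 (gen F k) := rfl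

theorem D_inl_mon (i : Fin m) (α : Fin m → ℕ) (ω : Ext F n) :
    D F (Sum.inl i) (mon α ω) = if α i = 0 then 0 else mon (α - Pi.single i 1) ω := by
  rw [mon, D_inl_tmul, DividedPow.partialD_x]
  split_ifs
  · rw [map_zero, LinearMap.zero_apply]
  · rfl

theorem D_inl_mon_add (i : Fin m) (α : Fin m → ℕ) (ω : Ext F n) :
    D F (Sum.inl i) (mon (α + Pi.single i 1) ω) = mon α ω := by
  rw [mon, D_inl_tmul, DividedPow.partialD_x_add]
  rfl

theorem D_inl_mon_zero (i : Fin m) {α : Fin m → ℕ} (h : α i = 0) (ω : Ext F n) :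
    D F (Sum.inl i) (mon α ω) = 0 := by
  rw [D_inl_mon, if_pos h]

theorem D_inr_mon (k : Fin n) (α : Fin m → ℕ) (ω : Ext F n) :
    D F (Sum.inr k) (mon α ω) = mon α (extD F k ω) :=
  D_inr_tmul k _ ω

/-- The coefficient in `Λ(n)` of `x^(α)`. -/
def co (α : Fin m → ℕ) : Alg F m n →ₗ[F] Ext F n :=
  (TensorProduct.lid F (Ext F n)).toLinearMap ∘ₗ
    ((DividedPow.basis F m).coord α).rTensor (Ext F n)

theorem co_tmul (α : Fin m → ℕ) (f : DividedPow F m) (ω : Ext F n) :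
    co α (tmul f ω) = (DividedPow.basis F m).coord α f • ω := by
  change TensorProduct.lid F (Ext F n) (((DividedPow.basis F m).coord α).rTensor (Ext F n)
    (f ⊗ₜ[F] ω)) = _
  rw [LinearMap.rTensor_tmul, TensorProduct.lid_tmul]

theorem co_mon (α β : Fin m → ℕ) (ω : Ext F n) : co α (mon β ω) = if α = β then ω else 0 := by
  rw [mon, co_tmul, DividedPow.x, Module.Basis.coord_apply, Module.Basis.repr_self,
    Finsupp.single_apply]
  by_cases h : α = β
  · simp [h]
  · simp [h, Ne.symm h]

theorem co_mon_self (α : Fin m → ℕ) (ω : Ext F n) : co α (mon α ω) = ω := by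
  rw [co_mon, if_pos rfl]

/-- In divided powers D_i shifts the coefficients without integer factors. This is what allows
integration in characteristic p, up to the truncation. -/
theorem coord_partialD (i : Fin m) (α : Fin m → ℕ) :
    (DividedPow.basis F m).coord α ∘ₗ DividedPow.partialD F i =
      (DividedPow.basis F m).coord (α + Pi.single i 1) := by
  refine (DividedPow.basis F m).ext fun β => ?_
  change (DividedPow.basis F m).coord α (DividedPow.partialD F i (DividedPow.x F β)) =
    (DividedPow.basis F m).coord (α + Pi.single i 1) (DividedPow.x F β)
  by_cases h : β i = 0
  · rw [DividedPow.partialD_x_zero i _ h, map_zero, DividedPow.x, Module.Basis.coord_apply,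
      Module.Basis.repr_self, Finsupp.single_eq_of_ne]
    rintro h'
    have := congrFun h' i
    simp [h] at this
  · obtain ⟨β, rfl⟩ := DividedPow.exists_add i β h
    rw [DividedPow.partialD_x_add, DividedPow.x, DividedPow.x, Module.Basis.coord_apply,
      Module.Basis.repr_self, Module.Basis.coord_apply, Module.Basis.repr_self,
      Finsupp.single_apply, Finsupp.single_apply]
    simp

theorem co_D_inl (i : Fin m) (α : Fin m → ℕ) (a : Alg F m n) :
    co α (D F (Sum.inl i) a) = co (α + Pi.single i 1) a := by
  induction a using Alg.induction with
  | zero => simp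
  | add a b ha hb => simp only [map_add, ha, hb]
  | tmul f ω => rw [D_inl_tmul, co_tmul, co_tmul, ← coord_partialD]; rfl

theorem co_D_inr (k : Fin n) (α : Fin m → ℕ) (a : Alg F m n) :
    co α (D F (Sum.inr k) a) = extD F k (co α a) := by
  induction a using Alg.induction with
  | zero => simp
  | add a b ha hb => simp only [map_add, ha, hb]
  | tmul f ω => rw [D_inr_tmul, co_tmul, co_tmul, map_smul]

theorem co_mem {θ : ZMod 2} {a : Alg F m n} (ha : a ∈ parityPart F m n θ) (α : Fin m → ℕ) :
    co α a ∈ extPart F n θ := by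
  induction ha using Submodule.span_induction with
  | zero => rw [map_zero]; exact zero_mem _
  | add a b _ _ ha hb => rw [map_add]; exact add_mem ha hb
  | smul c a _ ha => rw [map_smul]; exact Submodule.smul_mem _ c ha
  | mem a h =>
    obtain ⟨f, ω, hω, rfl⟩ := h
    rw [co_tmul]
    exact Submodule.smul_mem _ _ hω

theorem mon_mem_parityPart {θ : ZMod 2} {ω : Ext F n} (hω : ω ∈ extPart F n θ) (α : Fin m → ℕ) :
    mon α ω ∈ parityPart F m n θ :=
  Submodule.subset_span ⟨_, _, hω, rfl⟩

theorem mul_mem_parityPart {θ η : ZMod 2} {a b : Alg F m n} (ha : a ∈ parityPart F m n θ)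
    (hb : b ∈ parityPart F m n η) : a * b ∈ parityPart F m n (θ + η) := by
  induction ha using Submodule.span_induction with
  | zero => rw [zero_mul]; exact zero_mem _
  | add a a' _ _ ha ha' => rw [add_mul]; exact add_mem ha ha'
  | smul c a _ ha => rw [smul_mul_assoc]; exact Submodule.smul_mem _ c ha
  | mem a h =>
    obtain ⟨f, ω, hω, rfl⟩ := h
    induction hb using Submodule.span_induction with
    | zero => rw [mul_zero]; exact zero_mem _
    | add a a' _ _ ha ha' => rw [mul_add]; exact add_mem ha ha'
    | smul c a _ ha => rw [mul_smul_comm]; exact Submodule.smul_mem _ c ha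
    | mem b h =>
      obtain ⟨g, ν, hν, rfl⟩ := h
      rw [tmul_mul_tmul]
      exact Submodule.subset_span ⟨_, _, extPart_mul_mem hω hν, rfl⟩

theorem D_mem_parityPart (r : Fin m ⊕ Fin n) {θ : ZMod 2} {a : Alg F m n}
    (ha : a ∈ parityPart F m n θ) : D F r a ∈ parityPart F m n (tau r + θ) := by
  induction ha using Submodule.span_induction with
  | zero => rw [map_zero]; exact zero_mem _
  | add a b _ _ ha hb => rw [map_add]; exact add_mem ha hb
  | smul c a _ ha => rw [map_smul]; exact Submodule.smul_mem _ c ha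
  | mem a h =>
    obtain ⟨f, ω, hω, rfl⟩ := h
    cases r with
    | inl i =>
      rw [D_inl_tmul, tau, zero_add]
      exact Submodule.subset_span ⟨_, _, hω, rfl⟩
    | inr k =>
      rw [D_inr_tmul, tau, add_comm]
      exact Submodule.subset_span ⟨_, _, extD_mem k hω, rfl⟩

theorem D_one (r : Fin m ⊕ Fin n) : D F r (1 : Alg F m n) = 0 := by
  rw [one_eq_mon]
  cases r with
  | inl i => exact D_inl_mon_zero i rfl 1
  | inr k => rw [D_inr_mon, extD_one, map_zero]

theorem D_inr_D_self (k : Fin n) (a : Alg F m n) :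
    D F (Sum.inr k) (D F (Sum.inr k) a) = 0 := by
  induction a using Alg.induction with
  | zero => simp
  | add a b ha hb => simp only [map_add, ha, hb, add_zero]
  | tmul f ω => rw [D_inr_tmul, D_inr_tmul, extD_extD_self, map_zero]

theorem D_inr_X_mul (k : Fin n) (s : Fin m ⊕ Fin n) (hs : tau s = 1) (a : Alg F m n) :
    D F (Sum.inr k) (X F s * a) = (if Sum.inr k = s then 1 else 0) * a - X F s * D F (Sum.inr k) a := by
  rw [D_inr_odd_mul k (hs ▸ X_mem s), D_X]

theorem X_inr_mul_self (k : Fin n) :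
    X F (Sum.inr k : Fin m ⊕ Fin n) * X F (Sum.inr k) = 0 := by
  rw [X_inr, mon_zero_mul_mon, gen_mul_self, map_zero]

theorem X_inr_mul_comm (k l : Fin n) :
    X F (Sum.inr k : Fin m ⊕ Fin n) * X F (Sum.inr l) = -(X F (Sum.inr l) * X F (Sum.inr k)) := by
  simp only [X_inr, mon_zero_mul_mon]
  rw [gen_mul_comm, map_neg]

/-- The operator `a D_r`. -/
def op (r : Fin m ⊕ Fin n) : Alg F m n →ₗ[F] Module.End F (Alg F m n) where
  toFun a := LinearMap.mulLeft F a * D F r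
  map_add' a b := by ext; simp [add_mul]
  map_smul' c a := by ext; simp

theorem op_apply (r : Fin m ⊕ Fin n) (a b : Alg F m n) : op r a b = a * D F r b := rfl

theorem op_X (r s : Fin m ⊕ Fin n) (a : Alg F m n) : op r a (X F s) = if r = s then a else 0 := by
  rw [op_apply, D_X]
  split_ifs <;> simp

theorem op_one (r : Fin m ⊕ Fin n) : op r 1 = D F r := by
  ext a
  simp [op_apply]

theorem vectorField_eq_sum (f : Fin m ⊕ Fin n → Alg F m n) : vectorField f = ∑ r, op r (f r) := rfl

theorem lie_op_op {r s : Fin m ⊕ Fin n} {a b : Alg F m n} (ha : a ∈ parityPart F m n (tau r))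
    (hb : b ∈ parityPart F m n (tau s)) :
    ⁅op r a, op s b⁆ = op s (a * D F r b) - op r (b * D F s a) := by
  refine LinearMap.ext fun c => ?_
  rw [Ring.lie_def]
  exact smul_D_smul_D ha hb c

end coefficients

/-! ### The truncated superalgebra and its homogeneous parts in coordinates -/

section truncation

variable {F : Type*} [CommRing F] {m n : ℕ} {p : ℕ} {t : Fin m → ℕ}

/-- The exponents of the truncated divided power algebra. -/
def box (p : ℕ) (t : Fin m → ℕ) : Finset (Fin m → ℕ) := Fintype.piFinset fun i => Finset.range (p ^ t i)

theorem mem_box {α : Fin m → ℕ} : α ∈ box p t ↔ ∀ i, α i < p ^ t i := by simp [box]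

theorem mon_mem_truncAlg {α : Fin m → ℕ} (hα : ∀ i, α i < p ^ t i) (ω : Ext F n) :
    mon α ω ∈ truncAlg F n p t :=
  Submodule.subset_span ⟨α, ω, hα, rfl⟩

theorem eq_sum_mon {a : Alg F m n} (ha : a ∈ truncAlg F n p t) :
    a = ∑ α ∈ box p t, mon α (co α a) := by
  induction ha using Submodule.span_induction with
  | zero => simp
  | add a b _ _ ha hb => simp only [map_add, Finset.sum_add_distrib, ← ha, ← hb]
  | smul c a _ ha => simp only [map_smul, ← Finset.smul_sum, ← ha]
  | mem a h =>
    obtain ⟨α, ω, hα, rfl⟩ := h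
    change mon α ω = ∑ β ∈ box p t, mon β (co β (mon α ω))
    rw [Finset.sum_eq_single α]
    · rw [co_mon_self]
    · intro β _ hβ
      rw [co_mon, if_neg hβ, map_zero]
    · exact fun h => absurd (mem_box.2 hα) h

theorem eq_of_co_eq {a b : Alg F m n} (ha : a ∈ truncAlg F n p t) (hb : b ∈ truncAlg F n p t)
    (h : ∀ α, (∀ i, α i < p ^ t i) → co α a = co α b) : a = b := by
  rw [eq_sum_mon ha, eq_sum_mon hb]
  exact Finset.sum_congr rfl fun α hα => by rw [h α (mem_box.1 hα)]

theorem co_eq_zero {a : Alg F m n} (ha : a ∈ truncAlg F n p t) {α : Fin m → ℕ} {i : Fin m}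
    (hi : p ^ t i ≤ α i) : co α a = 0 := by
  rw [eq_sum_mon ha, map_sum]
  refine Finset.sum_eq_zero fun β hβ => ?_
  rw [co_mon, if_neg]
  rintro rfl
  exact absurd (mem_box.1 hβ i) (not_lt.2 hi)

theorem eq_mon_zero {a : Alg F m n} (hp : 0 < p) (ha : a ∈ truncAlg F n p t)
    (h : ∀ i, D F (Sum.inl i) a = 0) : a = mon 0 (co 0 a) := by
  refine eq_of_co_eq ha (mon_mem_truncAlg (fun i => pow_pos hp _) _) fun α _ => ?_
  rw [co_mon]
  split_ifs with h0
  · rw [h0]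
  · have : ∃ i, α i ≠ 0 := by
      by_contra! h'
      exact h0 (funext h')
    obtain ⟨i, hi⟩ := this
    obtain ⟨β, rfl⟩ := DividedPow.exists_add i α hi
    rw [← co_D_inl, h, map_zero]

theorem eq_smul_one {a : Alg F m n} (hp : 0 < p) (ha : a ∈ truncAlg F n p t)
    (h : ∀ r, D F r a = 0) : ∃ c : F, a = c • 1 := by
  have h1 := eq_mon_zero hp ha fun i => h _
  have h2 : ∀ k, extD F k (co 0 a) = 0 := fun k => by rw [← co_D_inr, h, map_zero]
  obtain ⟨c, hc⟩ := eq_algebraMap_of_extD_eq_zero h2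
  refine ⟨c, ?_⟩
  rw [h1, hc, Algebra.algebraMap_eq_smul_one, map_smul]
  rfl

variable (F n p t) in
/-- The homogeneous components of the truncated superalgebra. -/
def homog (θ : ZMod 2) : Submodule F (Alg F m n) := truncAlg F n p t ⊓ parityPart F m n θ

theorem D_mem_homog (r : Fin m ⊕ Fin n) {θ : ZMod 2} {a : Alg F m n} (ha : a ∈ homog F n p t θ) :
    D F r a ∈ homog F n p t (tau r + θ) :=
  ⟨D_mem_truncAlg r ha.1, D_mem_parityPart r ha.2⟩

theorem mon_mem_homog {θ : ZMod 2} {α : Fin m → ℕ} (hα : ∀ i, α i < p ^ t i) {ω : Ext F n}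
    (hω : ω ∈ extPart F n θ) : mon α ω ∈ homog F n p t θ :=
  ⟨mon_mem_truncAlg hα ω, mon_mem_parityPart hω α⟩

theorem sum_mon_mem_homog {θ : ZMod 2} (f : box p t → extPart F n θ) :
    ∑ α, mon α.1 (f α).1 ∈ homog F n p t θ := by
  refine Submodule.sum_mem _ fun α _ => ?_
  have h := mem_box.1 α.2
  have h' := (f α).2
  exact mon_mem_homog h h'

/-- The coefficients of a homogeneous element. -/
def homogCo (θ : ZMod 2) : homog F n p t θ →ₗ[F] (box p t → extPart F n θ) :=
  LinearMap.pi fun α => LinearMap.codRestrict (extPart F n θ)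
    (co α.1 ∘ₗ (homog F n p t θ).subtype) fun a => co_mem a.2.2 α.1

theorem homogCo_apply (θ : ZMod 2) (a : homog F n p t θ) (α : box p t) :
    (homogCo θ a α : Ext F n) = co α.1 a.1 := rfl

theorem homogCo_bijective (θ : ZMod 2) :
    Function.Bijective (homogCo (F := F) (n := n) (p := p) (t := t) θ) := by
  constructor
  · intro a b h
    refine Subtype.ext (eq_of_co_eq a.2.1 b.2.1 fun α hα => ?_)
    have := congrFun h ⟨α, mem_box.2 hα⟩
    rw [← homogCo_apply θ a ⟨α, mem_box.2 hα⟩, this, homogCo_apply]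
  · intro f
    refine ⟨⟨_, sum_mon_mem_homog f⟩, funext fun α => Subtype.ext ?_⟩
    rw [homogCo_apply, map_sum, Finset.sum_eq_single α]
    · exact co_mon_self _ _
    · intro β _ hβ
      rw [co_mon, if_neg]
      exact fun h => hβ (Subtype.ext h.symm)
    · simp

variable (F n p t) in
/-- Homogeneous elements are the same thing as families of coefficients. -/
def homogEquiv (θ : ZMod 2) : homog F n p t θ ≃ₗ[F] (box p t → extPart F n θ) :=
  LinearEquiv.ofBijective (homogCo θ) (homogCo_bijective θ)

theorem card_box : (box p t).card = p ^ ∑ i, t i := by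
  simp [box, Fintype.card_piFinset, Finset.prod_pow_eq_pow_sum]

end truncation

section finiteDimension

variable {F : Type*} [Field F] {m n : ℕ} {p : ℕ} {t : Fin m → ℕ}

instance (θ : ZMod 2) : Module.Finite F (homog F n p t θ) :=
  Module.Finite.equiv (homogEquiv F n p t θ).symm

theorem finrank_homog (hn : 0 < n) (θ : ZMod 2) :
    Module.finrank F (homog F n p t θ) = p ^ (∑ i, t i) * 2 ^ (n - 1) := by
  rw [(homogEquiv F n p t θ).finrank_eq, Module.finrank_pi_fintype]
  simp [finrank_extPart hn, card_box]

end finiteDimension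

/-! ### Elements of the Lie algebra and their coefficients -/

section evenPart

variable {F : Type*} [Field F] {m n p : ℕ} [Fact p.Prime] [CharP F p] {t : Fin m → ℕ}

theorem op_mem {r : Fin m ⊕ Fin n} {a : Alg F m n} (ha : a ∈ homog F n p t (tau r)) :
    op r a ∈ evenW F n p t := by
  refine ⟨⟨Pi.single r a, fun s => ?_, ?_⟩, fun θ b hb => ?_⟩
  · by_cases h : s = r
    · subst h; rw [Pi.single_eq_same]; exact ha.1
    · rw [Pi.single_eq_of_ne h]; exact zero_mem _
  · rw [vectorField_eq_sum, Finset.sum_eq_single r, Pi.single_eq_same]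
    · intro s _ hs
      rw [Pi.single_eq_of_ne hs, map_zero]
    · simp
  · rw [op_apply]
    have h := mul_mem_parityPart ha.2 (D_mem_parityPart r hb)
    rwa [← add_assoc, CharTwo.add_self_eq_zero, zero_add] at h

theorem apply_eq_sum {E : Module.End F (Alg F m n)} (hE : E ∈ evenW F n p t) (b : Alg F m n) :
    E b = ∑ r, E (X F r) * D F r b := by
  obtain ⟨⟨f, hf, rfl⟩, hE⟩ := hE
  simp only [vectorField_X]
  exact vectorField_apply f b

theorem apply_X_mem {E : Module.End F (Alg F m n)} (hE : E ∈ evenW F n p t) (r : Fin m ⊕ Fin n) :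
    E (X F r) ∈ homog F n p t (tau r) := by
  obtain ⟨⟨f, hf, rfl⟩, hE⟩ := hE
  exact ⟨(vectorField_X f r).symm ▸ hf r, hE _ _ (X_mem r)⟩

theorem eq_sum_op {E : Module.End F (Alg F m n)} (hE : E ∈ evenW F n p t) :
    E = ∑ r, op r (E (X F r)) := by
  ext b
  rw [apply_eq_sum hE b, LinearMap.sum_apply]
  rfl

theorem eq_of_apply_X {E E' : Module.End F (Alg F m n)} (hE : E ∈ evenW F n p t)
    (hE' : E' ∈ evenW F n p t) (h : ∀ r, E (X F r) = E' (X F r)) : E = E' := by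
  rw [eq_sum_op hE, eq_sum_op hE']
  exact Finset.sum_congr rfl fun r _ => by rw [h]

theorem apply_one {E : Module.End F (Alg F m n)} (hE : E ∈ evenW F n p t) : E 1 = 0 := by
  rw [apply_eq_sum hE]
  exact Finset.sum_eq_zero fun r _ => by rw [D_one, mul_zero]

/-- Even operators are ordinary derivations: the sign created when D_r passes a is cancelled by the
one from commuting a with a coefficient of the same parity as D_r. -/
theorem apply_mul {E : Module.End F (Alg F m n)} (hE : E ∈ evenW F n p t) {s : Fin m ⊕ Fin n}
    {a : Alg F m n} (ha : a ∈ parityPart F m n (tau s)) (b : Alg F m n) :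
    E (a * b) = E a * b + a * E b := by
  rw [apply_eq_sum hE (a * b), apply_eq_sum hE a, apply_eq_sum hE b, Finset.sum_mul,
    Finset.mul_sum, ← Finset.sum_add_distrib]
  exact Finset.sum_congr rfl fun r _ => smul_D_mul (apply_X_mem hE r).2 ha b

theorem lie_apply' (E E' : Module.End F (Alg F m n)) (a : Alg F m n) :
    ⁅E, E'⁆ a = E (E' a) - E' (E a) := rfl

theorem one_mem_homog : (1 : Alg F m n) ∈ homog F n p t 0 :=
  mon_mem_homog (fun _ => pow_pos (Fact.out : p.Prime).pos _) one_mem_extPart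

theorem D_inl_mem (i : Fin m) : D F (Sum.inl i) ∈ evenW F n p t :=
  op_one (F := F) (Sum.inl i : Fin m ⊕ Fin n) ▸ op_mem one_mem_homog

/-- E kills constants, so bracketing with D_i just differentiates the coefficients. Questions about
ad D_i become questions about functions. -/
theorem lie_D_apply_X (i : Fin m) {E : Module.End F (Alg F m n)} (hE : E ∈ evenW F n p t)
    (r : Fin m ⊕ Fin n) : ⁅(D F (Sum.inl i) : Module.End F (Alg F m n)), E⁆ (X F r) = D F (Sum.inl i) (E (X F r)) := by
  rw [lie_apply', D_X]
  split_ifs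
  · rw [apply_one hE, sub_zero]
  · rw [map_zero, sub_zero]

theorem lie_op_apply_X {E : Module.End F (Alg F m n)} (s r : Fin m ⊕ Fin n) (a : Alg F m n) :
    ⁅E, op s a⁆ (X F r) = (if s = r then E a else 0) - a * D F s (E (X F r)) := by
  rw [lie_apply', op_X, op_apply]
  split_ifs <;> simp

theorem X_mem_homog (ht : ∀ i, 0 < t i) (r : Fin m ⊕ Fin n) : X F r ∈ homog F n p t (tau r) := by
  refine ⟨?_, X_mem r⟩
  have hp := (Fact.out : p.Prime).one_lt
  cases r with
  | inl i =>
    refine mon_mem_truncAlg (fun j => ?_) _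
    by_cases h : j = i
    · subst h
      rw [Pi.single_eq_same]
      exact Nat.one_lt_pow (ht j).ne' hp
    · rw [Pi.single_eq_of_ne h]
      exact pow_pos (by omega) _
  | inr k => exact mon_mem_truncAlg (fun j => pow_pos (by omega) _) _

/-- The torus elements `x_r D_r`. -/
def tor (F : Type*) [CommRing F] {m n : ℕ} (r : Fin m ⊕ Fin n) : Module.End F (Alg F m n) :=
  op r (X F r)

theorem tor_mem (ht : ∀ i, 0 < t i) (r : Fin m ⊕ Fin n) : tor F r ∈ evenW F n p t :=
  op_mem (X_mem_homog ht r)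

theorem tor_apply (r : Fin m ⊕ Fin n) (a : Alg F m n) : tor F r a = X F r * D F r a := rfl

theorem lie_tor_tor (r s : Fin m ⊕ Fin n) :
    ⁅(tor F r : Module.End F (Alg F m n)), tor F s⁆ = 0 := by
  rw [tor, tor, lie_op_op (X_mem r) (X_mem s), D_X, D_X]
  by_cases h : r = s
  · subst h; simp
  · simp [h, Ne.symm h]

theorem lie_tor_apply_X {E : Module.End F (Alg F m n)} (s r : Fin m ⊕ Fin n) :
    ⁅tor F s, E⁆ (X F r) = tor F s (E (X F r)) - if s = r then E (X F r) else 0 := by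
  rw [lie_apply', tor_apply _ (X F r), D_X]
  split_ifs with h
  · subst h; simp
  · simp

theorem tor_inr_tor (k : Fin n) (a : Alg F m n) :
    tor F (Sum.inr k) (tor F (Sum.inr k) a) = tor F (Sum.inr k) a := by
  rw [tor_apply, tor_apply, D_inr_X_mul _ _ rfl, D_inr_D_self, mul_zero, sub_zero, if_pos rfl,
    one_mul]

variable (F n p t) in
/-- The centralizer of `D_1, …, D_m`: the elements with constant coefficients. -/
def constW : Submodule F (Module.End F (Alg F m n)) :=
  (evenW F n p t).toSubmodule ⊓
    ⨅ i : Fin m, LinearMap.ker (LieAlgebra.ad F (Module.End F (Alg F m n)) (D F (Sum.inl i)))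

theorem mem_constW {v : Module.End F (Alg F m n)} :
    v ∈ constW F n p t ↔ v ∈ evenW F n p t ∧ ∀ i, ⁅(D F (Sum.inl i) : Module.End F (Alg F m n)), v⁆ = 0 := by
  simp [constW, Submodule.mem_iInf]

theorem D_apply_X_of_mem_constW {v : Module.End F (Alg F m n)} (hv : v ∈ constW F n p t)
    (i : Fin m) (r : Fin m ⊕ Fin n) : D F (Sum.inl i) (v (X F r)) = 0 := by
  rw [mem_constW] at hv
  rw [← lie_D_apply_X i hv.1, hv.2, LinearMap.zero_apply]

theorem tor_inl_apply_X_of_mem_constW {v : Module.End F (Alg F m n)} (hv : v ∈ constW F n p t)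
    (i : Fin m) (r : Fin m ⊕ Fin n) : tor F (Sum.inl i) (v (X F r)) = 0 := by
  rw [tor_apply, D_apply_X_of_mem_constW hv, mul_zero]

theorem lie_D_tor (i : Fin m) (r : Fin m ⊕ Fin n) :
    ⁅(D F (Sum.inl i) : Module.End F (Alg F m n)), tor F r⁆ =
      if Sum.inl i = r then D F (Sum.inl i) else 0 := by
  rw [← op_one, tor, lie_op_op (r := (Sum.inl i : Fin m ⊕ Fin n))
    (one_eq_mon (F := F) (m := m) ▸ mon_mem_parityPart one_mem_extPart 0) (X_mem r), D_one, D_X]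
  split_ifs with h
  · subst h; simp
  · simp

theorem lie_tor_mem_constW (ht : ∀ i, 0 < t i) {v : Module.End F (Alg F m n)}
    (hv : v ∈ constW F n p t) (r : Fin m ⊕ Fin n) : ⁅tor F r, v⁆ ∈ constW F n p t := by
  rw [mem_constW] at hv ⊢
  refine ⟨(evenW F n p t).lie_mem (tor_mem ht r) hv.1, fun i => ?_⟩
  rw [leibniz_lie, hv.2, lie_zero, add_zero, lie_D_tor]
  split_ifs
  · exact hv.2 i
  · exact zero_lie _

/-- On the coefficient of D_s the operator ad (x_r D_r) acts as x_r D_r minus the Kronecker delta of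
r and s. On coefficients in Λ(n), x_r D_r is zero for even r and idempotent for odd r, so only the
eigenvalues 0, 1, -1 occur. -/
theorem lie_tor_cube (ht : ∀ i, 0 < t i) {v : Module.End F (Alg F m n)}
    (hv : v ∈ constW F n p t) (r : Fin m ⊕ Fin n) :
    ⁅tor F r, ⁅tor F r, ⁅tor F r, v⁆⁆⁆ = ⁅tor F r, v⁆ := by
  have h1 := lie_tor_mem_constW ht hv r
  have h2 := lie_tor_mem_constW ht h1 r
  have h3 := lie_tor_mem_constW ht h2 r
  refine eq_of_apply_X (mem_constW.1 h3).1 (mem_constW.1 h1).1 fun s => ?_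
  cases r with
  | inl i =>
    have h0 := tor_inl_apply_X_of_mem_constW hv i s
    simp only [lie_tor_apply_X, h0]
    split_ifs <;> simp [h0]
  | inr k =>
    simp only [lie_tor_apply_X]
    split_ifs <;> simp [tor_inr_tor]

/-- A common eigenvector of the torus in `Λ(n)` with the weight of `x_l` is a multiple of `x_l`. -/
theorem eq_smul_X_of_tor {θ : ZMod 2} {a : Alg F m n} (ha : a ∈ homog F n p t θ) (l : Fin n)
    (h0 : ∀ i, D F (Sum.inl i) a = 0) (h1 : tor F (Sum.inr l) a = a)
    (h2 : ∀ k, k ≠ l → tor F (Sum.inr k) a = 0) : ∃ c : F, a = c • X F (Sum.inr l) := by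
  have hD : ∀ k, k ≠ l → D F (Sum.inr k) a = 0 := fun k hk => by
    have h := congrArg (D F (Sum.inr k)) (h2 k hk)
    rwa [tor_apply, D_inr_X_mul _ _ rfl, D_inr_D_self, mul_zero, sub_zero, if_pos rfl, one_mul,
      map_zero] at h
  -- The derivative of a along x_l is killed by every D_r, hence is a constant c; then a = x_l D_l a
  -- = c x_l.
  obtain ⟨c, hc⟩ := eq_smul_one (a := D F (Sum.inr l) a) (Fact.out : p.Prime).pos
    (D_mem_truncAlg _ ha.1) fun r => by
      cases r with
      | inl i => rw [D_inl_comm, h0, map_zero]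
      | inr k =>
        by_cases hk : k = l
        · rw [hk, D_inr_D_self]
        · rw [D_inr_anticomm, hD k hk, map_zero, neg_zero]
  refine ⟨c, ?_⟩
  conv_lhs => rw [← h1, tor_apply, hc]
  simp

theorem two_ne_zero' (hp : 3 < p) : (2 : F) ≠ 0 := by
  have h : ((2 : ℕ) : F) ≠ 0 := fun h => by
    rw [CharP.cast_eq_zero_iff F p] at h
    have := Nat.le_of_dvd (by norm_num) h
    omega
  exact_mod_cast h

theorem eq_zero_of_eq_neg_self (hp : 3 < p) {M : Type*} [AddCommGroup M] [Module F M] {v : M} (h : v = -v) : v = 0 := by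
  have h1 : (2 : F) • v = 0 := by
    rw [two_smul]
    nth_rw 1 [h]
    exact neg_add_cancel v
  exact (smul_eq_zero.1 h1).resolve_left (two_ne_zero' hp)

/-- Elements of the Lie algebra with constant coefficients that commute with the torus. -/
theorem apply_X_of_lie_tor {v : Module.End F (Alg F m n)} (hv : v ∈ constW F n p t)
    (h : ∀ r : Fin m ⊕ Fin n, ⁅tor F r, v⁆ = 0) :
    (∀ i, v (X F (Sum.inl i)) = 0) ∧
      ∃ c : Fin n → F, ∀ l, v (X F (Sum.inr l)) = c l • X F (Sum.inr l) := by
  have h' : ∀ r s, tor F r (v (X F s)) = if r = s then v (X F s) else 0 := fun r s => by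
    rw [← sub_eq_zero, ← lie_tor_apply_X, h, LinearMap.zero_apply]
  constructor
  · intro i
    have := h' (Sum.inl i) (Sum.inl i)
    rw [tor_inl_apply_X_of_mem_constW hv, if_pos rfl] at this
    exact this.symm
  · choose c hc using fun l => eq_smul_X_of_tor (apply_X_mem (mem_constW.1 hv).1 (Sum.inr l)) l
      (fun i => D_apply_X_of_mem_constW hv i _) (by rw [h', if_pos rfl])
      (fun k hk => by rw [h', if_neg (by simpa using hk)])
    exact ⟨c, hc⟩

theorem X_mul_X_ne_zero {k l : Fin n} (h : k ≠ l) :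
    X F (Sum.inr k : Fin m ⊕ Fin n) * X F (Sum.inr l) ≠ 0 := by
  intro h0
  have h1 := congrArg (fun a => D F (Sum.inr l) (D F (Sum.inr k) a)) h0
  simp only [D_inr_X_mul _ _ (rfl : tau (Sum.inr k : Fin m ⊕ Fin n) = 1), D_X, map_zero] at h1
  rw [if_pos trivial, if_neg (by simpa using h), mul_zero, sub_zero, one_mul, D_X, if_pos rfl] at h1
  have h2 := congrArg (co (n := n) (0 : Fin m → ℕ)) h1
  rw [one_eq_mon, co_mon_self, map_zero] at h2
  exact one_ne_zero h2

/-- A constant element commuting with the torus is determined by its action on the `x_k x_l`. -/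
theorem eq_zero_of_lie_tor (hp : 3 < p) (hn : 2 < n) {v : Module.End F (Alg F m n)} (hv : v ∈ constW F n p t)
    (h : ∀ r : Fin m ⊕ Fin n, ⁅tor F r, v⁆ = 0)
    (h2 : ∀ k l, k ≠ l → v (X F (Sum.inr k) * X F (Sum.inr l)) = 0) : v = 0 := by
  obtain ⟨h3, c, hc⟩ := apply_X_of_lie_tor hv h
  have h4 : ∀ k l, k ≠ l → c k + c l = 0 := fun k l hkl => by
    have h5 := h2 k l hkl
    rw [apply_mul (mem_constW.1 hv).1 (X_mem (Sum.inr k)), hc, hc, smul_mul_assoc, mul_smul_comm,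
      ← add_smul] at h5
    exact (smul_eq_zero.1 h5).resolve_right (X_mul_X_ne_zero hkl)
  -- With three distinct odd indices k, l, q, the sums c_k + c_l, c_k + c_q and c_l + c_q all
  -- vanish, so 2 c_k = 0.
  have h5 : ∀ k, c k = 0 := fun k => by
    obtain ⟨l, hl⟩ : ∃ l : Fin n, l ∉ ({k} : Finset (Fin n)) := by
      by_contra! hall
      have := Finset.card_le_card (fun x _ => hall x : (Finset.univ : Finset (Fin n)) ⊆ {k})
      simp at this
      omega
    obtain ⟨q, hq⟩ : ∃ q : Fin n, q ∉ ({k, l} : Finset (Fin n)) := by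
      by_contra! hall
      have := (Finset.card_le_card
        (fun x _ => hall x : (Finset.univ : Finset (Fin n)) ⊆ {k, l})).trans Finset.card_le_two
      simp at this
      omega
    simp only [Finset.mem_singleton, Finset.mem_insert, not_or] at hl hq
    have e1 := h4 k l (Ne.symm hl)
    have e2 := h4 k q (Ne.symm hq.1)
    have e3 := h4 l q (Ne.symm hq.2)
    have e4 : 2 * c k = 0 := by linear_combination e1 + e2 - e3
    exact (mul_eq_zero.1 e4).resolve_left (two_ne_zero' hp)
  refine eq_of_apply_X (mem_constW.1 hv).1 (zero_mem (evenW F n p t)) fun r => ?_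
  cases r with
  | inl i => exact h3 i
  | inr l => rw [hc, h5, zero_smul]; rfl

end evenPart

/-! ### Derivations killing the torus -/

section torusCohomology

variable {F M ι : Type*} [Field F] [AddCommGroup M] [Module F M]

/-- A 1-cocycle on commuting operators with `a ^ 3 = a` is a coboundary up to weight zero. -/
theorem exists_weight_zero (V : Submodule F M) (a : ι → M →ₗ[F] M) (z : ι → M)
    (hV : ∀ j, ∀ v ∈ V, a j v ∈ V) (hz : ∀ j, z j ∈ V)
    (hcomm : ∀ j k, ∀ v ∈ V, a j (a k v) = a k (a j v))
    (hcube : ∀ j, ∀ v ∈ V, a j (a j (a j v)) = a j v)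
    (hcocycle : ∀ j k, a j (z k) = a k (z j)) [Finite ι] :
    ∃ u ∈ V, ∀ j k, a j (z k - a k u) = 0 := by
  classical
  have := Fintype.ofFinite ι
  suffices H : ∀ s : Finset ι, ∃ u ∈ V, ∀ k ∈ s, a k (z k - a k u) = 0 by
    obtain ⟨u, hu, h⟩ := H Finset.univ
    refine ⟨u, hu, fun j k => ?_⟩
    have hmem : z k - a k u ∈ V := sub_mem (hz k) (hV k u hu)
    -- The remainder is first shown to be killed by the square of a_j; since a_j equals its own
    -- cube, a_j itself then kills it.
    have h1 : a j (a j (z k - a k u)) = 0 := by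
      have : a j (z k - a k u) = a k (z j - a j u) := by
        rw [map_sub, map_sub, hcocycle j k, hcomm j k u hu]
      rw [this, hcomm j k _ (sub_mem (hz j) (hV j u hu)), h j (Finset.mem_univ j), map_zero]
    rw [← hcube j _ hmem, h1, map_zero]
  intro s
  induction s using Finset.induction_on with
  | empty => exact ⟨0, zero_mem _, by simp⟩
  | insert i s _ ih =>
    obtain ⟨u, hu, h⟩ := ih
    have hmem : ∀ k, z k - a k u ∈ V := fun k => sub_mem (hz k) (hV k u hu)
    have hcoc : ∀ j k, a j (z k - a k u) = a k (z j - a j u) := fun j k => by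
      rw [map_sub, map_sub, hcocycle j k, hcomm j k u hu]
    -- On the nonzero weights of a_i its square is the identity, so a_i inverts itself there. With w
    -- = z_i - a_i u the new remainder is w - a_i (a_i w), and a_i kills it because its cube is a_i.
    refine ⟨u + a i (z i - a i u), add_mem hu (hV i _ (hmem i)), fun k hk => ?_⟩
    have e : z k - a k (u + a i (z i - a i u)) = (z k - a k u) - a k (a i (z i - a i u)) := by
      rw [map_add]
      abel
    rw [e, map_sub]
    rcases Finset.mem_insert.1 hk with rfl | hk
    · rw [hcube k _ (hmem k), sub_self]
    · have e2 : a k (a i (z i - a i u)) = a i (a i (z k - a k u)) := by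
        rw [hcomm k i _ (hmem i), hcoc k i]
      rw [e2, h k hk, hcomm k i _ (hV i _ (hmem k)), hcomm k i _ (hmem k), h k hk, map_zero,
        map_zero, sub_zero]

/-- Semisimplicity: a generalized eigenvector of an operator with `a ^ 3 = a` is an eigenvector. -/
theorem eq_zero_of_generalized_eigenvector (a : M →ₗ[F] M) {x q : M} {w : F} (h2 : (2 : F) ≠ 0)
    (hw : w = 0 ∨ w = 1 ∨ w = -1) (hx : a (a (a x)) = a x) (h : a x = w • x - q)
    (hq : a q = w • q) : q = 0 := by
  have h1 : a (a x) = (w * w) • x - (2 * w) • q := by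
    rw [h, map_sub, map_smul, hq, h]
    module
  have h3 : a (a (a x)) = (w * w * w) • x - (3 * (w * w)) • q := by
    rw [h1, map_sub, map_smul, map_smul, hq, h]
    module
  rw [h3, h] at hx
  -- Comparing the cube of a on x with a on x. For w in {0, 1, -1} the right side vanishes, and the
  -- factor on the left is -1 or 2.
  have h4 : (3 * (w * w) - 1) • q = (w * w * w - w) • x := by
    have : (3 * (w * w) - 1) • q - (w * w * w - w) • x =
        (w • x - q) - ((w * w * w) • x - (3 * (w * w)) • q) := by module
    rw [← sub_eq_zero, this, hx, sub_self]
  rcases hw with rfl | rfl | rfl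
  · simpa using h4
  · have h5 : (2 : F) • q = 0 := by
      convert h4 using 2 <;> norm_num
    exact (smul_eq_zero.1 h5).resolve_left h2
  · have h5 : (2 : F) • q = 0 := by
      convert h4 using 2 <;> norm_num
    exact (smul_eq_zero.1 h5).resolve_left h2

end torusCohomology

/-! ### Derivations of the even part, and their normalisation on the torus -/

section derivations

variable {F : Type*} [Field F] {m n p : ℕ} [Fact p.Prime] [CharP F p] {t : Fin m → ℕ}

variable (n p t) in
/-- A linear map on operators that restricts to a derivation of the Lie algebra. -/
structure IsDer (d : Module.End F (Alg F m n) →ₗ[F] Module.End F (Alg F m n)) : Prop where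
  map_mem : ∀ E ∈ evenW F n p t, d E ∈ evenW F n p t
  leib : ∀ E ∈ evenW F n p t, ∀ E' ∈ evenW F n p t, d ⁅E, E'⁆ = ⁅d E, E'⁆ + ⁅E, d E'⁆

variable {d : Module.End F (Alg F m n) →ₗ[F] Module.End F (Alg F m n)}

theorem IsDer.sub (hd : IsDer n p t d)
    {d' : Module.End F (Alg F m n) →ₗ[F] Module.End F (Alg F m n)} (hd' : IsDer n p t d') :
    IsDer n p t (d - d') where
  map_mem E hE := sub_mem (hd.map_mem E hE) (hd'.map_mem E hE)
  leib E hE E' hE' := by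
    simp only [LinearMap.sub_apply, hd.leib E hE E' hE', hd'.leib E hE E' hE', sub_lie, lie_sub]
    abel

theorem isDer_ad {y : Module.End F (Alg F m n)} (hy : y ∈ evenW F n p t) :
    IsDer n p t (LieAlgebra.ad F _ y) where
  map_mem E hE := (evenW F n p t).lie_mem hy hE
  leib E _ E' _ := by simp only [LieAlgebra.ad_apply]; exact leibniz_lie y E E'

/-- The Lie algebra elements killed by a derivation. -/
def IsDer.ker (hd : IsDer n p t d) : LieSubalgebra F (Module.End F (Alg F m n)) :=
  { (evenW F n p t).toSubmodule ⊓ LinearMap.ker d with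
    lie_mem' := by
      rintro E E' ⟨hE, h⟩ ⟨hE', h'⟩
      refine ⟨(evenW F n p t).lie_mem hE hE', ?_⟩
      change d _ = 0
      rw [hd.leib E hE E' hE', LinearMap.mem_ker.1 h, LinearMap.mem_ker.1 h', zero_lie, lie_zero,
        add_zero] }

theorem IsDer.mem_ker (hd : IsDer n p t d) {E : Module.End F (Alg F m n)} :
    E ∈ hd.ker ↔ E ∈ evenW F n p t ∧ d E = 0 := Iff.rfl

theorem lie_smul_end (c : F) (E E' : Module.End F (Alg F m n)) : ⁅E, c • E'⁆ = c • ⁅E, E'⁆ := by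
  rw [Ring.lie_def, Ring.lie_def, mul_smul_comm, smul_mul_assoc, smul_sub]

theorem lie_sum_smul_end {ι : Type*} [Fintype ι] (c : ι → F)
    (E : ι → Module.End F (Alg F m n)) (E' : Module.End F (Alg F m n)) :
    ⁅∑ k, c k • E k, E'⁆ = ∑ k, c k • ⁅E k, E'⁆ := by
  simp only [Ring.lie_def, Finset.sum_mul, Finset.mul_sum, smul_mul_assoc, mul_smul_comm, smul_sub,
    Finset.sum_sub_distrib]

theorem lie_tor_op (r : Fin m ⊕ Fin n) {s : Fin m ⊕ Fin n} {a : Alg F m n}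
    (ha : a ∈ parityPart F m n (tau s)) :
    ⁅tor F r, op s a⁆ = op s (tor F r a) - if r = s then op s a else 0 := by
  rw [tor, lie_op_op (X_mem r) ha, D_X]
  congr 1
  by_cases h : r = s
  · subst h; simp
  · simp [h, Ne.symm h]

theorem lie_D_op (i : Fin m) {s : Fin m ⊕ Fin n} {a : Alg F m n}
    (ha : a ∈ parityPart F m n (tau s)) :
    ⁅(D F (Sum.inl i) : Module.End F (Alg F m n)), op s a⁆ = op s (D F (Sum.inl i) a) := by
  rw [← op_one, lie_op_op (r := (Sum.inl i : Fin m ⊕ Fin n))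
    (one_eq_mon (F := F) (m := m) ▸ mon_mem_parityPart one_mem_extPart 0) ha, D_one, mul_zero,
    map_zero, sub_zero, one_mul, op_one]

/-- A derivation killing D_i commutes with ad D_i, so the value at E is annihilated by ad D_i as
soon as d kills [D_i, E]. -/
theorem IsDer.apply_mem_constW (hd : IsDer n p t d) (h0 : ∀ i, d (D F (Sum.inl i)) = 0)
    {E : Module.End F (Alg F m n)} (hE : E ∈ evenW F n p t)
    (h : ∀ i, d ⁅(D F (Sum.inl i) : Module.End F (Alg F m n)), E⁆ = 0) : d E ∈ constW F n p t := by
  refine mem_constW.2 ⟨hd.map_mem E hE, fun i => ?_⟩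
  have := h i
  rwa [hd.leib _ (D_inl_mem i) E hE, h0, zero_lie, zero_add] at this

theorem IsDer.op_mem_constW (hd : IsDer n p t d) (h0 : ∀ i, d (D F (Sum.inl i)) = 0)
    {s : Fin m ⊕ Fin n} {a : Alg F m n} (ha : a ∈ homog F n p t (tau s))
    (h : ∀ i, d (op s (D F (Sum.inl i) a)) = 0) : d (op s a) ∈ constW F n p t :=
  hd.apply_mem_constW h0 (op_mem ha) fun i => by rw [lie_D_op i ha.2, h]

theorem X_mul_X_mem_parityPart (k l : Fin n) :
    X F (Sum.inr k : Fin m ⊕ Fin n) * X F (Sum.inr l) ∈ parityPart F m n 0 := by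
  have h := mul_mem_parityPart (X_mem (F := F) (Sum.inr k : Fin m ⊕ Fin n))
    (X_mem (Sum.inr l))
  change _ ∈ parityPart F m n (1 + 1) at h
  rwa [CharTwo.add_self_eq_zero] at h

theorem X_mul_X_mem_homog (k l : Fin n) :
    X F (Sum.inr k : Fin m ⊕ Fin n) * X F (Sum.inr l) ∈ homog F n p t 0 := by
  have h := extPart_mul_mem (gen_mem (F := F) k) (gen_mem l)
  rw [CharTwo.add_self_eq_zero] at h
  rw [X_inr, X_inr, mon_zero_mul_mon]
  exact mon_mem_homog (fun _ => pow_pos (Fact.out : p.Prime).pos _) h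

theorem tor_X_mul_X (r : Fin m ⊕ Fin n) {k l : Fin n} (h : k ≠ l) :
    tor F r (X F (Sum.inr k) * X F (Sum.inr l)) =
      (if r = Sum.inr k ∨ r = Sum.inr l then 1 else 0 : F) •
        (X F (Sum.inr k) * X F (Sum.inr l)) := by
  cases r with
  | inl i => simp [tor_apply, D_inl_mul, D_X]
  | inr q =>
    rw [tor_apply, D_inr_X_mul _ _ rfl, D_X]
    by_cases h1 : q = k
    · subst h1; simp [h]
    · by_cases h2 : q = l
      · subst h2; simp [h1, X_inr_mul_comm q k]
      · simp [h1, h2]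

theorem D_inl_X_mul_X (i : Fin m) (k l : Fin n) :
    D F (Sum.inl i) (X F (Sum.inr k) * X F (Sum.inr l)) = 0 := by
  simp [D_inl_mul, D_X]

/-- A derivation killing `D_1, …, D_m` kills the torus up to an inner derivation. -/
theorem IsDer.exists_kill_tor (hd : IsDer n p t d) (hp : 3 < p) (hm : 0 < m) (hn : 2 < n)
    (ht : ∀ i, 0 < t i) (h0 : ∀ i, d (D F (Sum.inl i)) = 0) :
    ∃ y ∈ evenW F n p t, (∀ i, (d - LieAlgebra.ad F _ y) (D F (Sum.inl i)) = 0) ∧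
      ∀ r, (d - LieAlgebra.ad F _ y) (tor F r) = 0 := by
  have hz : ∀ r, d (tor F r) ∈ constW F n p t := fun r =>
    hd.apply_mem_constW h0 (tor_mem ht r) fun i => by
      rw [lie_D_tor]
      split_ifs
      · exact h0 i
      · exact map_zero d
  have hcoc : ∀ r s, ⁅tor F r, d (tor F s)⁆ = ⁅tor F s, d (tor F r)⁆ := fun r s => by
    have h := hd.leib _ (tor_mem ht r) _ (tor_mem ht s)
    rw [lie_tor_tor, map_zero, ← lie_skew, ← sub_eq_neg_add] at h
    exact (sub_eq_zero.1 h.symm)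
  obtain ⟨u, hu, hu'⟩ := exists_weight_zero (constW F n p t)
    (fun r : Fin m ⊕ Fin n => LieAlgebra.ad F (Module.End F (Alg F m n)) (tor F r))
    (fun r => d (tor F r)) (fun r v hv => lie_tor_mem_constW ht hv r) hz
    (fun r s v _ => by
      simp only [LieAlgebra.ad_apply]
      rw [leibniz_lie, lie_tor_tor, zero_lie, zero_add])
    (fun r v hv => lie_tor_cube ht hv r) hcoc
  simp only [LieAlgebra.ad_apply] at hu'
  have huL := (mem_constW.1 hu).1
  -- The inner correction is by -u, because [-u, x_r D_r] = [x_r D_r, u] is the coboundary to be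
  -- subtracted.
  have hd' := hd.sub (isDer_ad (neg_mem huL : -u ∈ evenW F n p t))
  refine ⟨-u, neg_mem huL, ?_⟩
  set d' := d - LieAlgebra.ad F _ (-u) with hd'_def
  have h0' : ∀ i, d' (D F (Sum.inl i)) = 0 := fun i => by
    rw [hd'_def, LinearMap.sub_apply, h0, LieAlgebra.ad_apply, neg_lie, lie_skew,
      (mem_constW.1 hu).2, sub_zero]
  refine ⟨h0', fun r => ?_⟩
  have hz' : ∀ r, d' (tor F r) = d (tor F r) - ⁅tor F r, u⁆ := fun r => by
    rw [hd'_def, LinearMap.sub_apply, LieAlgebra.ad_apply, neg_lie, lie_skew]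
  have hzm : ∀ r, d' (tor F r) ∈ constW F n p t := fun r => by
    rw [hz']
    exact sub_mem (hz r) (lie_tor_mem_constW ht hu r)
  have hT : ∀ s, ⁅tor F s, d' (tor F r)⁆ = 0 := fun s => by rw [hz']; exact hu' s r
  -- What is left of d'(x_r D_r) has weight zero, hence is a combination of the x_l D_l with l odd.
  -- It is tested against the fields x_k x_l D_j.
  refine eq_zero_of_lie_tor hp hn (hzm r) hT fun k l hkl => ?_
  let j : Fin m := ⟨0, hm⟩
  set a : Alg F m n := X F (Sum.inr k) * X F (Sum.inr l) with ha
  have hmem : a ∈ homog F n p t (tau (Sum.inl j : Fin m ⊕ Fin n)) := X_mul_X_mem_homog k l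
  have hy : op (Sum.inl j) a ∈ evenW F n p t := op_mem hmem
  have hw : ∃ w : F, (w = 0 ∨ w = 1 ∨ w = -1) ∧
      ⁅tor F r, op (Sum.inl j) a⁆ = w • op (Sum.inl j) a := by
    rw [lie_tor_op r hmem.2, ha, tor_X_mul_X r hkl, map_smul]
    by_cases h1 : r = Sum.inl j
    · subst h1; exact ⟨-1, by simp, by simp⟩
    · by_cases h2 : r = Sum.inr k ∨ r = Sum.inr l
      · exact ⟨1, by simp, by simp [h1, h2]⟩
      · exact ⟨0, by simp, by simp [h1, h2]⟩
  obtain ⟨w, hw, hwy⟩ := hw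
  have hconst : d' (op (Sum.inl j) a) ∈ constW F n p t :=
    hd'.op_mem_constW h0' hmem fun i => by rw [ha, D_inl_X_mul_X, map_zero, map_zero]
  -- Applying d' to the weight equation of E = x_k x_l D_j gives [x_r D_r, d' E] = w d' E - [d'(x_r
  -- D_r), E]. The bracket on the right again has weight w, so d' E would be a proper generalized
  -- eigenvector; semisimplicity forces this bracket to vanish.
  have hq : ⁅d' (tor F r), op (Sum.inl j) a⁆ = 0 := by
    refine eq_zero_of_generalized_eigenvector (LieAlgebra.ad F _ (tor F r))
      (x := d' (op (Sum.inl j) a)) (w := w) (two_ne_zero' hp) hw (lie_tor_cube ht hconst r) ?_ ?_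
    · have h := hd'.leib _ (tor_mem ht r) _ hy
      rw [hwy, map_smul] at h
      rw [LieAlgebra.ad_apply, h]
      abel
    · rw [LieAlgebra.ad_apply, leibniz_lie, hT, zero_lie, zero_add, hwy, lie_smul_end]
  have h1 := congrArg (fun E => E (X F (Sum.inl j))) hq
  simp only [lie_op_apply_X, if_true, LinearMap.zero_apply] at h1
  rwa [(apply_X_of_lie_tor (hzm r) hT).1 j, map_zero, mul_zero, sub_zero] at h1

/-- The weight equations for the value of a derivation on a weight vector. -/
theorem IsDer.tor_apply_X (hd : IsDer n p t d) (ht : ∀ i, 0 < t i) {r : Fin m ⊕ Fin n}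
    (hT : d (tor F r) = 0) {E : Module.End F (Alg F m n)}
    (hE : E ∈ evenW F n p t) {w : F} (hw : ⁅tor F r, E⁆ = w • E) (s : Fin m ⊕ Fin n) :
    tor F r (d E (X F s)) = (w + if r = s then 1 else 0) • d E (X F s) := by
  have h := hd.leib _ (tor_mem ht r) E hE
  rw [hw, hT, zero_lie, zero_add, map_smul] at h
  have h1 := congrArg (fun E => E (X F s)) h
  simp only [lie_tor_apply_X, LinearMap.smul_apply] at h1
  rw [add_smul, h1]
  split_ifs <;> simp

/-- The coefficients of a constant field are killed by x_i D_i, so a coefficient can survive only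
where its predicted weight is zero in F. -/
theorem IsDer.weight_smul_eq_zero (hd : IsDer n p t d) (ht : ∀ i, 0 < t i) {i : Fin m}
    (hT : d (tor F (Sum.inl i : Fin m ⊕ Fin n)) = 0) {E : Module.End F (Alg F m n)} (hE : E ∈ evenW F n p t)
    (hc : d E ∈ constW F n p t) {w : F} (hw : ⁅tor F (Sum.inl i : Fin m ⊕ Fin n), E⁆ = w • E)
    (s : Fin m ⊕ Fin n) : (w + if Sum.inl i = s then 1 else 0) • d E (X F s) = 0 := by
  rw [← hd.tor_apply_X ht hT hE hw s, tor_inl_apply_X_of_mem_constW hc]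

/-- Elements of weight `1` are killed as soon as their derivatives are. -/
theorem IsDer.op_mem_ker (hd : IsDer n p t d) (hp : 3 < p) (ht : ∀ i, 0 < t i)
    (h0 : ∀ i, d (D F (Sum.inl i)) = 0) {s : Fin m ⊕ Fin n} {a : Alg F m n} {i : Fin m}
    (hT : d (tor F (Sum.inl i : Fin m ⊕ Fin n)) = 0)
    (ha : a ∈ homog F n p t (tau s)) (his : Sum.inl i ≠ s) (hw : tor F (Sum.inl i) a = a)
    (h : ∀ j, d (op s (D F (Sum.inl j) a)) = 0) : op s a ∈ hd.ker := by
  refine hd.mem_ker.2 ⟨op_mem ha, ?_⟩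
  have hc := hd.op_mem_constW h0 ha h
  have hw' : ⁅tor F (Sum.inl i : Fin m ⊕ Fin n), op s a⁆ = (1 : F) • op s a := by
    rw [lie_tor_op _ ha.2, hw, if_neg his, sub_zero, one_smul]
  refine eq_of_apply_X (hd.map_mem _ (op_mem ha)) (zero_mem (evenW F n p t)) fun r => ?_
  -- The predicted weight is 2 for the component along D_i and 1 for all others, never zero.
  have h1 := hd.weight_smul_eq_zero ht hT (op_mem ha) hc hw' r
  refine (smul_eq_zero.1 h1).resolve_left ?_
  split_ifs
  · rw [one_add_one_eq_two]; exact two_ne_zero' hp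
  · rw [add_zero]; exact one_ne_zero

end derivations

/-! ### Derivations killing the torus kill the constant elements up to an inner derivation -/

section exteriorSpan

variable {F : Type*} [CommRing F] {n : ℕ}

/-- Writing odd elements as even elements times one generator lets the odd fields be produced by
brackets from even coefficients and the x_k D_l. -/
theorem odd_le_span : extPart F n 1 ≤
    Submodule.span F {b | ∃ a ∈ extPart F n 0, ∃ k, b = a * gen F k} := by
  intro b hb
  induction b, hb using CliffordAlgebra.odd_induction with
  | ι v =>
    change ExteriorAlgebra.ι F v ∈ _
    rw [ι_eq_sum]
    exact sum_mem fun k _ => Submodule.smul_mem _ _ (Submodule.subset_span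
      ⟨1, one_mem_extPart, k, (one_mul _).symm⟩)
  | add x y hx hy ihx ihy => exact add_mem ihx ihy
  | ι_mul_ι_mul v w x hx ih =>
    clear hx
    have hvw : ExteriorAlgebra.ι F v * ExteriorAlgebra.ι F w ∈ extPart F n 0 :=
      CliffordAlgebra.ι_mul_ι_mem_evenOdd_zero _ v w
    induction ih using Submodule.span_induction with
    | zero => rw [mul_zero]; exact zero_mem _
    | add x y _ _ hx hy => rw [mul_add]; exact add_mem hx hy
    | smul c x _ hx => rw [mul_smul_comm]; exact Submodule.smul_mem _ c hx
    | mem x hx =>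
      obtain ⟨a, ha, k, rfl⟩ := hx
      rw [← mul_assoc]
      have h := extPart_mul_mem hvw ha
      rw [zero_add] at h
      exact Submodule.subset_span ⟨_, h, k, rfl⟩

theorem even_le_span : extPart F n 0 ≤
    Submodule.span F ({1} ∪ {a | ∃ b ∈ extPart F n 1, ∃ k, a = gen F k * b}) := by
  intro a ha
  induction a, ha using CliffordAlgebra.even_induction with
  | algebraMap r =>
    rw [Algebra.algebraMap_eq_smul_one]
    exact Submodule.smul_mem _ _ (Submodule.subset_span (Or.inl rfl))
  | add x y hx hy ihx ihy => exact add_mem ihx ihy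
  | ι_mul_ι_mul v w x hx ih =>
    change ExteriorAlgebra.ι F v * ExteriorAlgebra.ι F w * x ∈ _
    rw [ι_eq_sum v, mul_assoc, Finset.sum_mul]
    refine sum_mem fun k _ => ?_
    rw [smul_mul_assoc]
    have h := extPart_mul_mem (ι_mem_extPart w) hx
    rw [add_zero] at h
    exact Submodule.smul_mem _ _ (Submodule.subset_span (Or.inr ⟨_, h, k, rfl⟩))

end exteriorSpan

/-! ### Normalisation on 𝔤𝔩(n) and on the quadratic fields -/

section constants

variable {F : Type*} [Field F] {m n p : ℕ} [Fact p.Prime] [CharP F p] {t : Fin m → ℕ}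
variable {d : Module.End F (Alg F m n) →ₗ[F] Module.End F (Alg F m n)}

theorem binom_single (j : Fin m) (α : Fin m → ℕ) :
    DividedPow.binom (Pi.single j 1) α = α j + 1 := by
  rw [DividedPow.binom_split j, Finset.prod_eq_one]
  · simp [add_comm]
  · intro i hi
    rw [Pi.single_eq_of_ne (Finset.ne_of_mem_erase hi), Nat.choose_zero_right]

theorem tor_inl_mon (j : Fin m) (α : Fin m → ℕ) (ω : Ext F n) :
    tor F (Sum.inl j) (mon α ω) = (α j : F) • mon α ω := by
  rw [tor_apply]
  by_cases h : α j = 0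
  · rw [D_inl_mon_zero j h, h, mul_zero, Nat.cast_zero, zero_smul]
  · obtain ⟨β, rfl⟩ := DividedPow.exists_add j α h
    rw [D_inl_mon_add, X_inl, mon_mul_mon, binom_single, one_mul, add_comm β]
    simp [add_comm]

theorem lie_gl_quad (k l q : Fin n) (hlq : l ≠ q) (i : Fin m) :
    ⁅op (Sum.inr l) (X F (Sum.inr k : Fin m ⊕ Fin n)),
      op (Sum.inl i) (X F (Sum.inr l) * X F (Sum.inr q))⁆ =
      op (Sum.inl i) (X F (Sum.inr k) * X F (Sum.inr q)) := by
  rw [lie_op_op (r := Sum.inr l) (s := Sum.inl i) (X_mem (Sum.inr k))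
    (X_mul_X_mem_parityPart l q), D_inr_X_mul _ _ rfl, D_X, D_X]
  simp [hlq]

theorem lie_gl_gl (k l q : Fin n) (hkq : k ≠ q) :
    ⁅op (Sum.inr l) (X F (Sum.inr k : Fin m ⊕ Fin n)), op (Sum.inr q) (X F (Sum.inr l : Fin m ⊕ Fin n))⁆ =
      op (Sum.inr q) (X F (Sum.inr k)) := by
  rw [lie_op_op (r := Sum.inr l) (s := Sum.inr q) (X_mem (Sum.inr k)) (X_mem (Sum.inr l)), D_X,
    D_X]
  simp [hkq.symm]

theorem lie_gl_gl_self {k l : Fin n} :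
    ⁅op (Sum.inr l) (X F (Sum.inr k : Fin m ⊕ Fin n)), op (Sum.inr k) (X F (Sum.inr l : Fin m ⊕ Fin n))⁆ =
      tor F (Sum.inr k) - tor F (Sum.inr l) := by
  rw [lie_op_op (r := Sum.inr l) (s := Sum.inr k) (X_mem (Sum.inr k)) (X_mem (Sum.inr l)), D_X,
    D_X, tor, tor]
  simp

theorem tor_X (r s : Fin m ⊕ Fin n) : tor F r (X F s) = if r = s then X F s else 0 := by
  rw [tor_apply, D_X]
  by_cases h : r = s
  · subst h; simp
  · simp [h]

theorem gl_mem (k l : Fin n) (ht : ∀ i, 0 < t i) :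
    X F (Sum.inr k : Fin m ⊕ Fin n) ∈ homog F n p t (tau (Sum.inr l : Fin m ⊕ Fin n)) :=
  X_mem_homog ht (Sum.inr k)

theorem lie_tor_gl (r : Fin m ⊕ Fin n) (k l : Fin n) :
    ⁅tor F r, op (Sum.inr l) (X F (Sum.inr k : Fin m ⊕ Fin n))⁆ =
      ((if r = Sum.inr k then 1 else 0) - (if r = Sum.inr l then 1 else 0) : F) •
        op (Sum.inr l) (X F (Sum.inr k)) := by
  rw [lie_tor_op r (s := Sum.inr l) (X_mem (Sum.inr k)), tor_X, sub_smul]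
  split_ifs <;> simp

theorem lie_tor_quad (r : Fin m ⊕ Fin n) {k l : Fin n} (hkl : k ≠ l) (i : Fin m) :
    ⁅tor F r, op (Sum.inl i) (X F (Sum.inr k) * X F (Sum.inr l))⁆ =
      ((if r = Sum.inr k ∨ r = Sum.inr l then 1 else 0) - (if r = Sum.inl i then 1 else 0) : F) •
        op (Sum.inl i) (X F (Sum.inr k) * X F (Sum.inr l)) := by
  rw [lie_tor_op r (s := Sum.inl i) (X_mul_X_mem_parityPart k l),
    tor_X_mul_X r hkl, map_smul, sub_smul]
  split_ifs <;> simp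

/-- Since d kills the torus it preserves weights, and up to scalars x_k D_l is the only constant
field of its weight. -/
theorem IsDer.exists_gl_smul (hd : IsDer n p t d) (hp : 3 < p) (ht : ∀ i, 0 < t i)
    (h0 : ∀ i, d (D F (Sum.inl i)) = 0) (hT : ∀ r, d (tor F r) = 0) {k l : Fin n} (hkl : k ≠ l) :
    ∃ c : F, d (op (Sum.inr l) (X F (Sum.inr k))) = c • op (Sum.inr l) (X F (Sum.inr k)) := by
  have hE : op (Sum.inr l) (X F (Sum.inr k : Fin m ⊕ Fin n)) ∈ evenW F n p t :=
    op_mem (gl_mem k l ht)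
  have hc := hd.op_mem_constW h0 (gl_mem (m := m) (p := p) (F := F) k l ht) fun i => by
    rw [D_X, if_neg (by simp), map_zero, map_zero]
  have hw := fun r s => hd.tor_apply_X ht (hT r) hE (lie_tor_gl r k l) s
  obtain ⟨c, hcX⟩ := eq_smul_X_of_tor (apply_X_mem (mem_constW.1 hc).1 (Sum.inr l)) k
    (fun i => D_apply_X_of_mem_constW hc i _)
    (by rw [hw]; simp [hkl])
    (fun q hq => by
      rw [hw]
      by_cases h : q = l
      · subst h; simp [hq]
      · simp [hq, h])
  refine ⟨c, eq_of_apply_X (hd.map_mem _ hE) ((evenW F n p t).smul_mem c hE) fun s => ?_⟩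
  rw [LinearMap.smul_apply, op_X]
  by_cases hs : Sum.inr l = s
  · rw [← hs, hcX, if_pos rfl]
  · rw [if_neg hs, smul_zero]
    cases s with
    | inl i =>
      have := hd.weight_smul_eq_zero ht (hT _) hE hc (lie_tor_gl (Sum.inl i) k l) (Sum.inl i)
      simpa using this
    | inr q =>
      -- A component along D_q with q ≠ l would be an eigenvector of x_l D_l for -1, but that
      -- operator is idempotent.
      have h1 := hw (Sum.inr l) (Sum.inr q)
      simp only [hkl.symm, hs, if_true, if_false, Sum.inr.injEq, zero_sub, add_zero, neg_smul,
        one_smul] at h1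
      have h2 := tor_inr_tor l (d (op (Sum.inr l) (X F (Sum.inr k))) (X F (Sum.inr q)))
      rw [h1, map_neg, h1, neg_neg] at h2
      exact eq_zero_of_eq_neg_self (F := F) hp h2

/-- The weight -1 under x_i D_i leaves only the component along D_i. Its coefficient has odd weights
1 at k and l and 0 elsewhere; differentiating by x_k gives the weight of x_l, hence a multiple of
x_l, and multiplying by x_k recovers the coefficient. -/
theorem IsDer.exists_quad_smul (hd : IsDer n p t d) (ht : ∀ i, 0 < t i)
    (h0 : ∀ i, d (D F (Sum.inl i)) = 0) (hT : ∀ r, d (tor F r) = 0) {k l : Fin n} (hkl : k ≠ l)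
    (i : Fin m) :
    ∃ c : F, d (op (Sum.inl i) (X F (Sum.inr k) * X F (Sum.inr l))) =
      c • op (Sum.inl i) (X F (Sum.inr k) * X F (Sum.inr l)) := by
  have hmem : X F (Sum.inr k : Fin m ⊕ Fin n) * X F (Sum.inr l) ∈
      homog F n p t (tau (Sum.inl i : Fin m ⊕ Fin n)) := X_mul_X_mem_homog k l
  have hE := op_mem hmem
  have hc := hd.op_mem_constW h0 hmem fun j => by rw [D_inl_X_mul_X, map_zero, map_zero]
  have hw := fun r s => hd.tor_apply_X ht (hT r) hE (lie_tor_quad r hkl i) s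
  set x := d (op (Sum.inl i) (X F (Sum.inr k) * X F (Sum.inr l))) (X F (Sum.inl i)) with hx
  have hxm : x ∈ homog F n p t 0 := apply_X_mem (mem_constW.1 hc).1 (Sum.inl i)
  have hwx : ∀ q, tor F (Sum.inr q) x = (if q = k ∨ q = l then 1 else 0 : F) • x := fun q => by
    rw [hx, hw]
    simp
  have hcomm : ∀ q, q ≠ k → ∀ a : Alg F m n,
      tor F (Sum.inr q) (D F (Sum.inr k) a) = D F (Sum.inr k) (tor F (Sum.inr q) a) :=
    fun q hq a => by
      rw [tor_apply, tor_apply, D_inr_X_mul _ _ rfl, if_neg (by simpa using hq.symm), zero_mul,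
        zero_sub, D_inr_anticomm q k, mul_neg]
  obtain ⟨c, hcX⟩ := eq_smul_X_of_tor (D_mem_homog (Sum.inr k) hxm) l
    (fun j => by rw [D_inl_comm, D_apply_X_of_mem_constW hc, map_zero])
    (by rw [hcomm l hkl.symm, hwx]; simp)
    (fun q hq => by
      by_cases h : q = k
      · rw [h, tor_apply, D_inr_D_self, mul_zero]
      · rw [hcomm q h, hwx]; simp [h, hq])
  have hxe : x = c • (X F (Sum.inr k) * X F (Sum.inr l)) := by
    have h1 := hwx k
    rw [tor_apply, hcX, mul_smul_comm] at h1
    rw [h1]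
    simp
  refine ⟨c, eq_of_apply_X (hd.map_mem _ hE) ((evenW F n p t).smul_mem c hE) fun s => ?_⟩
  rw [LinearMap.smul_apply, op_X]
  by_cases hs : Sum.inl i = s
  · rw [← hs, if_pos rfl, ← hxe]
  · rw [if_neg hs, smul_zero]
    have := hd.weight_smul_eq_zero ht (hT _) hE hc (lie_tor_quad (Sum.inl i) hkl i) s
    simpa [hs] using this

variable (n p t) in
/-- A derivation that kills the elements of low degree. -/
structure IsNormal (d : Module.End F (Alg F m n) →ₗ[F] Module.End F (Alg F m n)) : Prop where
  isDer : IsDer n p t d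
  map_D : ∀ i, d (D F (Sum.inl i)) = 0
  map_tor : ∀ r, d (tor F r) = 0
  map_gl : ∀ k l, d (op (Sum.inr l) (X F (Sum.inr k))) = 0
  map_quad : ∀ k l i, d (op (Sum.inl i) (X F (Sum.inr k) * X F (Sum.inr l))) = 0

/-- For i ≠ j the field has weight 1 under x_i D_i and its derivatives are zero or D_j, which d
kills. -/
theorem IsDer.linear_mem_ker (hd : IsDer n p t d) (hp : 3 < p) (ht : ∀ i, 0 < t i)
    (h0 : ∀ i, d (D F (Sum.inl i)) = 0) (hT : ∀ r, d (tor F r) = 0) (i j : Fin m) :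
    op (Sum.inl j) (X F (Sum.inl i)) ∈ hd.ker := by
  by_cases hij : i = j
  · rw [hij]
    exact ⟨tor_mem ht _, hT _⟩
  · refine hd.op_mem_ker hp ht h0 (hT (Sum.inl i)) (X_mem_homog ht (Sum.inl i)) (by simpa using hij)
      (by rw [tor_X, if_pos rfl]) fun q => ?_
    rw [D_X]
    split_ifs
    · rw [op_one, h0]
    · rw [map_zero, map_zero]

theorem lie_quad_linear (k l : Fin n) (i j : Fin m) :
    ⁅op (Sum.inl i) (X F (Sum.inr k) * X F (Sum.inr l)), op (Sum.inl j) (X F (Sum.inl i))⁆ =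
      op (Sum.inl j) (X F (Sum.inr k : Fin m ⊕ Fin n) * X F (Sum.inr l)) := by
  rw [lie_op_op (r := Sum.inl i) (s := Sum.inl j)
    (X_mul_X_mem_parityPart k l) (X_mem (Sum.inl i)), D_inl_X_mul_X, D_X]
  simp

/-- Derivations killing the torus kill `𝔤𝔩(n)` up to an inner derivation. -/
theorem IsDer.exists_kill_gl (hd : IsDer n p t d) (hp : 3 < p) (hn : 2 < n)
    (ht : ∀ i, 0 < t i) (h0 : ∀ i, d (D F (Sum.inl i)) = 0) (hT : ∀ r, d (tor F r) = 0) :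
    ∃ y ∈ evenW F n p t, (∀ i, (d - LieAlgebra.ad F _ y) (D F (Sum.inl i)) = 0) ∧
      (∀ r, (d - LieAlgebra.ad F _ y) (tor F r) = 0) ∧
      ∀ k l, (d - LieAlgebra.ad F _ y) (op (Sum.inr l) (X F (Sum.inr k))) = 0 := by
  let o : Fin n := ⟨0, by omega⟩
  have hex : ∀ k : Fin n, ∃ c : F, k ≠ o →
      d (op (Sum.inr o) (X F (Sum.inr k))) = c • op (Sum.inr o) (X F (Sum.inr k)) := fun k => by
    by_cases h : k = o
    · exact ⟨0, fun h' => absurd h h'⟩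
    · obtain ⟨c, hc⟩ := hd.exists_gl_smul hp ht h0 hT h
      exact ⟨c, fun _ => hc⟩
  choose c hc using hex
  -- The inner derivation of ∑ b_k x_k D_k scales x_k D_o by b_k - b_o. Normalising b_o = 0 leaves
  -- b_k = c_k for k ≠ o.
  let b : Fin n → F := fun k => if k = o then 0 else c k
  set y : Module.End F (Alg F m n) := ∑ k, b k • tor F (Sum.inr k) with hy
  have hyL : y ∈ evenW F n p t :=
    sum_mem fun k _ => (evenW F n p t).smul_mem _ (tor_mem ht _)
  have hlie : ∀ E : Module.End F (Alg F m n), ⁅y, E⁆ = ∑ k, b k • ⁅tor F (Sum.inr k), E⁆ :=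
    fun E => lie_sum_smul_end _ _ E
  have hd' := hd.sub (isDer_ad hyL)
  have h0' : ∀ i, (d - LieAlgebra.ad F _ y) (D F (Sum.inl i)) = 0 := fun i => by
    rw [LinearMap.sub_apply, h0, LieAlgebra.ad_apply, hlie, zero_sub, neg_eq_zero]
    refine Finset.sum_eq_zero fun k _ => ?_
    rw [← lie_skew, lie_D_tor, if_neg (by simp), neg_zero, smul_zero]
  have hT' : ∀ r, (d - LieAlgebra.ad F _ y) (tor F r) = 0 := fun r => by
    rw [LinearMap.sub_apply, hT, LieAlgebra.ad_apply, hlie, zero_sub, neg_eq_zero]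
    exact Finset.sum_eq_zero fun k _ => by rw [lie_tor_tor, smul_zero]
  refine ⟨y, hyL, h0', hT', ?_⟩
  have hmem : ∀ k l : Fin n, op (Sum.inr l) (X F (Sum.inr k : Fin m ⊕ Fin n)) ∈ evenW F n p t :=
    fun k l => op_mem (gl_mem k l ht)
  have h1 : ∀ k, op (Sum.inr o) (X F (Sum.inr k)) ∈ hd'.ker := fun k => by
    by_cases hk : k = o
    · rw [hk]
      exact hd'.mem_ker.2 ⟨tor_mem ht _, hT' _⟩
    · refine hd'.mem_ker.2 ⟨hmem k o, ?_⟩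
      rw [LinearMap.sub_apply, hc k hk, LieAlgebra.ad_apply, hlie]
      simp only [lie_tor_gl, smul_smul]
      rw [← Finset.sum_smul, Finset.sum_eq_single k]
      · simp [hk, b]
      · intro q _ hq
        by_cases hqo : q = o
        · simp [hqo, b]
        · simp [hq, hqo]
      · simp
  have h2 : ∀ k, op (Sum.inr k) (X F (Sum.inr o)) ∈ hd'.ker := fun k => by
    by_cases hk : k = o
    · rw [hk]
      exact h1 o
    -- The bracket [x_k D_o, x_o D_k] = x_k D_k - x_o D_o lies in the torus, so it is killed, and it
    -- is nonzero; hence the scalar e on x_o D_k must vanish.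
    obtain ⟨e, he⟩ := hd'.exists_gl_smul hp ht h0' hT' (Ne.symm hk)
    refine hd'.mem_ker.2 ⟨hmem o k, ?_⟩
    have h3 := hd'.leib _ (hmem k o) _ (hmem o k)
    rw [lie_gl_gl_self, (hd'.mem_ker.1 (h1 k)).2, zero_lie, zero_add, he, lie_smul_end,
      lie_gl_gl_self, map_sub, hT', hT', sub_zero] at h3
    have h4 := congrArg (fun E => E (X F (Sum.inr k))) h3
    simp only [LinearMap.smul_apply, LinearMap.sub_apply, LinearMap.zero_apply, tor_X, if_true,
      Sum.inr.injEq, if_neg (Ne.symm hk), sub_zero] at h4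
    have hX : X F (Sum.inr k : Fin m ⊕ Fin n) ≠ 0 := fun h => by
      have := X_mul_X_ne_zero (F := F) (m := m) hk
      rw [h, zero_mul] at this
      exact this rfl
    rw [he, (smul_eq_zero.1 h4.symm).resolve_right hX, zero_smul]
  intro k l
  by_cases hkl : k = l
  · rw [hkl]
    exact hT' _
  · rw [← lie_gl_gl k o l hkl]
    exact (hd'.mem_ker.1 (hd'.ker.lie_mem (h1 k) (h2 l))).2

/-- Derivations killing the torus are normal up to an inner derivation. -/
theorem IsDer.exists_isNormal (hd : IsDer n p t d) (hp : 3 < p) (hm : 0 < m) (hn : 2 < n)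
    (ht : ∀ i, 0 < t i) (h0 : ∀ i, d (D F (Sum.inl i)) = 0) (hT : ∀ r, d (tor F r) = 0)
    (hG : ∀ k l, d (op (Sum.inr l) (X F (Sum.inr k))) = 0) :
    ∃ y ∈ evenW F n p t, IsNormal n p t (d - LieAlgebra.ad F _ y) := by
  let o : Fin n := ⟨0, by omega⟩
  let o' : Fin n := ⟨1, by omega⟩
  let i₀ : Fin m := ⟨0, hm⟩
  have hoo : o ≠ o' := by simp [o, o']
  obtain ⟨c, hc⟩ := hd.exists_quad_smul ht h0 hT hoo i₀
  -- The odd Euler field ∑ x_k D_k commutes with 𝔤𝔩(n) and scales each x_k x_l D_i with k ≠ l by 2.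
  -- This explains the factor c / 2 and why nothing normalised before is disturbed.
  set y : Module.End F (Alg F m n) := ∑ k, (c / 2) • tor F (Sum.inr k) with hy
  have hyL : y ∈ evenW F n p t :=
    sum_mem fun k _ => (evenW F n p t).smul_mem _ (tor_mem ht _)
  have hlie : ∀ E : Module.End F (Alg F m n), ⁅y, E⁆ = ∑ k, (c / 2) • ⁅tor F (Sum.inr k), E⁆ :=
    fun E => lie_sum_smul_end _ _ E
  have hd' := hd.sub (isDer_ad hyL)
  have h0' : ∀ i, (d - LieAlgebra.ad F _ y) (D F (Sum.inl i)) = 0 := fun i => by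
    rw [LinearMap.sub_apply, h0, LieAlgebra.ad_apply, hlie, zero_sub, neg_eq_zero]
    refine Finset.sum_eq_zero fun k _ => ?_
    rw [← lie_skew, lie_D_tor, if_neg (by simp), neg_zero, smul_zero]
  have hT' : ∀ r, (d - LieAlgebra.ad F _ y) (tor F r) = 0 := fun r => by
    rw [LinearMap.sub_apply, hT, LieAlgebra.ad_apply, hlie, zero_sub, neg_eq_zero]
    exact Finset.sum_eq_zero fun k _ => by rw [lie_tor_tor, smul_zero]
  have hG' : ∀ k l, (d - LieAlgebra.ad F _ y) (op (Sum.inr l) (X F (Sum.inr k))) = 0 :=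
    fun k l => by
      rw [LinearMap.sub_apply, hG, LieAlgebra.ad_apply, hlie, zero_sub, neg_eq_zero]
      simp only [lie_tor_gl, smul_smul]
      rw [← Finset.sum_smul, ← Finset.mul_sum, Finset.sum_sub_distrib]
      simp
  refine ⟨y, hyL, hd', h0', hT', hG', ?_⟩
  have hgl : ∀ k l, op (Sum.inr l) (X F (Sum.inr k)) ∈ hd'.ker := fun k l =>
    hd'.mem_ker.2 ⟨op_mem (gl_mem k l ht), hG' k l⟩
  have hmem : ∀ (k l : Fin n) (i : Fin m), op (Sum.inl i)
      (X F (Sum.inr k : Fin m ⊕ Fin n) * X F (Sum.inr l)) ∈ evenW F n p t :=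
    fun k l i => op_mem (r := Sum.inl i) (X_mul_X_mem_homog k l)
  have h1 : op (Sum.inl i₀) (X F (Sum.inr o) * X F (Sum.inr o')) ∈ hd'.ker := by
    refine hd'.mem_ker.2 ⟨hmem _ _ _, ?_⟩
    rw [LinearMap.sub_apply, hc, LieAlgebra.ad_apply, hlie]
    simp only [lie_tor_quad _ hoo, smul_smul]
    rw [← Finset.sum_smul, ← sub_smul, ← Finset.mul_sum]
    have : ∑ k : Fin n, ((if (Sum.inr k : Fin m ⊕ Fin n) = Sum.inr o ∨
        (Sum.inr k : Fin m ⊕ Fin n) = Sum.inr o' then 1 else 0) -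
        (if (Sum.inr k : Fin m ⊕ Fin n) = Sum.inl i₀ then 1 else 0) : F) = 2 := by
      simp only [Sum.inr.injEq, reduceCtorEq, if_false, sub_zero]
      rw [Finset.sum_ite, Finset.sum_const_zero, add_zero, Finset.sum_const,
        show Finset.univ.filter (fun k => k = o ∨ k = o') = {o, o'} by ext; simp,
        Finset.card_pair hoo]
      norm_num
    rw [this, div_mul_cancel₀ _ (two_ne_zero' hp), sub_self, zero_smul]
  -- Brackets with 𝔤𝔩(n) replace one index of the pair at a time; at the end x_(i₀) D_i changes the
  -- direction i₀ into i.
  have h2 : ∀ l, op (Sum.inl i₀) (X F (Sum.inr o) * X F (Sum.inr l)) ∈ hd'.ker := fun l => by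
    by_cases hl : l = o
    · rw [hl, X_inr_mul_self, map_zero]
      exact zero_mem _
    · have h3 := hd'.ker.lie_mem (hgl l o') (neg_mem h1)
      rw [← map_neg, ← X_inr_mul_comm, lie_gl_quad l o' o hoo.symm, X_inr_mul_comm,
        map_neg] at h3
      rw [← neg_neg (op (Sum.inl i₀) _)]
      exact neg_mem h3
  have h3 : ∀ k l, op (Sum.inl i₀) (X F (Sum.inr k) * X F (Sum.inr l)) ∈ hd'.ker := fun k l => by
    by_cases hl : l = o
    · have := neg_mem (h2 k)
      rwa [← map_neg, ← X_inr_mul_comm, ← hl] at this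
    · have := hd'.ker.lie_mem (hgl k o) (h2 l)
      rwa [lie_gl_quad k o l (Ne.symm hl)] at this
  intro k l i
  rw [← lie_quad_linear k l i₀ i]
  exact (hd'.mem_ker.1 (hd'.ker.lie_mem (h3 k l)
    (hd'.linear_mem_ker hp ht h0' hT' i₀ i))).2

end constants

/-! ### Normal derivations are determined on the vector fields `x^(α) D_i` -/

section normal

variable {F : Type*} [Field F] {m n p : ℕ} [Fact p.Prime] [CharP F p] {t : Fin m → ℕ}
variable {d : Module.End F (Alg F m n) →ₗ[F] Module.End F (Alg F m n)}

/-- Exponent 1 at some i with D_i ≠ D_s means weight 1 under x_i D_i. The predecessors of α control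
all derivatives of the field. -/
theorem IsNormal.op_mon_mem_ker (hN : IsNormal n p t d) (hp : 3 < p) (ht : ∀ i, 0 < t i)
    {s : Fin m ⊕ Fin n} {α : Fin m → ℕ} (hα : ∀ i, α i < p ^ t i) {ω : Ext F n}
    (hω : ω ∈ extPart F n (tau s)) {i : Fin m} (his : Sum.inl i ≠ s) (hi : α i = 1)
    (h : ∀ β j, α = β + Pi.single j 1 → op s (mon β ω) ∈ hN.isDer.ker) :
    op s (mon α ω) ∈ hN.isDer.ker := by
  refine hN.isDer.op_mem_ker hp ht hN.map_D (hN.map_tor (Sum.inl i)) (mon_mem_homog hα hω) his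
    (by rw [tor_inl_mon, hi, Nat.cast_one, one_smul]) fun j => ?_
  by_cases hj : α j = 0
  · rw [D_inl_mon_zero j hj, map_zero, map_zero]
  · obtain ⟨β, hβ⟩ := DividedPow.exists_add j α hj
    rw [hβ, D_inl_mon_add]
    exact (hN.isDer.mem_ker.1 (h β j hβ)).2

theorem eq_of_single_eq_add {i j : Fin m} {β : Fin m → ℕ}
    (h : (Pi.single i 1 : Fin m → ℕ) = β + Pi.single j 1) : β = 0 ∧ i = j := by
  have hij : i = j := by
    by_contra hij
    have := congrFun h j
    simp [Pi.single_eq_of_ne (Ne.symm hij)] at this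
  subst hij
  simpa using h

theorem single_lt (ht : ∀ i, 0 < t i) (i j : Fin m) : (Pi.single i 1 : Fin m → ℕ) j < p ^ t j := by
  have hp := (Fact.out : p.Prime).one_lt
  by_cases h : j = i
  · rw [h, Pi.single_eq_same]
    exact Nat.one_lt_pow (ht i).ne' hp
  · rw [Pi.single_eq_of_ne h]
    exact pow_pos (by omega) _

theorem IsNormal.op_mon_single_mem_ker (hN : IsNormal n p t d) (hp : 3 < p) (ht : ∀ i, 0 < t i)
    {s : Fin m ⊕ Fin n} {ω : Ext F n} (hω : ω ∈ extPart F n (tau s)) {i : Fin m}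
    (his : Sum.inl i ≠ s) (h : op s (mon 0 ω) ∈ hN.isDer.ker) :
    op s (mon (Pi.single i 1) ω) ∈ hN.isDer.ker := by
  refine hN.op_mon_mem_ker hp ht (single_lt ht i) hω his (Pi.single_eq_same i 1) fun β j hβ => ?_
  rw [(eq_of_single_eq_add hβ).1]
  exact h

theorem lie_op_mon_op_mon {r s : Fin m ⊕ Fin n} {α β : Fin m → ℕ} {ω η : Ext F n}
    (hω : ω ∈ extPart F n (tau r)) (hη : η ∈ extPart F n (tau s)) :
    ⁅op r (mon α ω), op s (mon β η)⁆ =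
      op s (mon α ω * D F r (mon β η)) - op r (mon β η * D F s (mon α ω)) :=
  lie_op_op (mon_mem_parityPart hω α) (mon_mem_parityPart hη β)

theorem D_inl_mon_single (i j : Fin m) (ω : Ext F n) :
    D F (Sum.inl i) (mon (Pi.single j 1) ω) = if i = j then mon 0 ω else 0 := by
  split_ifs with h
  · subst h
    have := D_inl_mon_add (F := F) i 0 ω
    rwa [zero_add] at this
  · exact D_inl_mon_zero i (Pi.single_eq_of_ne h 1) ω

theorem exists_fin_ne (hm : 2 < m) (i : Fin m) : ∃ j, j ≠ i := by
  by_cases h : i = ⟨0, by omega⟩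
  · exact ⟨⟨1, by omega⟩, by rw [h]; simp⟩
  · exact ⟨_, Ne.symm h⟩

/-- Induction on the length of ω, by [x_k x_l D_i, x_i ω D_j] = x_k x_l ω D_j with i ≠ j. The second
factor has weight 1 under x_i D_i, so it is killed once ω D_j is. -/
theorem IsNormal.even_mem_ker (hN : IsNormal n p t d) (hp : 3 < p) (hm : 2 < m)
    (ht : ∀ i, 0 < t i) {ω : Ext F n} (hω : ω ∈ extPart F n 0) (j : Fin m) :
    op (Sum.inl j) (mon 0 ω) ∈ hN.isDer.ker := by
  induction ω, hω using CliffordAlgebra.even_induction with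
  | algebraMap r =>
    change op (Sum.inl j) (mon 0 (algebraMap F (Ext F n) r)) ∈ _
    rw [Algebra.algebraMap_eq_smul_one, map_smul, map_smul, ← one_eq_mon, op_one]
    exact hN.isDer.ker.smul_mem r ⟨D_inl_mem j, hN.map_D j⟩
  | add x y hx hy ihx ihy => rw [map_add, map_add]; exact add_mem ihx ihy
  | ι_mul_ι_mul v w x hx ih =>
    change op (Sum.inl j) (mon 0 (ExteriorAlgebra.ι F v * ExteriorAlgebra.ι F w * x)) ∈ _
    rw [ι_eq_sum v, ι_eq_sum w]
    simp only [Finset.sum_mul, Finset.mul_sum, smul_mul_assoc, mul_smul_comm, map_sum, map_smul]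
    refine sum_mem fun k _ => hN.isDer.ker.smul_mem _ (sum_mem fun l _ =>
      hN.isDer.ker.smul_mem _ ?_)
    obtain ⟨i, hij⟩ := exists_fin_ne hm j
    have h1 : op (Sum.inl i) (mon 0 (gen F l * gen F k)) ∈ hN.isDer.ker := by
      have := hN.map_quad l k i
      rw [X_inr, X_inr, mon_zero_mul_mon] at this
      refine ⟨op_mem (r := Sum.inl i) ?_, this⟩
      have h := X_mul_X_mem_homog (F := F) (p := p) (t := t) l k
      rwa [X_inr, X_inr, mon_zero_mul_mon] at h
    have h2 := hN.op_mon_single_mem_ker hp ht (s := Sum.inl j) (i := i) hx (by simpa using hij) ih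
    have h3 := hN.isDer.ker.lie_mem h1 h2
    have hg := extPart_mul_mem (gen_mem (F := F) l) (gen_mem k)
    rw [CharTwo.add_self_eq_zero] at hg
    rw [lie_op_mon_op_mon (r := Sum.inl i) (s := Sum.inl j) hg hx, D_inl_mon_single, if_pos rfl,
      D_inl_mon_zero j rfl, mul_zero, map_zero, sub_zero, mon_zero_mul_mon] at h3
    exact h3

/-- The field x_i ω D_i has weight 0 under x_i D_i, so the weight argument in the direction i does
not apply. It is obtained as [ω D_j, x_i x_j D_i] with j ≠ i, where x_j has exponent 1. -/
theorem IsNormal.single_even_mem_ker (hN : IsNormal n p t d) (hp : 3 < p) (hm : 2 < m)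
    (ht : ∀ i, 0 < t i) {ω : Ext F n} (hω : ω ∈ extPart F n 0) (i : Fin m) :
    op (Sum.inl i) (mon (Pi.single i 1) ω) ∈ hN.isDer.ker := by
  obtain ⟨j, hji⟩ := exists_fin_ne hm i
  have h1 : op (Sum.inl i) (mon (Pi.single i 1 + Pi.single j 1) 1) ∈ hN.isDer.ker := by
    refine hN.op_mon_mem_ker hp ht (s := Sum.inl i) (i := j) (fun q => ?_) one_mem_extPart
      (by simpa using hji) (by simp [Pi.single_eq_of_ne hji]) fun β q hβ => ?_
    · rw [Pi.add_apply]
      by_cases hq : q = i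
      · rw [hq, Pi.single_eq_of_ne hji.symm]
        exact single_lt ht i i
      · rw [Pi.single_eq_of_ne hq, zero_add]
        exact single_lt ht j q
    · have hlin := fun q => hN.isDer.linear_mem_ker hp ht hN.map_D hN.map_tor q i
      by_cases hq : q = j
      · subst hq
        rw [← add_right_cancel hβ]
        exact hlin i
      · by_cases hq' : q = i
        · subst hq'
          rw [add_comm] at hβ
          rw [← add_right_cancel hβ]
          exact hlin j
        · have := congrFun hβ q
          simp [Pi.single_eq_of_ne hq, Pi.single_eq_of_ne hq'] at this
  have h2 := hN.isDer.ker.lie_mem (hN.even_mem_ker hp hm ht hω j) h1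
  rw [lie_op_mon_op_mon (r := Sum.inl j) (s := Sum.inl i) hω one_mem_extPart, D_inl_mon_add,
    D_inl_mon_zero i rfl, mul_zero, map_zero, sub_zero, mon_zero_mul_mon, mul_one] at h2
  exact h2

/-- For even a, [a D_i, x_i x_k D_l] = a x_k D_l - x_i x_k ∂_l(a) D_i, and `single_even_mem_ker`
disposes of the last term. -/
theorem IsNormal.odd_mem_ker (hN : IsNormal n p t d) (hp : 3 < p) (hm : 2 < m)
    (ht : ∀ i, 0 < t i) {ω : Ext F n} (hω : ω ∈ extPart F n 1) (l : Fin n) :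
    op (Sum.inr l) (mon 0 ω) ∈ hN.isDer.ker := by
  let i : Fin m := ⟨0, by omega⟩
  have h := odd_le_span hω
  clear hω
  induction h using Submodule.span_induction with
  | zero => rw [map_zero, map_zero]; exact zero_mem _
  | add x y _ _ hx hy => rw [map_add, map_add]; exact add_mem hx hy
  | smul c x _ hx => rw [map_smul, map_smul]; exact hN.isDer.ker.smul_mem c hx
  | mem x hx =>
    obtain ⟨a, ha, k, rfl⟩ := hx
    have h1 : op (Sum.inr l) (mon (Pi.single i 1) (gen F k)) ∈ hN.isDer.ker :=
      hN.op_mon_single_mem_ker hp ht (s := Sum.inr l) (gen_mem k) (by simp)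
        ⟨op_mem (gl_mem k l ht), hN.map_gl k l⟩
    have h2 := hN.isDer.ker.lie_mem (hN.even_mem_ker hp hm ht ha i) h1
    have hmem : gen F k * extD F l a ∈ extPart F n 0 := by
      have := extPart_mul_mem (gen_mem k) (extD_mem l ha)
      rwa [zero_add, CharTwo.add_self_eq_zero] at this
    have h3 := hN.single_even_mem_ker hp hm ht hmem i
    rw [lie_op_mon_op_mon (r := Sum.inl i) (s := Sum.inr l) ha (gen_mem k), D_inl_mon_single,
      if_pos rfl, D_inr_mon, mon_zero_mul_mon, mon_mul_mon_zero] at h2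
    have h4 := add_mem h2 h3
    rwa [sub_add_cancel] at h4

/-- A normal derivation that kills all `x^(α) D_i` vanishes. -/
theorem IsNormal.eq_zero (hN : IsNormal n p t d) (hp : 3 < p) (hm : 2 < m) (ht : ∀ i, 0 < t i)
    (h : ∀ α : Fin m → ℕ, (∀ i, α i < p ^ t i) → ∀ i, op (Sum.inl i) (mon α 1) ∈ hN.isDer.ker)
    {E : Module.End F (Alg F m n)} (hE : E ∈ evenW F n p t) : d E = 0 := by
  have hodd : ∀ α : Fin m → ℕ, (∀ i, α i < p ^ t i) → ∀ ω ∈ extPart F n 1, ∀ l,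
      op (Sum.inr l) (mon α ω) ∈ hN.isDer.ker := fun α hα ω hω l => by
    let q : Fin m := ⟨0, by omega⟩
    have h1 := hN.op_mon_single_mem_ker hp ht (s := Sum.inr l) (i := q) hω (by simp)
      (hN.odd_mem_ker hp hm ht hω l)
    -- [x^(α) D_q, x_q ω D_l] = x^(α) ω D_l, whatever the exponent of x_q in x^(α).
    have h2 := hN.isDer.ker.lie_mem (h α hα q) h1
    rwa [lie_op_mon_op_mon (r := Sum.inl q) (s := Sum.inr l) one_mem_extPart hω, D_inl_mon_single,
      if_pos rfl, D_inr_mon, extD_one, map_zero, mul_zero, map_zero, sub_zero, mon_mul_mon_zero,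
      one_mul] at h2
  have heven : ∀ α : Fin m → ℕ, (∀ i, α i < p ^ t i) → ∀ ω ∈ extPart F n 0, ∀ i,
      op (Sum.inl i) (mon α ω) ∈ hN.isDer.ker := fun α hα ω hω i => by
    have hω' := even_le_span hω
    clear hω
    induction hω' using Submodule.span_induction with
    | zero => rw [map_zero, map_zero]; exact zero_mem _
    | add x y _ _ hx hy => rw [map_add, map_add]; exact add_mem hx hy
    | smul c x _ hx => rw [map_smul, map_smul]; exact hN.isDer.ker.smul_mem c hx
    | mem x hx =>
      rcases hx with rfl | ⟨b, hb, k, rfl⟩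
      · exact h α hα i
      · have hgb := extPart_mul_mem (gen_mem (F := F) k) hb
        rw [CharTwo.add_self_eq_zero] at hgb
        -- The bracket of x^(α) x_k D_k with x_k b D_i is x^(α) x_k b D_i minus a field along D_k
        -- with odd coefficient, which is already known to be killed.
        have h1 := hN.isDer.ker.lie_mem (hodd α hα _ (gen_mem k) k)
          (hN.even_mem_ker hp hm ht hgb i)
        rw [lie_op_mon_op_mon (r := Sum.inr k) (s := Sum.inl i) (gen_mem k) hgb, D_inr_mon,
          mon_mul_mon_zero, extD_gen_mul_self, mul_sub, ← mul_assoc (gen F k) (gen F k),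
          gen_mul_self, zero_mul, sub_zero] at h1
        have h2 : op (Sum.inr k) (mon 0 (gen F k * b) * D F (Sum.inl i) (mon α (gen F k))) ∈
            hN.isDer.ker := by
          by_cases hi : α i = 0
          · rw [D_inl_mon_zero i hi, mul_zero, map_zero]
            exact zero_mem _
          · rw [D_inl_mon, if_neg hi, mon_zero_mul_mon]
            have := extPart_mul_mem hgb (gen_mem k)
            rw [zero_add] at this
            exact hodd _ (fun j => (Nat.sub_le _ _).trans_lt (hα j)) _ this k
        have h3 := add_mem h1 h2
        rwa [sub_add_cancel] at h3
  rw [eq_sum_op hE, map_sum]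
  refine Finset.sum_eq_zero fun r _ => ?_
  have hr := apply_X_mem hE r
  rw [eq_sum_mon hr.1, map_sum, map_sum]
  refine Finset.sum_eq_zero fun α hα => ?_
  have hco := co_mem hr.2 α
  cases r with
  | inl i => exact (hN.isDer.mem_ker.1 (heven α (mem_box.1 hα) _ hco i)).2
  | inr k => exact (hN.isDer.mem_ker.1 (hodd α (mem_box.1 hα) _ hco k)).2

end normal

/-! ### Normal derivations on the vector fields `x^(α) D_i` -/

section polynomial

variable {F : Type*} [Field F] {m n p : ℕ} [Fact p.Prime] [CharP F p] {t : Fin m → ℕ}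
variable {d : Module.End F (Alg F m n) →ₗ[F] Module.End F (Alg F m n)}

theorem binom_single_of_eq_zero {q : Fin m} (a : ℕ) {α : Fin m → ℕ} (h : α q = 0) :
    DividedPow.binom (Pi.single q a) α = 1 := by
  refine Finset.prod_eq_one fun i _ => ?_
  by_cases hi : i = q
  · rw [hi, h, Pi.single_eq_same, add_zero, Nat.choose_self]
  · rw [Pi.single_eq_of_ne hi, Nat.choose_zero_right]

theorem binom_single_single (q : Fin m) (a b : ℕ) :
    DividedPow.binom (Pi.single q a) (Pi.single q b) = (a + b).choose a := by
  rw [DividedPow.binom_split q, Finset.prod_eq_one, Pi.single_eq_same, Pi.single_eq_same, mul_one]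
  intro i hi
  rw [Pi.single_eq_of_ne (Finset.ne_of_mem_erase hi), Nat.choose_zero_right]

theorem single_lt_of_lt {q : Fin m} {a : ℕ} (ha : a < p ^ t q) (i : Fin m) :
    (Pi.single q a : Fin m → ℕ) i < p ^ t i := by
  by_cases h : i = q
  · subst h
    rwa [Pi.single_eq_same]
  · rw [Pi.single_eq_of_ne h]
    exact pow_pos (Fact.out : p.Prime).pos _

theorem sum_single_eq (q : Fin m) (a : ℕ) : ∑ i, (Pi.single q a : Fin m → ℕ) i = a := by
  simp [Pi.single_apply]

/-- Vector fields `x^(α) D_i` with `α` of smaller total degree are killed. -/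
def KilledBelow (hN : IsNormal n p t d) (N : ℕ) : Prop :=
  ∀ α : Fin m → ℕ, (∀ i, α i < p ^ t i) → ∑ i, α i < N → ∀ i,
    op (Sum.inl i) (mon α 1) ∈ hN.isDer.ker

/-- Exponents in which some `x_q`, `q ≠ i`, occurs together with another variable. -/
theorem IsNormal.mixed_mem_ker (hN : IsNormal n p t d) {α : Fin m → ℕ}
    (hα : ∀ i, α i < p ^ t i) (ih : KilledBelow hN (∑ i, α i)) {i q : Fin m} (hqi : q ≠ i)
    (hq : 2 ≤ α q) (hne : ∃ j, j ≠ q ∧ α j ≠ 0) : op (Sum.inl i) (mon α 1) ∈ hN.isDer.ker := by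
  obtain ⟨j, hjq, hj⟩ := hne
  set α' : Fin m → ℕ := Function.update α q 0 with hα'
  have h1 : α = Pi.single q (α q) + α' := by
    funext l
    by_cases hl : l = q
    · subst hl; simp [hα']
    · simp [hα', hl]
  have h2 : ∑ l, α l = α q + ∑ l, α' l := by
    conv_lhs => rw [h1]
    simp only [Pi.add_apply, Finset.sum_add_distrib, sum_single_eq]
  have h3 : 0 < ∑ l, α' l :=
    (by simp [hα', hjq]; omega : 0 < α' j).trans_le
      (Finset.single_le_sum (fun l _ => Nat.zero_le _) (Finset.mem_univ j))
  -- With a = α_q and α' the rest of α, [x_q^(a) D_q, x^(α') x_q D_i] = x^(α) D_i with binomial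
  -- coefficient 1. Both factors have smaller degree: the first because α' ≠ 0, the second because a
  -- ≥ 2.
  have e1 := ih (Pi.single q (α q)) (single_lt_of_lt (hα q)) (by rw [sum_single_eq]; omega) q
  have e2 := ih (α' + Pi.single q 1) (fun l => by
    by_cases hl : l = q
    · subst hl
      simp only [Pi.add_apply, hα', Function.update_self, Pi.single_eq_same]
      have := hα l
      omega
    · simp only [Pi.add_apply, hα', Function.update_of_ne hl, Pi.single_eq_of_ne hl, add_zero]
      exact hα l) (by
    simp only [Pi.add_apply, Finset.sum_add_distrib, sum_single_eq]
    omega) i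
  have e3 := hN.isDer.ker.lie_mem e1 e2
  rw [lie_op_mon_op_mon (r := Sum.inl q) (s := Sum.inl i) one_mem_extPart one_mem_extPart,
    D_inl_mon_add, D_inl_mon_zero i (Pi.single_eq_of_ne hqi.symm _), mul_zero, map_zero, sub_zero,
    mon_mul_mon, binom_single_of_eq_zero _ (by simp [hα']), ← h1, Nat.cast_one, one_smul,
    one_mul] at e3
  exact e3

theorem lie_tor_mon (r : Fin m ⊕ Fin n) (i : Fin m) (α : Fin m → ℕ) :
    ⁅tor F r, op (Sum.inl i) (mon α (1 : Ext F n))⁆ =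
      (Sum.elim (fun j => (α j : F)) 0 r - if r = Sum.inl i then 1 else 0) •
        op (Sum.inl i) (mon α 1) := by
  rw [lie_tor_op r (s := Sum.inl i) (mon_mem_parityPart one_mem_extPart α), sub_smul]
  congr 1
  · cases r with
    | inl j => rw [tor_inl_mon, map_smul]; rfl
    | inr k => rw [tor_apply, D_inr_mon, extD_one]; simp
  · split_ifs <;> simp

theorem IsNormal.tor_apply_mon (hN : IsNormal n p t d) (ht : ∀ i, 0 < t i) {α : Fin m → ℕ}
    (hα : ∀ i, α i < p ^ t i) (i : Fin m) (r s : Fin m ⊕ Fin n) :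
    tor F r (d (op (Sum.inl i) (mon α 1)) (X F s)) =
      (Sum.elim (fun j => (α j : F)) 0 r - (if r = Sum.inl i then 1 else 0) +
        if r = s then 1 else 0) • d (op (Sum.inl i) (mon α 1)) (X F s) :=
  hN.isDer.tor_apply_X ht (hN.map_tor r)
    (op_mem (r := Sum.inl i) (mon_mem_homog hα one_mem_extPart)) (lie_tor_mon r i α) s

theorem IsNormal.apply_mon_mem_constW (hN : IsNormal n p t d) {α : Fin m → ℕ}
    (hα : ∀ i, α i < p ^ t i) (ih : KilledBelow hN (∑ i, α i)) (i : Fin m) :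
    d (op (Sum.inl i) (mon α 1)) ∈ constW F n p t := by
  refine hN.isDer.op_mem_constW hN.map_D (s := Sum.inl i) (mon_mem_homog hα one_mem_extPart)
    fun j => ?_
  by_cases hj : α j = 0
  · rw [D_inl_mon_zero j hj, map_zero, map_zero]
  · obtain ⟨β, rfl⟩ := DividedPow.exists_add j α hj
    rw [D_inl_mon_add]
    refine (ih β (fun l => (Nat.le_add_right _ _).trans_lt (hα l)) ?_ i).2
    simp only [Pi.add_apply, Finset.sum_add_distrib, sum_single_eq]
    omega

theorem IsNormal.weight_mon (hN : IsNormal n p t d) (ht : ∀ i, 0 < t i) {α : Fin m → ℕ}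
    (hα : ∀ i, α i < p ^ t i) (ih : KilledBelow hN (∑ i, α i)) (i j : Fin m)
    (s : Fin m ⊕ Fin n) :
    ((α j : F) - (if j = i then 1 else 0) + if Sum.inl j = s then 1 else 0) •
      d (op (Sum.inl i) (mon α 1)) (X F s) = 0 := by
  have h := hN.tor_apply_mon ht hα i (Sum.inl j) s
  rw [tor_inl_apply_X_of_mem_constW (hN.apply_mon_mem_constW hα ih i)] at h
  simpa using h.symm

theorem IsNormal.mem_ker_of_apply_eq_zero (hN : IsNormal n p t d) {α : Fin m → ℕ}
    (hα : ∀ i, α i < p ^ t i) (i : Fin m)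
    (h : d (op (Sum.inl i) (mon α 1)) = 0) : op (Sum.inl i) (mon α 1) ∈ hN.isDer.ker :=
  ⟨op_mem (r := Sum.inl i) (mon_mem_homog hα one_mem_extPart), h⟩

/-- Pure powers `x_q^(a) D_i` with `a` prime to `p`. -/
theorem IsNormal.power_mem_ker_of_ne_zero (hN : IsNormal n p t d) (hp : 3 < p) (hm : 2 < m)
    (hn : 2 < n) (ht : ∀ i, 0 < t i) {q : Fin m} {a : ℕ} (ha : a < p ^ t q)
    (ih : KilledBelow hN a) (ha0 : (a : F) ≠ 0) (i : Fin m) :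
    op (Sum.inl i) (mon (Pi.single q a) 1) ∈ hN.isDer.ker := by
  have hα := single_lt_of_lt (t := t) ha
  have ih' : KilledBelow hN (∑ i, (Pi.single q a : Fin m → ℕ) i) := by rwa [sum_single_eq]
  have hw := fun j s => hN.weight_mon ht hα ih' i j s
  have hc := hN.apply_mon_mem_constW hα ih' i
  refine hN.mem_ker_of_apply_eq_zero hα i ?_
  have hext : (∀ s, d (op (Sum.inl i) (mon (Pi.single q a) 1)) (X F s) = 0) →
      d (op (Sum.inl i) (mon (Pi.single q a) 1)) = 0 := fun h =>
    eq_of_apply_X (mem_constW.1 hc).1 (zero_mem (evenW F n p t)) h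
  by_cases hqi : q = i
  · subst hqi
    by_cases ha1 : (a : F) = 1
    -- If a = 1 in F the value has torus weight zero, so it commutes with the torus. It is tested on
    -- x_k x_l D_j with j ≠ q, which commutes with x_q^(a) D_q and is killed by d.
    · refine eq_zero_of_lie_tor hp hn hc (fun r => ?_) fun k l hkl => ?_
      · refine eq_of_apply_X ((evenW F n p t).lie_mem (tor_mem ht r) (mem_constW.1 hc).1)
          (zero_mem (evenW F n p t)) fun s => ?_
        rw [lie_tor_apply_X, hN.tor_apply_mon ht hα, LinearMap.zero_apply, add_smul,
          sub_eq_zero, add_eq_right.2]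
        · split_ifs <;> simp
        · refine smul_eq_zero.2 (Or.inl ?_)
          cases r with
          | inl j =>
            by_cases hj : j = q
            · subst hj; simp [ha1]
            · simp [hj]
          | inr k => simp
      · obtain ⟨j, hj⟩ := exists_fin_ne hm q
        have hmem := X_mul_X_mem_homog (F := F) (p := p) (t := t) k l
        have h1 := hN.isDer.leib _ (op_mem (r := Sum.inl q) (mon_mem_homog hα one_mem_extPart)) _
          (op_mem (r := Sum.inl j) hmem)
        rw [lie_op_op (r := Sum.inl q) (s := Sum.inl j)
          (mon_mem_parityPart one_mem_extPart _) hmem.2, D_inl_X_mul_X,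
          D_inl_mon_zero j (Pi.single_eq_of_ne hj _), mul_zero, mul_zero, map_zero, map_zero,
          sub_zero, map_zero, hN.map_quad, lie_zero, add_zero] at h1
        have h2 := congrArg (fun E => E (X F (Sum.inl j))) h1
        simp only [lie_op_apply_X, if_true, LinearMap.zero_apply] at h2
        rwa [D_apply_X_of_mem_constW hc, mul_zero, sub_zero, eq_comm] at h2
    · refine hext fun s => ?_
      have h1 := hw q s
      rw [Pi.single_eq_same, if_pos rfl] at h1
      refine (smul_eq_zero.1 h1).resolve_left ?_
      split_ifs
      · simpa using ha0
      · simpa [sub_eq_zero] using ha1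
  · refine hext fun s => ?_
    -- For q ≠ i the component along D_q has weight -1 under x_i D_i, and every other component has
    -- weight a ≠ 0 under x_q D_q.
    by_cases hs : Sum.inl q = s
    · have h1 := hw i s
      rw [Pi.single_eq_of_ne (Ne.symm hqi), if_pos rfl, ← hs,
        if_neg (by simpa using Ne.symm hqi)] at h1
      rw [← hs]
      simpa using h1
    · have h1 := hw q s
      rw [Pi.single_eq_same, if_neg hqi, if_neg hs, sub_zero, add_zero] at h1
      exact (smul_eq_zero.1 h1).resolve_left ha0

/-- Pure powers `x_q^(a) D_i` with `p ∣ a` are mapped to multiples of `D_i`. -/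
theorem IsNormal.power_smul_of_eq_zero (hN : IsNormal n p t d)
    (ht : ∀ i, 0 < t i) {q : Fin m} {a : ℕ} (ha : a < p ^ t q)
    (ih : KilledBelow hN a) (ha0 : (a : F) = 0) (i : Fin m) :
    ∃ c : F, d (op (Sum.inl i) (mon (Pi.single q a) 1)) = c • D F (Sum.inl i) := by
  have hα := single_lt_of_lt (t := t) ha
  have ih' : KilledBelow hN (∑ i, (Pi.single q a : Fin m → ℕ) i) := by rwa [sum_single_eq]
  have hc := hN.apply_mon_mem_constW hα ih' i
  have h0 : ∀ s, Sum.inl i ≠ s → d (op (Sum.inl i) (mon (Pi.single q a) 1)) (X F s) = 0 :=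
    fun s hs => by
      -- The exponent of x_i is zero in F in either case, so components other than the one along D_i
      -- have weight -1 and vanish.
      have h1 := hN.weight_mon ht hα ih' i i s
      rw [if_pos rfl, if_neg hs] at h1
      by_cases hq : i = q
      · subst hq
        rw [Pi.single_eq_same, ha0] at h1
        simpa using h1
      · rw [Pi.single_eq_of_ne hq] at h1
        simpa using h1
  obtain ⟨c, hcX⟩ := eq_smul_one (a := d (op (Sum.inl i) (mon (Pi.single q a) 1)) (X F (Sum.inl i)))
    (Fact.out : p.Prime).pos (apply_X_mem (mem_constW.1 hc).1 (Sum.inl i)).1 fun r => by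
      cases r with
      | inl j => exact D_apply_X_of_mem_constW hc j _
      | inr k =>
        have h1 := congrArg (D F (Sum.inr k)) (hN.tor_apply_mon ht hα i (Sum.inr k) (Sum.inl i))
        rw [tor_apply, D_inr_X_mul _ _ rfl, D_inr_D_self] at h1
        simpa using h1
  refine ⟨c, eq_of_apply_X (mem_constW.1 hc).1 ((evenW F n p t).smul_mem c (D_inl_mem i))
    fun s => ?_⟩
  rw [LinearMap.smul_apply, D_X]
  split_ifs with hs
  · rw [← hs, hcX]
  · rw [h0 s hs, smul_zero]

/-- Off the diagonal, only powers `x_q^(p^r)` can contribute. -/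
theorem IsNormal.power_mem_ker_of_not_prime_power (hN : IsNormal n p t d)
    {q : Fin m} {a : ℕ} (ha : a < p ^ t q)
    (ih : KilledBelow hN a) (ha0 : (a : F) = 0) (hpos : 0 < a) (hpow : ∀ r, a ≠ p ^ r)
    {i : Fin m} (hqi : q ≠ i) : op (Sum.inl i) (mon (Pi.single q a) 1) ∈ hN.isDer.ker := by
  -- If p divided all the binomial coefficients of a choose b with 0 < b < a, then a would be a
  -- power of p. For a b where it does not, [x_q^(b) D_q, x_q^(a-b+1) D_i] is a nonzero multiple of
  -- x_q^(a) D_i.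
  obtain ⟨b, hb, hb'⟩ : ∃ b ∈ Finset.Icc 1 (a - 1), ¬ a.choose b ≡ 0 [MOD p] := by
    by_contra! h
    exact hpow _ (Choose.eq_pow_multiplicity_of_choose_modEq_zero_nat hpos h)
  rw [Finset.mem_Icc] at hb
  have hch : (a.choose b : F) ≠ 0 := fun h =>
    hb' (Nat.modEq_zero_iff_dvd.2 ((CharP.cast_eq_zero_iff F p _).1 h))
  -- For b = 1 the second factor would have degree a itself, outside the induction hypothesis.
  have hb1 : b ≠ 1 := by
    rintro rfl
    rw [Nat.choose_one_right] at hch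
    exact hch ha0
  have e1 := ih (Pi.single q b) (single_lt_of_lt (by omega)) (by rw [sum_single_eq]; omega) q
  have e2 := ih (Pi.single q (a - b) + Pi.single q 1) (by
    rw [← Pi.single_add]
    exact single_lt_of_lt (by omega)) (by
    rw [← Pi.single_add, sum_single_eq]
    omega) i
  have e3 := hN.isDer.ker.lie_mem e1 e2
  rw [lie_op_mon_op_mon (r := Sum.inl q) (s := Sum.inl i) one_mem_extPart one_mem_extPart,
    D_inl_mon_add, D_inl_mon_zero i (Pi.single_eq_of_ne hqi.symm _), mul_zero, map_zero, sub_zero,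
    mon_mul_mon, binom_single_single, ← Pi.single_add, show b + (a - b) = a by omega, one_mul,
    map_smul] at e3
  have e4 := hN.isDer.ker.smul_mem ((a.choose b : F)⁻¹) e3
  rwa [smul_smul, inv_mul_cancel₀ hch, one_smul] at e4

/-- Links the off-diagonal power x_q^(a) D_i with the diagonal one x_q^(a) D_q, up to a mixed
monomial that is handled separately. -/
theorem lie_power_linear {q i : Fin m} (hqi : q ≠ i) {a : ℕ} (ha : 0 < a) :
    ⁅op (Sum.inl i) (mon (Pi.single q a) (1 : Ext F n)),
      op (Sum.inl q) (mon (Pi.single i 1) (1 : Ext F n))⁆ =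
      op (Sum.inl q) (mon (Pi.single q a) 1) -
        op (Sum.inl i) (mon (Pi.single i 1 + Pi.single q (a - 1)) 1) := by
  have h1 : D F (Sum.inl q) (mon (Pi.single q a) (1 : Ext F n)) = mon (Pi.single q (a - 1)) 1 := by
    obtain ⟨b, rfl⟩ : ∃ b, a = b + 1 := ⟨a - 1, by omega⟩
    rw [Pi.single_add, D_inl_mon_add, Nat.add_sub_cancel]
  rw [lie_op_mon_op_mon (r := Sum.inl i) (s := Sum.inl q) one_mem_extPart one_mem_extPart,
    D_inl_mon_single, if_pos rfl, mon_mul_mon_zero, mul_one, h1, mon_mul_mon,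
    binom_single_of_eq_zero _ (Pi.single_eq_of_ne hqi.symm _), Nat.cast_one, one_smul, mul_one]

/-- A normal derivation whose values on the `x_j^(p^r) D_j` have no component along `D_j` kills
all `x^(α) D_i`. -/
theorem IsNormal.mon_mem_ker (hN : IsNormal n p t d) (hp : 3 < p) (hm : 2 < m)
    (hn : 2 < n) (ht : ∀ i, 0 < t i)
    (hpow : ∀ j r (c : F), 1 ≤ r → r < t j →
      d (op (Sum.inl j) (mon (Pi.single j (p ^ r)) 1)) = c • D F (Sum.inl j) → c = 0)
    {α : Fin m → ℕ} (hα : ∀ i, α i < p ^ t i) (i : Fin m) :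
    op (Sum.inl i) (mon α 1) ∈ hN.isDer.ker := by
  suffices H : ∀ N, KilledBelow hN N from H (∑ i, α i + 1) α hα (Nat.lt_succ_self _) i
  clear hα i α
  intro N
  induction N with
  | zero => exact fun α _ h => absurd h (Nat.not_lt_zero _)
  | succ N ihN =>
    intro α hα hs i
    rcases Nat.lt_or_eq_of_le (Nat.lt_succ_iff.1 hs) with hs | hs
    · exact ihN α hα hs i
    have ih : KilledBelow hN (∑ i, α i) := by rwa [hs]
    by_cases h1 : ∃ q, q ≠ i ∧ α q = 1
    · obtain ⟨q, hqi, hq⟩ := h1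
      refine hN.op_mon_mem_ker hp ht (s := Sum.inl i) hα one_mem_extPart (by simpa using hqi) hq
        fun β j hβ => ih β (fun l => ?_) ?_ i
      · exact (by rw [hβ]; exact Nat.le_add_right _ _ : β l ≤ α l).trans_lt (hα l)
      · rw [hβ]
        simp only [Pi.add_apply, Finset.sum_add_distrib, sum_single_eq]
        omega
    push Not at h1
    by_cases h2 : ∃ q, q ≠ i ∧ 2 ≤ α q ∧ ∃ j, j ≠ q ∧ α j ≠ 0
    · obtain ⟨q, hqi, hq, hj⟩ := h2
      exact hN.mixed_mem_ker hα ih hqi hq hj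
    push Not at h2
    -- A variable other than x_i now has exponent at least 2 if it occurs, and then occurs alone; so
    -- α is a pure power.
    obtain ⟨q, a, rfl⟩ : ∃ q a, α = Pi.single q a := by
      by_cases h3 : ∃ q, q ≠ i ∧ α q ≠ 0
      · obtain ⟨q, hqi, hq⟩ := h3
        refine ⟨q, α q, funext fun l => ?_⟩
        by_cases hl : l = q
        · rw [hl, Pi.single_eq_same]
        · rw [Pi.single_eq_of_ne hl]
          have := h1 q hqi
          exact h2 q hqi (by omega) l hl
      · push Not at h3
        refine ⟨i, α i, funext fun l => ?_⟩
        by_cases hl : l = i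
        · rw [hl, Pi.single_eq_same]
        · rw [Pi.single_eq_of_ne hl, h3 l hl]
    clear h1 h2
    rw [sum_single_eq] at ih
    have ha : a < p ^ t q := by simpa using hα q
    by_cases ha0 : (a : F) = 0
    swap
    · exact hN.power_mem_ker_of_ne_zero hp hm hn ht ha ih ha0 i
    rcases Nat.eq_zero_or_pos a with rfl | hpos
    · rw [Pi.single_zero, ← one_eq_mon, op_one]
      exact ⟨D_inl_mem i, hN.map_D i⟩
    -- This guarantees a - 1 ≥ 2, as required for the mixed monomials x_j x_q^(a-1).
    have hpa : p ≤ a := Nat.le_of_dvd hpos ((CharP.cast_eq_zero_iff F p a).1 ha0)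
    have hmix : ∀ j, q ≠ j →
        op (Sum.inl j) (mon (Pi.single j 1 + Pi.single q (a - 1)) 1) ∈ hN.isDer.ker := fun j hj => by
      refine hN.mixed_mem_ker (fun l => ?_) ?_ hj ?_ ⟨j, hj.symm, ?_⟩
      · by_cases hl : l = q
        · subst hl
          simp only [Pi.add_apply, Pi.single_eq_of_ne hj, Pi.single_eq_same]
          omega
        · simp only [Pi.add_apply, Pi.single_eq_of_ne hl, add_zero]
          exact single_lt ht j l
      · simp only [Pi.add_apply, Finset.sum_add_distrib, sum_single_eq]
        rwa [show 1 + (a - 1) = a by omega]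
      · simp only [Pi.add_apply, Pi.single_eq_of_ne hj, Pi.single_eq_same]
        omega
      · simp
    have hlin : ∀ j, op (Sum.inl q) (mon (Pi.single j 1) 1) ∈ hN.isDer.ker := fun j =>
      hN.isDer.linear_mem_ker hp ht hN.map_D hN.map_tor j q
    have hoff : ∀ j, q ≠ j → op (Sum.inl j) (mon (Pi.single q a) 1) ∈ hN.isDer.ker := fun j hj => by
      by_cases hr : ∃ r, a = p ^ r
      -- If d sends x_q^(p^r) D_j to c D_j, then bracketing with x_j D_q shows that it sends
      -- x_q^(p^r) D_q to c D_q, and the hypothesis on the diagonal powers gives c = 0.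
      · obtain ⟨r, rfl⟩ := hr
        obtain ⟨c, hc⟩ := hN.power_smul_of_eq_zero ht ha ih ha0 j
        have hr1 : 1 ≤ r := by
          by_contra h
          rw [show r = 0 by omega, pow_zero] at hpa
          omega
        have hr2 : r < t q := (Nat.pow_lt_pow_iff_right (Fact.out : p.Prime).one_lt).1 ha
        have h1 := hN.isDer.leib _
          (op_mem (r := Sum.inl j) (mon_mem_homog (single_lt_of_lt ha) one_mem_extPart)) _
          (hlin j).1
        rw [lie_power_linear hj hpos, map_sub, (hN.isDer.mem_ker.1 (hmix j hj)).2,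
          (hN.isDer.mem_ker.1 (hlin j)).2, lie_zero, add_zero, sub_zero, hc, smul_lie,
          lie_D_op (s := Sum.inl q) j (mon_mem_parityPart one_mem_extPart _), D_inl_mon_single,
          if_pos rfl, ← one_eq_mon, op_one] at h1
        have hc0 := hpow q r c hr1 hr2 h1
        rw [hc0, zero_smul] at hc
        exact hN.mem_ker_of_apply_eq_zero (single_lt_of_lt ha) j hc
      · push Not at hr
        exact hN.power_mem_ker_of_not_prime_power ha ih ha0 hpos hr hj
    by_cases hqi : q = i
    · subst hqi
      obtain ⟨j, hj⟩ := exists_fin_ne hm q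
      have h1 := hN.isDer.ker.lie_mem (hoff j hj.symm) (hlin j)
      rw [lie_power_linear hj.symm hpos] at h1
      have h2 := add_mem h1 (hmix j hj.symm)
      rwa [sub_add_cancel] at h2
    · exact hoff i hqi

end polynomial

/-! ### Powers of the `D_i`, and derivations killing the `D_i` -/

section powers

/-- ad a is the difference of left and right multiplication by a. These commute, so the Frobenius
identity for p^r-th powers applies. -/
theorem ad_pow_char_pow {F A : Type*} [Field F] [Ring A] [Nontrivial A] [Algebra F A] (p : ℕ)
    [Fact p.Prime] [CharP F p] (a : A) (r : ℕ) :
    LieAlgebra.ad F A a ^ p ^ r = LieAlgebra.ad F A (a ^ p ^ r) := by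
  have : CharP (Module.End F A) p :=
    charP_of_injective_algebraMap (algebraMap F (Module.End F A)).injective p
  have h : ∀ a : A, LieAlgebra.ad F A a = LinearMap.mulLeft F a - LinearMap.mulRight F a :=
    fun a => by
      ext b
      rfl
  rw [h, h, sub_pow_char_pow_of_commute p r (LinearMap.commute_mulLeft_right a a),
    LinearMap.pow_mulLeft, LinearMap.pow_mulRight]

/-- If `(ad e) ^ p ^ r = 0` then `(ad e) ^ (p ^ r - 1)` maps `δ e` into the center. -/
theorem lie_ad_pow_derivation_eq_zero {F L : Type*} [Field F] [LieRing L] [LieAlgebra F L]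
    [Nontrivial L] (p : ℕ) [Fact p.Prime] [CharP F p] (δ : LieDerivation F L L) (e : L) (r : ℕ)
    (hnil : LieAlgebra.ad F L e ^ p ^ r = 0) (y : L) :
    ⁅(LieAlgebra.ad F L e ^ (p ^ r - 1)) (δ e), y⁆ = 0 := by
  have hbr : LieAlgebra.ad F (Module.End F L) (LieAlgebra.ad F L e) (δ : L →ₗ[F] L) =
      -LieAlgebra.ad F L (δ e) := by
    refine LinearMap.ext fun y => ?_
    change ⁅e, δ y⁆ - δ ⁅e, y⁆ = -⁅δ e, y⁆
    rw [LieDerivation.apply_lie_eq_add]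
    abel
  have hadk : ∀ k (z : L), (LieAlgebra.ad F (Module.End F L) (LieAlgebra.ad F L e) ^ k)
      (LieAlgebra.ad F L z) = LieAlgebra.ad F L ((LieAlgebra.ad F L e ^ k) z) := fun k z => by
    induction k with
    | zero => rfl
    | succ k ih =>
      rw [pow_succ', Module.End.mul_apply, ih, pow_succ', Module.End.mul_apply,
        LieAlgebra.ad_apply, LieAlgebra.ad_apply, LieHom.map_lie]
  have hpos : 0 < p ^ r := pow_pos (Fact.out : p.Prime).pos _
  have h1 := congrArg (fun f => f (δ : L →ₗ[F] L))
    (ad_pow_char_pow (F := F) p (LieAlgebra.ad F L e) r)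
  simp only [hnil, map_zero, LinearMap.zero_apply] at h1
  -- One factor is split off from the p^r-th power of ad (ad e): it turns δ into -ad (δ e), and the
  -- other factors move inside ad.
  rw [← Nat.sub_add_cancel (Nat.one_le_of_lt hpos), pow_succ, Module.End.mul_apply, hbr, map_neg,
    hadk, neg_eq_zero] at h1
  exact LinearMap.congr_fun h1 y

variable {F : Type*} [Field F] {m n p : ℕ} [Fact p.Prime] [CharP F p] {t : Fin m → ℕ}
variable {d : Module.End F (Alg F m n) →ₗ[F] Module.End F (Alg F m n)}

theorem co_D_pow (i : Fin m) (k : ℕ) (α : Fin m → ℕ) (a : Alg F m n) :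
    co α ((D F (Sum.inl i) ^ k) a) = co (α + Pi.single i k) a := by
  induction k generalizing α with
  | zero => simp
  | succ k ih =>
    rw [pow_succ', Module.End.mul_apply, co_D_inl, ih, add_assoc, ← Pi.single_add, add_comm 1 k]

theorem D_pow_mem_truncAlg (i : Fin m) (k : ℕ) {a : Alg F m n} (ha : a ∈ truncAlg F n p t) :
    (D F (Sum.inl i) ^ k) a ∈ truncAlg F n p t := by
  induction k with
  | zero => exact ha
  | succ k ih =>
    rw [pow_succ', Module.End.mul_apply]
    exact D_mem_truncAlg _ ih

theorem D_pow_eq_zero (i : Fin m) {a : Alg F m n} (ha : a ∈ truncAlg F n p t) :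
    (D F (Sum.inl i) ^ p ^ t i) a = 0 :=
  eq_of_co_eq (D_pow_mem_truncAlg i _ ha) (zero_mem _) fun α _ => by
    rw [co_D_pow, co_eq_zero ha (i := i) (by simp), map_zero]

theorem ad_D_pow_mem (i : Fin m) (k : ℕ) {E : Module.End F (Alg F m n)}
    (hE : E ∈ evenW F n p t) :
    (LieAlgebra.ad F (Module.End F (Alg F m n)) (D F (Sum.inl i)) ^ k) E ∈ evenW F n p t := by
  induction k with
  | zero => exact hE
  | succ k ih =>
    rw [pow_succ', Module.End.mul_apply]
    exact (evenW F n p t).lie_mem (D_inl_mem i) ih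

theorem ad_D_pow_apply_X (i : Fin m) (k : ℕ) {E : Module.End F (Alg F m n)}
    (hE : E ∈ evenW F n p t) (s : Fin m ⊕ Fin n) :
    (LieAlgebra.ad F (Module.End F (Alg F m n)) (D F (Sum.inl i)) ^ k) E (X F s) =
      (D F (Sum.inl i) ^ k) (E (X F s)) := by
  induction k with
  | zero => rfl
  | succ k ih =>
    rw [pow_succ', Module.End.mul_apply, pow_succ', Module.End.mul_apply, LieAlgebra.ad_apply,
      lie_D_apply_X i (ad_D_pow_mem i k hE), ih]

theorem apply_quad_eq_zero {v : Module.End F (Alg F m n)} (hv : v ∈ constW F n p t) {k l : Fin n}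
    (j : Fin m) (h : ⁅v, op (Sum.inl j) (X F (Sum.inr k) * X F (Sum.inr l))⁆ = 0) :
    v (X F (Sum.inr k) * X F (Sum.inr l)) = 0 := by
  have h1 := congrArg (fun E => E (X F (Sum.inl j))) h
  simp only [lie_op_apply_X, if_true, LinearMap.zero_apply] at h1
  rwa [D_apply_X_of_mem_constW hv, mul_zero, sub_zero] at h1

/-- An element commuting with the `D_i`, the torus and the `x_k x_l D_j` vanishes. -/
theorem eq_zero_of_lie_eq_zero (hp : 3 < p) (hm : 0 < m) (hn : 2 < n)
    {v : Module.End F (Alg F m n)} (hv : v ∈ evenW F n p t)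
    (h0 : ∀ i, ⁅v, (D F (Sum.inl i) : Module.End F (Alg F m n))⁆ = 0)
    (hT : ∀ r : Fin m ⊕ Fin n, ⁅v, tor F r⁆ = 0)
    (hQ : ∀ k l i, ⁅v, op (Sum.inl i) (X F (Sum.inr k : Fin m ⊕ Fin n) * X F (Sum.inr l))⁆ = 0) :
    v = 0 := by
  have hc : v ∈ constW F n p t :=
    mem_constW.2 ⟨hv, fun i => by rw [← lie_skew, h0, neg_zero]⟩
  exact eq_zero_of_lie_tor hp hn hc (fun r => by rw [← lie_skew, hT, neg_zero]) fun k l _ =>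
    apply_quad_eq_zero hc ⟨0, hm⟩ (hQ k l _)

/-- The coefficients of the value of a derivation at `D_i` have no term of top degree in `x_i`. -/
theorem D_pow_derivation_eq_zero (hp : 3 < p) (hm : 0 < m) (hn : 2 < n) (ht : ∀ i, 0 < t i)
    (δ : LieDerivation F (evenW F n p t) (evenW F n p t)) (i : Fin m) (s : Fin m ⊕ Fin n) :
    (D F (Sum.inl i) ^ (p ^ t i - 1))
      ((δ ⟨D F (Sum.inl i), D_inl_mem i⟩ : Module.End F (Alg F m n)) (X F s)) = 0 := by
  let e : evenW F n p t := ⟨D F (Sum.inl i), D_inl_mem i⟩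
  let L := evenW F n p t
  have hcoe : ∀ k (y : L), (((LieAlgebra.ad F L e ^ k) y : L) : Module.End F (Alg F m n)) =
      (LieAlgebra.ad F (Module.End F (Alg F m n)) (D F (Sum.inl i)) ^ k) y := fun k y => by
    induction k with
    | zero => rfl
    | succ k ih =>
      rw [pow_succ', Module.End.mul_apply, pow_succ', Module.End.mul_apply, ← ih]
      rfl
  have hnil : LieAlgebra.ad F L e ^ p ^ t i = 0 := by
    refine LinearMap.ext fun y => Subtype.ext ?_
    rw [hcoe]
    refine eq_of_apply_X (ad_D_pow_mem i _ y.2) (zero_mem (evenW F n p t)) fun r => ?_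
    rw [ad_D_pow_apply_X i _ y.2, D_pow_eq_zero i (apply_X_mem y.2 r).1]
    rfl
  have hnt : Nontrivial L := by
    refine ⟨e, 0, fun h => ?_⟩
    have h1 : (D F (Sum.inl i) : Module.End F (Alg F m n)) = 0 := congrArg Subtype.val h
    have h2 := congrArg (fun E => E (X F (Sum.inl i))) h1
    simp only [D_X, if_true, LinearMap.zero_apply] at h2
    have h3 := congrArg (co (n := n) (0 : Fin m → ℕ)) h2
    rw [one_eq_mon, co_mon_self, map_zero] at h3
    exact one_ne_zero h3
  have hz := lie_ad_pow_derivation_eq_zero p δ e (t i) hnil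
  have hlie : ∀ y ∈ L, ⁅(((LieAlgebra.ad F L e ^ (p ^ t i - 1)) (δ e) : L) :
      Module.End F (Alg F m n)), y⁆ = 0 := fun y hy =>
    congrArg Subtype.val (hz ⟨y, hy⟩)
  -- The element is central, in particular it commutes with all low-degree fields, so it is zero.
  have h0 := eq_zero_of_lie_eq_zero hp hm hn ((LieAlgebra.ad F L e ^ (p ^ t i - 1)) (δ e)).2
    (fun j => hlie _ (D_inl_mem j)) (fun r => hlie _ (tor_mem ht r))
    (fun k l j => hlie _ (op_mem (r := Sum.inl j) (X_mul_X_mem_homog k l)))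
  rw [hcoe] at h0
  have h2 := ad_D_pow_apply_X i (p ^ t i - 1) (δ e).2 s
  rw [h0] at h2
  exact h2.symm

/-- A truncated element without top terms in `x_i` is a derivative. -/
theorem exists_integral {θ : ZMod 2} {a : Alg F m n} (ha : a ∈ homog F n p t θ) (i : Fin m)
    (htop : (D F (Sum.inl i) ^ (p ^ t i - 1)) a = 0) :
    ∃ b ∈ homog F n p t θ, D F (Sum.inl i) b = a ∧
      ∀ j, j ≠ i → D F (Sum.inl j) a = 0 → D F (Sum.inl j) b = 0 := by
  refine ⟨∑ α ∈ box p t, mon (α + Pi.single i 1) (co α a), sum_mem fun α hα => ?_, ?_, ?_⟩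
  · rw [mem_box] at hα
    by_cases h : α i + 1 < p ^ t i
    · refine mon_mem_homog (fun j => ?_) (co_mem ha.2 α)
      by_cases hj : j = i
      · subst hj
        simpa using h
      · simpa [Pi.single_eq_of_ne hj] using hα j
    -- Here α_i = p^(t_i) - 1, and integrating would leave the truncation. The coefficient at α is
    -- that of the (p^(t_i) - 1)-st derivative at α with its i-th entry set to 0, so it vanishes.
    · have h1 := congrArg (co (Function.update α i 0)) htop
      rw [co_D_pow, map_zero] at h1
      have h2 : Function.update α i 0 + Pi.single i (p ^ t i - 1) = α := by
        funext j
        by_cases hj : j = i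
        · subst hj
          have := hα j
          simp
          omega
        · simp [hj]
      rw [← h2, h1, map_zero]
      exact zero_mem _
  · rw [map_sum]
    conv_rhs => rw [eq_sum_mon ha.1]
    exact Finset.sum_congr rfl fun α _ => D_inl_mon_add i α _
  · intro j hj hja
    rw [map_sum]
    refine Finset.sum_eq_zero fun α _ => ?_
    by_cases h : α j = 0
    · exact D_inl_mon_zero j (by simp [h, Pi.single_eq_of_ne hj]) _
    · obtain ⟨β, rfl⟩ := DividedPow.exists_add j α h
      rw [← co_D_inl, hja]
      simp

/-- The Poincaré lemma: a derivation kills `D_1, …, D_m` up to an inner derivation. -/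
theorem IsDer.exists_kill_D (hd : IsDer n p t d)
    (htop : ∀ i s, (D F (Sum.inl i) ^ (p ^ t i - 1)) (d (D F (Sum.inl i)) (X F s)) = 0) :
    ∃ y ∈ evenW F n p t, ∀ i, (d - LieAlgebra.ad F _ y) (D F (Sum.inl i)) = 0 := by
  suffices H : ∀ s : Finset (Fin m), ∃ y ∈ evenW F n p t, ∀ i ∈ s,
      (d - LieAlgebra.ad F _ y) (D F (Sum.inl i)) = 0 by
    obtain ⟨y, hy, h⟩ := H Finset.univ
    exact ⟨y, hy, fun i => h i (Finset.mem_univ i)⟩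
  intro s
  induction s using Finset.induction_on with
  | empty => exact ⟨0, zero_mem (evenW F n p t), by simp⟩
  | insert i s hi ih =>
    obtain ⟨y, hy, h⟩ := ih
    have hd' := hd.sub (isDer_ad hy)
    set f := (d - LieAlgebra.ad F _ y) (D F (Sum.inl i)) with hf
    have hfL : f ∈ evenW F n p t := hd'.map_mem _ (D_inl_mem i)
    have hpos : 0 < p ^ t i := pow_pos (Fact.out : p.Prime).pos _
    have hcomm : ∀ j, ⁅(D F (Sum.inl j) : Module.End F (Alg F m n)), D F (Sum.inl i)⁆ = 0 :=
      fun j => LinearMap.ext fun a => by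
        rw [lie_apply', D_inl_comm, sub_self, LinearMap.zero_apply]
    -- Earlier corrections change d(D_i) by derivatives along x_i, and D_i^(p^(t_i)) = 0 on the
    -- truncation; the absence of top terms is preserved.
    have hft : ∀ r, (D F (Sum.inl i) ^ (p ^ t i - 1)) (f (X F r)) = 0 := fun r => by
      have h1 : f (X F r) = d (D F (Sum.inl i)) (X F r) + D F (Sum.inl i) (y (X F r)) := by
        rw [hf, LinearMap.sub_apply, LinearMap.sub_apply, LieAlgebra.ad_apply, ← lie_skew,
          LinearMap.neg_apply, lie_D_apply_X i hy, sub_neg_eq_add]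
      rw [h1, map_add, htop, zero_add, ← Module.End.mul_apply, ← pow_succ,
        Nat.sub_add_cancel (Nat.one_le_of_lt hpos), D_pow_eq_zero i (apply_X_mem hy r).1]
    -- Closedness: from [D_j, D_i] = 0 the coefficients of f are killed by each D_j already treated.
    -- Integration in x_i keeps this, so the earlier normalisation survives.
    have hfs : ∀ j ∈ s, ∀ r, D F (Sum.inl j) (f (X F r)) = 0 := fun j hj r => by
      rw [← lie_D_apply_X j hfL]
      have h1 := hd'.leib _ (D_inl_mem j) _ (D_inl_mem i)
      rw [hcomm, map_zero, h j hj, zero_lie, zero_add] at h1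
      rw [← h1, LinearMap.zero_apply]
    choose g hg hgi hgj using fun r => exists_integral (apply_X_mem hfL r) i (hft r)
    set z := ∑ r, op r (g r) with hz
    have hzL : z ∈ evenW F n p t := sum_mem fun r _ => op_mem (hg r)
    have hzX : ∀ r, z (X F r) = g r := fun r => by
      rw [hz, LinearMap.sum_apply, Finset.sum_eq_single r]
      · rw [op_X, if_pos rfl]
      · intro q _ hq
        rw [op_X, if_neg hq]
      · simp
    have hval : ∀ j r, (d - LieAlgebra.ad F _ (y - z)) (D F (Sum.inl j)) (X F r) =
        (d - LieAlgebra.ad F _ y) (D F (Sum.inl j)) (X F r) - D F (Sum.inl j) (g r) := fun j r => by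
      rw [← hzX, ← lie_D_apply_X j hzL, ← lie_skew]
      simp only [LinearMap.sub_apply, map_sub, LieAlgebra.ad_apply, LinearMap.neg_apply]
      abel
    refine ⟨y - z, sub_mem hy hzL, fun j hj => ?_⟩
    refine eq_of_apply_X ((hd.sub (isDer_ad (sub_mem hy hzL))).map_mem _ (D_inl_mem j))
      (zero_mem (evenW F n p t)) fun r => ?_
    rw [hval, LinearMap.zero_apply]
    rcases Finset.mem_insert.1 hj with rfl | hj
    · rw [hgi, hf, sub_self]
    · rw [h j hj, hgj r j (fun e => hi (e ▸ hj)) (hfs j hj r)]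
      simp

end powers

/-! ### Classification of the derivations -/

section classification

variable {F : Type*} [Field F] {m n p : ℕ} [Fact p.Prime] [CharP F p] {t : Fin m → ℕ}
variable {d : Module.End F (Alg F m n) →ₗ[F] Module.End F (Alg F m n)}

/-- The derivation `(ad D_j) ^ (p ^ r) = ad (D_j ^ (p ^ r))`. -/
def powerDer (F : Type*) [Field F] {m : ℕ} (n p : ℕ) (j : Fin m) (r : ℕ) :
    Module.End F (Alg F m n) →ₗ[F] Module.End F (Alg F m n) :=
  LieAlgebra.ad F (Module.End F (Alg F m n)) (D F (Sum.inl j) ^ p ^ r)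

theorem powerDer_eq (j : Fin m) (r : ℕ) :
    powerDer F n p j r =
      LieAlgebra.ad F (Module.End F (Alg F m n)) (D F (Sum.inl j)) ^ p ^ r := by
  have : Nontrivial (Alg F m n) := by
    refine ⟨1, 0, fun h => ?_⟩
    have h3 := congrArg (co (n := n) (0 : Fin m → ℕ)) h
    rw [one_eq_mon, co_mon_self, map_zero] at h3
    exact one_ne_zero h3
  exact (ad_pow_char_pow p _ r).symm

/-- As the commutator with an operator the map is a derivation; as a power of ad D_j it preserves
the Lie algebra, although D_j^(p^r) need not lie in it. -/
theorem isDer_powerDer (j : Fin m) (r : ℕ) : IsDer n p t (powerDer F n p j r) where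
  map_mem E hE := by
    rw [powerDer_eq]
    exact ad_D_pow_mem j _ hE
  leib E _ E' _ := by
    simp only [powerDer, LieAlgebra.ad_apply]
    exact leibniz_lie _ E E'

theorem powerDer_apply_X (j : Fin m) (r : ℕ) {E : Module.End F (Alg F m n)}
    (hE : E ∈ evenW F n p t) (s : Fin m ⊕ Fin n) :
    powerDer F n p j r E (X F s) = (D F (Sum.inl j) ^ p ^ r) (E (X F s)) := by
  rw [powerDer_eq, ad_D_pow_apply_X j _ hE]

theorem powerDer_op (j : Fin m) (r : ℕ) {s : Fin m ⊕ Fin n} {a : Alg F m n}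
    (ha : a ∈ homog F n p t (tau s)) (h : D F (Sum.inl j) (D F (Sum.inl j) a) = 0)
    (hr : 0 < r) : powerDer F n p j r (op s a) = 0 := by
  refine eq_of_apply_X ((isDer_powerDer j r).map_mem _ (op_mem ha)) (zero_mem (evenW F n p t))
    fun q => ?_
  rw [powerDer_apply_X j r (op_mem ha), op_X]
  have h2 : 2 ≤ p ^ r := (Fact.out : p.Prime).two_le.trans (Nat.le_self_pow hr.ne' p)
  split_ifs
  · rw [← Nat.sub_add_cancel h2, pow_add, Module.End.mul_apply, pow_two, Module.End.mul_apply, h,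
      map_zero]
    rfl
  · rw [map_zero]
    rfl

/-- The constant term of an element of `𝔄(m,n)`. -/
def constTerm (F : Type*) [Field F] (m n : ℕ) : Alg F m n →ₗ[F] F :=
  (ExteriorAlgebra.algebraMapInv (R := F) (M := Fin n → F)).toLinearMap ∘ₗ co 0

theorem constTerm_one : constTerm F m n 1 = 1 := by
  change ExteriorAlgebra.algebraMapInv (co 0 (1 : Alg F m n)) = 1
  rw [one_eq_mon, co_mon_self, map_one]

theorem constTerm_D_pow (i j : Fin m) {k l : ℕ} (hk : 0 < k) :
    constTerm F m n ((D F (Sum.inl i) ^ k) (mon (Pi.single j l) 1)) =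
      if i = j ∧ k = l then 1 else 0 := by
  change ExteriorAlgebra.algebraMapInv (co 0 _) = _
  have h : (Pi.single i k = (Pi.single j l : Fin m → ℕ)) ↔ i = j ∧ k = l := by
    constructor
    · intro h
      have h1 := congrFun h i
      rw [Pi.single_eq_same] at h1
      have h2 : i = j := by
        by_contra hij
        rw [Pi.single_eq_of_ne hij] at h1
        omega
      subst h2
      rw [Pi.single_eq_same] at h1
      exact ⟨rfl, h1⟩
    · rintro ⟨rfl, rfl⟩
      rfl
  rw [co_D_pow, zero_add, co_mon]
  simp only [h]
  split_ifs <;> simp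

/-- The index set of the outer derivations `(ad D_j) ^ (p ^ r)`, `1 ≤ r < t_j`. -/
abbrev PowIndex (t : Fin m → ℕ) : Type := Σ j : Fin m, Fin (t j - 1)

/-- The vector field `x_j^(p^r) D_j`. -/
def powField (F : Type*) [Field F] {m : ℕ} (n p : ℕ) (j : Fin m) (r : ℕ) :
    Module.End F (Alg F m n) :=
  op (Sum.inl j) (mon (Pi.single j (p ^ r)) 1)

theorem powField_mem {j : Fin m} {r : ℕ} (hr : r < t j) : powField F n p j r ∈ evenW F n p t :=
  op_mem (r := Sum.inl j) (mon_mem_homog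
    (single_lt_of_lt (Nat.pow_lt_pow_right (Fact.out : p.Prime).one_lt hr)) one_mem_extPart)

/-- The fields x_j^(p^s) D_j and the outer derivations are dual to each other. This determines the
outer coefficients of a derivation and gives their independence. -/
theorem constTerm_powerDer (x y : PowIndex t) :
    constTerm F m n (powerDer F n p x.1 (x.2 + 1) (powField F n p y.1 (y.2 + 1))
      (X F (Sum.inl y.1))) = if x = y then 1 else 0 := by
  obtain ⟨i, r⟩ := x
  obtain ⟨j, s⟩ := y
  have hp := (Fact.out : p.Prime)
  rw [powerDer_apply_X i _ (powField_mem (t := t) (by have := s.2; simp only; omega)), powField,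
    op_X, if_pos rfl, constTerm_D_pow _ _ (pow_pos hp.pos _)]
  by_cases hij : i = j
  · subst hij
    simp only [true_and, Sigma.mk.injEq, heq_eq_eq,
      (Nat.pow_right_injective hp.two_le).eq_iff, Nat.add_right_cancel_iff, Fin.ext_iff]
  · simp [hij]

theorem isDer_sum_powerDer (c : PowIndex t → F) :
    IsDer n p t (∑ x, c x • powerDer F n p x.1 (x.2 + 1)) where
  map_mem E hE := by
    rw [LinearMap.sum_apply]
    exact sum_mem fun x _ => (evenW F n p t).smul_mem _ ((isDer_powerDer _ _).map_mem E hE)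
  leib E hE E' hE' := by
    have h := fun x : PowIndex t => (isDer_powerDer (t := t) x.1 (x.2 + 1)).leib E hE E' hE'
    simp only [LinearMap.sum_apply, LinearMap.smul_apply, h]
    simp only [smul_add, Finset.sum_add_distrib, Ring.lie_def, Finset.sum_mul, Finset.mul_sum,
      smul_mul_assoc, mul_smul_comm, smul_sub, Finset.sum_sub_distrib]

/-- These fields have degree at most one in each even variable, and p^r ≥ 2 derivatives are taken.
Subtracting outer derivations therefore preserves normality. -/
theorem powerDer_low (x : PowIndex t) (ht : ∀ i, 0 < t i) :
    (∀ i, powerDer F n p x.1 (x.2 + 1) (D F (Sum.inl i)) = 0) ∧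
    (∀ r, powerDer F n p x.1 (x.2 + 1) (tor F r) = 0) ∧
    (∀ k l, powerDer F n p x.1 (x.2 + 1) (op (Sum.inr l) (X F (Sum.inr k))) = 0) ∧
    ∀ k l i, powerDer F n p x.1 (x.2 + 1) (op (Sum.inl i) (X F (Sum.inr k) * X F (Sum.inr l))) = 0 := by
  have hX : ∀ (j : Fin m) (r : Fin m ⊕ Fin n), D F (Sum.inl j) (D F (Sum.inl j) (X F r)) = 0 :=
    fun j r => by
      rw [D_X]
      split_ifs
      · exact D_one _
      · exact map_zero _
  refine ⟨fun i => ?_, fun r => ?_, fun k l => ?_, fun k l i => ?_⟩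
  · rw [← op_one]
    exact powerDer_op (t := t) (s := Sum.inl i) _ _ one_mem_homog (by rw [D_one, map_zero])
      (Nat.succ_pos _)
  · exact powerDer_op (t := t) _ _ (X_mem_homog ht r) (hX _ r) (Nat.succ_pos _)
  · exact powerDer_op (t := t) _ _ (gl_mem k l ht) (hX _ _) (Nat.succ_pos _)
  · exact powerDer_op (t := t) (s := Sum.inl i) _ _ (X_mul_X_mem_homog k l)
      (by rw [D_inl_X_mul_X, map_zero]) (Nat.succ_pos _)

/-- Every derivation is the sum of an inner one and a combination of the `(ad D_j) ^ (p ^ r)`. -/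
theorem IsDer.exists_eq (hd : IsDer n p t d) (hp : 3 < p) (hm : 2 < m) (hn : 2 < n)
    (ht : ∀ i, 0 < t i)
    (htop : ∀ i s, (D F (Sum.inl i) ^ (p ^ t i - 1)) (d (D F (Sum.inl i)) (X F s)) = 0) :
    ∃ y ∈ evenW F n p t, ∃ c : PowIndex t → F, ∀ E ∈ evenW F n p t,
      d E = ⁅y, E⁆ + ∑ x, c x • powerDer F n p x.1 (x.2 + 1) E := by
  obtain ⟨y₁, hy₁, h₁⟩ := hd.exists_kill_D htop
  have hd₁ := hd.sub (isDer_ad hy₁)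
  obtain ⟨y₂, hy₂, h₂, h₂'⟩ := hd₁.exists_kill_tor hp (by omega) hn ht h₁
  have hd₂ := hd₁.sub (isDer_ad hy₂)
  obtain ⟨y₃, hy₃, h₃, h₃', h₃''⟩ := hd₂.exists_kill_gl hp hn ht h₂ h₂'
  have hd₃ := hd₂.sub (isDer_ad hy₃)
  obtain ⟨y₄, hy₄, h₄⟩ := hd₃.exists_isNormal hp (by omega) hn ht h₃ h₃' h₃''
  set d₄ := d - LieAlgebra.ad F _ y₁ - LieAlgebra.ad F _ y₂ - LieAlgebra.ad F _ y₃ -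
    LieAlgebra.ad F _ y₄ with hd₄
  -- The coefficients are chosen to cancel the component along D_j of the value at each x_j^(p^r)
  -- D_j.
  let c : PowIndex t → F := fun x =>
    constTerm F m n (d₄ (powField F n p x.1 (x.2 + 1)) (X F (Sum.inl x.1)))
  have hN : IsNormal n p t (d₄ - ∑ x, c x • powerDer F n p x.1 (x.2 + 1)) := by
    refine ⟨h₄.isDer.sub (isDer_sum_powerDer c), fun i => ?_, fun r => ?_, fun k l => ?_,
      fun k l i => ?_⟩
    · simp only [LinearMap.sub_apply, LinearMap.sum_apply, LinearMap.smul_apply, h₄.map_D,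
        (powerDer_low _ ht).1, smul_zero, Finset.sum_const_zero, sub_zero]
    · simp only [LinearMap.sub_apply, LinearMap.sum_apply, LinearMap.smul_apply, h₄.map_tor,
        (powerDer_low _ ht).2.1, smul_zero, Finset.sum_const_zero, sub_zero]
    · simp only [LinearMap.sub_apply, LinearMap.sum_apply, LinearMap.smul_apply, h₄.map_gl,
        (powerDer_low _ ht).2.2.1, smul_zero, Finset.sum_const_zero, sub_zero]
    · simp only [LinearMap.sub_apply, LinearMap.sum_apply, LinearMap.smul_apply, h₄.map_quad,
        (powerDer_low _ ht).2.2.2, smul_zero, Finset.sum_const_zero, sub_zero]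
  have hpow : ∀ j r (e : F), 1 ≤ r → r < t j →
      (d₄ - ∑ x, c x • powerDer F n p x.1 (x.2 + 1))
        (op (Sum.inl j) (mon (Pi.single j (p ^ r)) 1)) = e • D F (Sum.inl j) → e = 0 := by
    intro j r e hr1 hr2 he
    -- The exponents 1 ≤ r < t_j are indexed by r - 1 in `Fin (t j - 1)`.
    let y : PowIndex t := ⟨j, ⟨r - 1, by omega⟩⟩
    have hr : r = y.2 + 1 := by simp only [y]; omega
    have h1 := congrArg (fun E => constTerm F m n (E (X F (Sum.inl j)))) he
    have h2 : op (Sum.inl j) (mon (Pi.single j (p ^ r)) 1) = powField F n p y.1 (y.2 + 1) := by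
      rw [← hr]
      rfl
    simp only [h2, LinearMap.sub_apply, LinearMap.sum_apply, LinearMap.smul_apply, map_sub,
      map_sum, map_smul, D_X, if_true, constTerm_one, smul_eq_mul, mul_one] at h1
    rw [← h1, show (Sum.inl j : Fin m ⊕ Fin n) = Sum.inl y.1 from rfl]
    simp only [constTerm_powerDer, mul_ite, mul_one, mul_zero, Finset.sum_ite_eq',
      Finset.mem_univ, if_true]
    exact sub_self _
  refine ⟨y₁ + y₂ + y₃ + y₄, add_mem (add_mem (add_mem hy₁ hy₂) hy₃) hy₄, c, fun E hE => ?_⟩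
  have h := hN.eq_zero hp hm ht (fun α hα i => hN.mon_mem_ker hp hm hn ht hpow hα i) hE
  simp only [hd₄, LinearMap.sub_apply, LinearMap.sum_apply, LinearMap.smul_apply,
    LieAlgebra.ad_apply] at h
  rw [add_lie, add_lie, add_lie]
  have h' := sub_eq_zero.1 h
  rw [← h']
  abel

/-- The derivation of the Lie algebra induced by a map on operators. -/
def IsDer.toLieDerivation (hd : IsDer n p t d) :
    LieDerivation F (evenW F n p t) (evenW F n p t) where
  toLinearMap := LinearMap.restrict (p := (evenW F n p t).toSubmodule)
    (q := (evenW F n p t).toSubmodule) d hd.map_mem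
  leibniz' a b := Subtype.ext <| by
    have h := hd.leib a a.2 b b.2
    rw [← lie_skew (d a) (b : Module.End F (Alg F m n)), ← sub_eq_neg_add] at h
    exact h

/-- The derivation is extended linearly, and arbitrarily, to all operators. Nothing is claimed off
the Lie algebra, which is why `IsDer` only constrains values there. -/
theorem exists_isDer (δ : LieDerivation F (evenW F n p t) (evenW F n p t)) :
    ∃ d : Module.End F (Alg F m n) →ₗ[F] Module.End F (Alg F m n), IsDer n p t d ∧
      ∀ a : evenW F n p t, d a = δ a := by
  obtain ⟨d, hd⟩ := LinearMap.exists_extend (p := (evenW F n p t).toSubmodule)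
    ((evenW F n p t).toSubmodule.subtype ∘ₗ (δ : evenW F n p t →ₗ[F] evenW F n p t))
  have hd' : ∀ a : evenW F n p t, d a = δ a := fun a => LinearMap.congr_fun hd a
  refine ⟨d, ⟨fun E hE => ?_, fun E hE E' hE' => ?_⟩, hd'⟩
  · have := hd' ⟨E, hE⟩
    simp only at this
    rw [this]
    exact Subtype.property _
  · have h1 := hd' ⁅(⟨E, hE⟩ : evenW F n p t), (⟨E', hE'⟩ : evenW F n p t)⁆
    rw [LieDerivation.apply_lie_eq_add] at h1
    have h2 := hd' ⟨E, hE⟩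
    have h3 := hd' ⟨E', hE'⟩
    simp only at h2 h3
    rw [h2, h3, add_comm]
    exact h1

variable (F n p t) in
/-- Inner derivations and combinations of the `(ad D_j) ^ (p ^ r)`. -/
def derMap : (evenW F n p t × (PowIndex t → F)) →ₗ[F]
    LieDerivation F (evenW F n p t) (evenW F n p t) :=
  (LieDerivation.inner F (evenW F n p t) (evenW F n p t)).coprod
    (Fintype.linearCombination F fun x : PowIndex t =>
      (isDer_powerDer (F := F) (n := n) (p := p) (t := t) x.1 (x.2 + 1)).toLieDerivation)

theorem coe_derMap (y : evenW F n p t) (c : PowIndex t → F) (a : evenW F n p t) :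
    (derMap F n p t (y, c) a : Module.End F (Alg F m n)) =
      ⁅(a : Module.End F (Alg F m n)), (y : Module.End F (Alg F m n))⁆ +
        ∑ x, c x • powerDer F n p x.1 (x.2 + 1) a := by
  have h : ∀ s : Finset (PowIndex t), ((∑ x ∈ s, c x •
      (isDer_powerDer (F := F) (n := n) (p := p) (t := t) x.1 (x.2 + 1)).toLieDerivation :
      LieDerivation F (evenW F n p t) (evenW F n p t)) a : Module.End F (Alg F m n)) =
      ∑ x ∈ s, c x • powerDer F n p x.1 (x.2 + 1) a := fun s => by
    induction s using Finset.induction_on with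
    | empty => rfl
    | insert i s hi ih =>
      rw [Finset.sum_insert hi, Finset.sum_insert hi, ← ih]
      rfl
  rw [← h]
  rfl

theorem derMap_bijective (hp : 3 < p) (hm : 2 < m) (hn : 2 < n) (ht : ∀ i, 0 < t i) :
    Function.Bijective (derMap F n p t) := by
  constructor
  · rw [injective_iff_map_eq_zero]
    rintro ⟨y, c⟩ h
    have h' : ∀ E ∈ evenW F n p t, ⁅E, (y : Module.End F (Alg F m n))⁆ +
        ∑ x, c x • powerDer F n p x.1 (x.2 + 1) E = 0 := fun E hE => by
      rw [← coe_derMap y c ⟨E, hE⟩, h]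
      rfl
    have hlow : ∀ E ∈ evenW F n p t, (∀ x : PowIndex t, powerDer F n p x.1 (x.2 + 1) E = 0) →
        ⁅(y : Module.End F (Alg F m n)), E⁆ = 0 := fun E hE hx => by
      have h1 := h' E hE
      simp only [hx, smul_zero, Finset.sum_const_zero, add_zero] at h1
      rw [← lie_skew, h1, neg_zero]
    -- On low-degree fields the outer part vanishes, so y commutes with them and is zero.
    have hy : (y : Module.End F (Alg F m n)) = 0 :=
      eq_zero_of_lie_eq_zero hp (by omega) hn y.2
        (fun i => hlow _ (D_inl_mem i) fun x => (powerDer_low x ht).1 i)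
        (fun r => hlow _ (tor_mem ht r) fun x => (powerDer_low x ht).2.1 r)
        (fun k l i => hlow _ (op_mem (r := Sum.inl i) (X_mul_X_mem_homog k l))
          fun x => (powerDer_low x ht).2.2.2 k l i)
    refine Prod.ext (Subtype.ext hy) (funext fun x => ?_)
    have h1 := h' (powField F n p x.1 (x.2 + 1)) (powField_mem (by have := x.2.2; omega))
    rw [hy, lie_zero, zero_add] at h1
    have h2 := congrArg (fun E => constTerm F m n (E (X F (Sum.inl x.1)))) h1
    change c x = 0
    simpa only [LinearMap.sum_apply, LinearMap.smul_apply, map_sum, map_smul, constTerm_powerDer,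
      smul_eq_mul, mul_ite, mul_one, mul_zero, Finset.sum_ite_eq', Finset.mem_univ, if_true,
      LinearMap.zero_apply, map_zero] using h2
  · intro δ
    obtain ⟨d, hd, hδ⟩ := exists_isDer δ
    obtain ⟨y, hy, c, h⟩ := hd.exists_eq hp hm hn ht fun i s => by
      have := D_pow_derivation_eq_zero hp (by omega) hn ht δ i s
      rwa [← hδ] at this
    -- The sign appears because `LieDerivation.inner` is a ↦ [a, y].
    refine ⟨(⟨-y, neg_mem hy⟩, c), LieDerivation.ext fun a => Subtype.ext ?_⟩
    rw [coe_derMap, ← hδ, h a a.2, lie_neg, lie_skew]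

/-- The coefficients of a vector field. -/
def coeffMap (F : Type*) [Field F] {m : ℕ} (n p : ℕ) [Fact p.Prime] [CharP F p] (t : Fin m → ℕ) :
    evenW F n p t →ₗ[F] ((r : Fin m ⊕ Fin n) → homog F n p t (tau r)) where
  toFun E r := ⟨(E : Module.End F (Alg F m n)) (X F r), apply_X_mem E.2 r⟩
  map_add' _ _ := rfl
  map_smul' _ _ := rfl

theorem coeffMap_bijective : Function.Bijective (coeffMap F n p t) := by
  constructor
  · intro E E' h
    refine Subtype.ext (eq_of_apply_X E.2 E'.2 fun r => ?_)
    exact congrArg Subtype.val (congrFun h r)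
  · intro f
    refine ⟨⟨∑ r, op r (f r).1, sum_mem fun r _ => op_mem (f r).2⟩, funext fun s => Subtype.ext ?_⟩
    change (∑ r, op r (f r).1) (X F s) = _
    rw [LinearMap.sum_apply, Finset.sum_eq_single s]
    · rw [op_X, if_pos rfl]
    · intro q _ hq
      rw [op_X, if_neg hq]
    · simp

instance : Module.Finite F (evenW F n p t) :=
  Module.Finite.of_injective (coeffMap F n p t) coeffMap_bijective.1

theorem finrank_evenW (hn : 0 < n) :
    Module.finrank F (evenW F n p t) = (m + n) * (p ^ (∑ i, t i) * 2 ^ (n - 1)) := by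
  rw [(LinearEquiv.ofBijective _ (coeffMap_bijective (F := F) (n := n) (p := p) (t := t))).finrank_eq,
    Module.finrank_pi_fintype]
  simp only [finrank_homog hn, Finset.sum_const, Finset.card_univ, Fintype.card_sum,
    Fintype.card_fin, smul_eq_mul]

end classification

end WittSuper
end

/-! ### The dimension count -/

theorem corollary5p1p3 {F : Type*} [Field F] (p : ℕ) [Fact p.Prime] [CharP F p] (hp : 3 < p)
    (m n : ℕ) (hm : 2 < m) (hn : 2 < n) (t : Fin m → ℕ) (ht : ∀ i, 0 < t i) :
    Module.Finite F (LieDerivation F (WittSuper.evenW F n p t) (WittSuper.evenW F n p t)) ∧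
      (Module.finrank F
          (LieDerivation F (WittSuper.evenW F n p t) (WittSuper.evenW F n p t)) : ℤ) =
        (m + n) * 2 ^ (n - 1) * (p : ℤ) ^ (∑ i, t i) + ∑ i, (t i : ℤ) - m := by
  let e := LinearEquiv.ofBijective (WittSuper.derMap F n p t)
    (WittSuper.derMap_bijective hp hm hn ht)
  refine ⟨Module.Finite.equiv e, ?_⟩
  rw [← e.finrank_eq, Module.finrank_prod, WittSuper.finrank_evenW (by omega),
    Module.finrank_fintype_fun_eq_card, Fintype.card_sigma]
  -- As t_i ≥ 1, the truncated subtraction counting the outer derivations is a genuine one.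
  have h : ∀ i, ((t i - 1 : ℕ) : ℤ) = t i - 1 := fun i => by
    have := ht i
    omega
  simp only [Fintype.card_fin]
  push_cast [h]
  rw [Finset.sum_sub_distrib]
  simp
  ring
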